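/- **Definitions.** Lie algebras are over $\mathbb R$, Lie groups are smooth and finite-dimensional. A *symmetric Lie algebra* $(\mathfrak h,s)$ is a Lie algebra $\mathfrak h$ with a Lie algebra automorphism $s$ such that $s^2=\mathrm{id}$. An *invariant Legendrian form* on $(\mathfrak h,s)$ is a nondegenerate symmetric bilinear form $\Lambda:\mathfrak h\times\mathfrak h\to\mathbb R$ such that $\Lambda(sx,y)=-\Lambda(x,sy)$ and $\Lambda([z,x],y)=-\Lambda(x,[z,y])$ for all $x,y,z\in\mathfrak h$. If $H$ is a Lie group and $K\subseteq H$ a closed subgroup, $(H,K)$ is a *symmetric pair* if there is a smooth automorphism $\sigma$ of $H$ with $\sigma^2=\mathrm{id}$, $\sigma\neq\mathrm{id}$ and $(H^\sigma)_0\subseteq K\subseteq H^\sigma$, where $H^\sigma$ is the fixed point group and $(H^\sigma)_0$ its identity component. It is a *Legendrian symmetric pair* if moreover $\mathfrak h=\mathrm{Lie}(H)$ with $s=d\sigma_e$ admits an invariant Legendrian form $\Lambda$ that satisfies $\Lambda(\mathrm{Ad}_hx,y)=\Lambda(x,\mathrm{Ad}_{h^{-1}}y)$ for all $h\in H$ and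 $x,y\in\mathfrak h$. An *invariant inner product* on a Lie algebra $\mathfrak g$ is a positive definite symmetric bilinear form $B$ such that $B([z,x],y)=-B(x,[z,y])$ for all $x,y,z\in\mathfrak g$. **Proposition.** In the statements about groups, $G$ is a Lie group with $\dim G>0$ and $\mathfrak g=\mathrm{Lie}(G)$. (a) Let $\mathfrak g$ be a Lie algebra and let $\mathfrak h_0=\mathfrak g\rtimes\mathfrak g^*$ with bracket $[\xi\rtimes\lambda,\eta\rtimes\mu]=[\xi,\eta]\rtimes(\mathrm{ad}^*_\xi\mu-\mathrm{ad}^*_\eta\lambda)$, where $\mathrm{ad}^*_\xi\mu=-\mu\circ\mathrm{ad}_\xi$, and involution $s_0(\xi\rtimes\lambda)=\xi\rtimes(-\lambda)$. Then $$\Lambda_0(\xi_1\rtimes\lambda_1,\xi_2\rtimes\lambda_2)=\langle\xi_1,\lambda_2\rangle+\langle\xi_2,\lambda_1\rangle$$ is an invariant Legendrian form on $(\mathfrak h_0,s_0)$. Let $H_0=G\rtimes\mathfrak g^*$ be the manifold $G\times\mathfrak g^*$ with the product $(g_1,\ell_1)(g_2,\ell_2)=(g_1g_2,\ell_1+\mathrm{Ad}^*_{g_1}\ell_2)$,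 where $\mathrm{Ad}^*_g\ell=\ell\circ\mathrm{Ad}_{g^{-1}}$. Then $(H_0,G)$, with $G$ embedded as $G\times\{0\}$, is a Legendrian symmetric pair, by means of $\sigma_0(g,\ell)=(g,-\ell)$ and of the form $\Lambda_0$; its symmetric Lie algebra is $(\mathfrak h_0,s_0)$. (b) Let $\mathfrak g$ be a Lie algebra with an invariant inner product $B$, and let $\mathfrak h_+=\mathfrak g\times\mathfrak g$ with involution $s_+(\xi,\eta)=(\eta,\xi)$. Then $$\Lambda_+\big((\xi_1,\eta_1),(\xi_2,\eta_2)\big)=\tfrac12\big(B(\xi_1,\xi_2)-B(\eta_1,\eta_2)\big)$$ is an invariant Legendrian form on $(\mathfrak h_+,s_+)$. If $G$ is connected and $B$ is an invariant inner product on $\mathfrak g=\mathrm{Lie}(G)$, then $(G\times G,\Delta(G))$, where $\Delta(G)$ is the diagonal, is a Legendrian symmetric pair, by means of $\sigma_+(g_1,g_2)=(g_2,g_1)$ and of the form $\Lambda_+$; its symmetric Lie algebra is $(\mathfrak h_+,s_+)$. (c) Let $\mathfrak g$ be a Lie algebra with an invariant inner product $B$, and let $\mathfrak h_-=\mathfrak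 g\otimes\mathbb C$, regarded as a real Lie algebra, with involution $s_-(\xi+\sqrt{-1}\,\eta)=\xi-\sqrt{-1}\,\eta$. Then $B$ extends to a nondegenerate symmetric invariant $\mathbb C$-bilinear form $B^{\mathbb C}$ on $\mathfrak h_-$, and $$\Lambda_-(\zeta_1,\zeta_2)=\operatorname{Im}B^{\mathbb C}(\zeta_1,\zeta_2)$$ is an invariant Legendrian form on $(\mathfrak h_-,s_-)$. Let $G$ be simply connected and let $B$ be an invariant inner product on $\mathfrak g=\mathrm{Lie}(G)$. Let $G^{\mathbb C}$ be a simply connected complex Lie group that contains $G$ as a Lie subgroup and whose Lie algebra is $\mathfrak g\otimes\mathbb C$, in the sense that the $\mathbb C$-linear extension $\mathfrak g\otimes\mathbb C\to\mathrm{Lie}(G^{\mathbb C})$ of the differential of the inclusion is bijective. Then $(G^{\mathbb C},G)$ is a Legendrian symmetric pair, by means of an involution whose differential is $s_-$ and of the form $\Lambda_-$; its symmetric Lie algebra is $(\mathfrak h_-,s_-)$. -/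

import Mathlib

open scoped Manifold ContDiff TensorProduct

noncomputable section

/-! ### Legendrian forms on symmetric Lie algebras -/

/-- A Legendrian form on a vector space `W` with involution `s`: a nondegenerate symmetric
bilinear form for which `s` is skew. -/
structure IsLegendrianForm {k W : Type*} [Field k] [AddCommGroup W] [Module k W]
    (s : W →ₗ[k] W) (L : LinearMap.BilinForm k W) : Prop where
  involutive : ∀ w, s (s w) = w
  symm : L.IsSymm
  nondegenerate : L.Nondegenerate
  skew : ∀ w₁ w₂, L (s w₁) w₂ = -L w₁ (s w₂)

/-- Invariance of a bilinear form under the adjoint action of a Lie algebra on itself. -/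
def IsAdInvariant {k W : Type*} [Field k] [AddCommGroup W] [Module k W] [Bracket W W]
    (L : LinearMap.BilinForm k W) : Prop :=
  ∀ x y z : W, L ⁅x, y⁆ z = -L y ⁅x, z⁆

/-- `(𝔥, s)` is a symmetric Lie algebra (`s` is a Lie algebra endomorphism and, by the first clause
of `IsLegendrianForm`, an involution), and `L` is an invariant Legendrian form on it. -/
structure IsLegendrianStructure {𝔥 : Type*} [LieRing 𝔥] [LieAlgebra ℝ 𝔥]
    (s : 𝔥 →ₗ⁅ℝ⁆ 𝔥) (L : LinearMap.BilinForm ℝ 𝔥) : Prop where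
  legendrian : IsLegendrianForm (s : 𝔥 →ₗ[ℝ] 𝔥) L
  invariant : IsAdInvariant L

/-- An invariant inner product on a real Lie algebra. -/
structure IsInvariantInnerProduct {𝔤 : Type*} [LieRing 𝔤] [LieAlgebra ℝ 𝔤]
    (B : LinearMap.BilinForm ℝ 𝔤) : Prop where
  symm : B.IsSymm
  pos : ∀ x, x ≠ 0 → 0 < B x x
  invariant : IsAdInvariant B

/-! ### The Lie algebra `𝔤 ⋊ 𝔤*` -/

/-- The underlying space of `𝔤 ⋊ 𝔤*`. -/
@[ext]
structure CoadjointLie (𝔤 : Type*) [LieRing 𝔤] [LieAlgebra ℝ 𝔤] where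
  /-- The component in `𝔤`. -/
  left : 𝔤
  /-- The component in `𝔤*`. -/
  right : Module.Dual ℝ 𝔤

namespace CoadjointLie

variable (𝔤 : Type*) [LieRing 𝔤] [LieAlgebra ℝ 𝔤]

/-- The underlying space of `𝔤 ⋊ 𝔤*` is `𝔤 × 𝔤*`. -/
def toProd : CoadjointLie 𝔤 ≃ 𝔤 × Module.Dual ℝ 𝔤 where
  toFun x := (x.left, x.right)
  invFun x := ⟨x.1, x.2⟩
  left_inv _ := rfl
  right_inv _ := rfl

instance : AddCommGroup (CoadjointLie 𝔤) := (toProd 𝔤).addCommGroup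

instance : Module ℝ (CoadjointLie 𝔤) := (toProd 𝔤).module ℝ

/-- The underlying vector space of `𝔤 ⋊ 𝔤*` is `𝔤 × 𝔤*`. -/
def toProdₗ : CoadjointLie 𝔤 ≃ₗ[ℝ] 𝔤 × Module.Dual ℝ 𝔤 :=
  { toProd 𝔤 with
    map_add' := fun _ _ => rfl
    map_smul' := fun _ _ => rfl }

/-- `[ξ ⋊ l, η ⋊ m] = [ξ, η] ⋊ (ad*_ξ m - ad*_η l)`, where `(ad*_ξ m)(ζ) = -m [ξ, ζ]` is Mathlib's
`⁅ξ, m⁆`. -/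
instance : Bracket (CoadjointLie 𝔤) (CoadjointLie 𝔤) where
  bracket x y := ⟨⁅x.left, y.left⁆, ⁅x.left, y.right⁆ - ⁅y.left, x.right⁆⟩

variable {𝔤}

@[simp] theorem left_lie (x y : CoadjointLie 𝔤) : ⁅x, y⁆.left = ⁅x.left, y.left⁆ := rfl

@[simp] theorem right_lie (x y : CoadjointLie 𝔤) :
    ⁅x, y⁆.right = ⁅x.left, y.right⁆ - ⁅y.left, x.right⁆ := rfl

@[simp] theorem left_zero : (0 : CoadjointLie 𝔤).left = 0 := rfl

@[simp] theorem right_zero : (0 : CoadjointLie 𝔤).right = 0 := rfl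

@[simp] theorem left_add (x y : CoadjointLie 𝔤) : (x + y).left = x.left + y.left := rfl

@[simp] theorem right_add (x y : CoadjointLie 𝔤) : (x + y).right = x.right + y.right := rfl

@[simp] theorem left_smul (c : ℝ) (x : CoadjointLie 𝔤) : (c • x).left = c • x.left := rfl

@[simp] theorem right_smul (c : ℝ) (x : CoadjointLie 𝔤) : (c • x).right = c • x.right := rfl

variable (𝔤)

instance : LieRing (CoadjointLie 𝔤) where
  add_lie x y z := by
    ext <;> simp; ring
  lie_add x y z := by
    ext <;> simp; ring
  lie_self x := by
    ext <;> simp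
  leibniz_lie x y z := by
    ext <;> simp; ring

instance : LieAlgebra ℝ (CoadjointLie 𝔤) where
  lie_smul c x y := by
    ext <;> simp; ring

/-- The involution `s₀ (ξ ⋊ l) = ξ ⋊ (-l)`. -/
def involution : CoadjointLie 𝔤 →ₗ⁅ℝ⁆ CoadjointLie 𝔤 where
  toFun x := ⟨x.left, -x.right⟩
  map_add' x y := by ext <;> simp; ring
  map_smul' c x := by ext <;> simp
  map_lie' {x y} := by ext <;> simp; ring

/-- The pairing `Λ₀ (ξ₁ ⋊ l₁, ξ₂ ⋊ l₂) = ⟨ξ₁, l₂⟩ + ⟨ξ₂, l₁⟩`. -/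
def pairing : LinearMap.BilinForm ℝ (CoadjointLie 𝔤) :=
  LinearMap.mk₂ ℝ (fun x y => y.right x.left + x.right y.left)
    (fun x y z => by simp; ring) (fun c x y => by simp; ring)
    (fun x y z => by simp; ring) (fun c x y => by simp; ring)

end CoadjointLie

/-! ### The Lie algebra `𝔤 × 𝔤` -/

/-- The involution `s₊ (ξ, η) = (η, ξ)` of the product Lie algebra `𝔤 × 𝔤`. -/
def swapInvolution (𝔤 : Type*) [LieRing 𝔤] [LieAlgebra ℝ 𝔤] : 𝔤 × 𝔤 →ₗ⁅ℝ⁆ 𝔤 × 𝔤 :=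
  (LieHom.snd ℝ 𝔤 𝔤).prod (LieHom.fst ℝ 𝔤 𝔤)

/-- The pairing `Λ₊ ((ξ₁, η₁), (ξ₂, η₂)) = (B ξ₁ ξ₂ - B η₁ η₂) / 2`. -/
def productPairing {𝔤 : Type*} [LieRing 𝔤] [LieAlgebra ℝ 𝔤] (B : LinearMap.BilinForm ℝ 𝔤) :
    LinearMap.BilinForm ℝ (𝔤 × 𝔤) :=
  LinearMap.mk₂ ℝ (fun x y => (1 / 2 : ℝ) * (B x.1 y.1 - B x.2 y.2))
    (fun x y z => by simp only [Prod.fst_add, Prod.snd_add, map_add, LinearMap.add_apply]; ring)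
    (fun c x y => by
      simp only [Prod.smul_fst, Prod.smul_snd, map_smul, LinearMap.smul_apply, smul_eq_mul]; ring)
    (fun x y z => by simp only [Prod.fst_add, Prod.snd_add, map_add]; ring)
    (fun c x y => by simp only [Prod.smul_fst, Prod.smul_snd, map_smul, smul_eq_mul]; ring)

/-! ### The Lie algebra `𝔤 ⊗ ℂ` -/

/-- The conjugation `s₋ (ξ + √-1 η) = ξ - √-1 η` of `𝔤 ⊗ ℂ`, regarded as a real Lie algebra. -/
def conjInvolution (𝔤 : Type*) [LieRing 𝔤] [LieAlgebra ℝ 𝔤] : ℂ ⊗[ℝ] 𝔤 →ₗ⁅ℝ⁆ ℂ ⊗[ℝ] 𝔤 :=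
  LieAlgebra.ExtendScalars.map (Complex.conjAe : ℂ →ₐ[ℝ] ℂ) LieHom.id

/-- The pairing `Λ₋ = Im B^ℂ`, where `B^ℂ` is the complex bilinear extension of `B`. -/
def imPairing {𝔤 : Type*} [LieRing 𝔤] [LieAlgebra ℝ 𝔤] (B : LinearMap.BilinForm ℝ 𝔤) :
    LinearMap.BilinForm ℝ (ℂ ⊗[ℝ] 𝔤) :=
  LinearMap.mk₂ ℝ (fun z w => (B.baseChange ℂ z w).im)
    (fun x y z => by simp)
    (fun c x y => by
      rw [← algebraMap_smul ℂ c x, map_smul]; simp)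
    (fun x y z => by simp)
    (fun c x y => by
      rw [← algebraMap_smul ℂ c y, map_smul]; simp)

/-! ### Lie groups and Legendrian symmetric pairs -/

section LieGroups

variable {E : Type*} [NormedAddCommGroup E] [NormedSpace ℝ E]
  {M : Type*} [TopologicalSpace M] {I : ModelWithCorners ℝ E M}
  {E' : Type*} [NormedAddCommGroup E'] [NormedSpace ℝ E']
  {M' : Type*} [TopologicalSpace M'] {I' : ModelWithCorners ℝ E' M'}
  {H : Type*} [TopologicalSpace H] [ChartedSpace M H] [Group H]
  {H' : Type*} [TopologicalSpace H'] [ChartedSpace M' H'] [Group H']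

variable (I) in
/-- The adjoint action `Ad_h` of a Lie group on its Lie algebra, the differential at `1` of
`x ↦ h x h⁻¹`. (Its values lie in the tangent space at `h 1 h⁻¹ = 1`.) -/
def groupAd (h : H) : GroupLieAlgebra I H →L[ℝ] GroupLieAlgebra I H :=
  mfderiv I I (fun x : H => h * x * h⁻¹) 1

variable (I I') in
/-- The differential at `1` of a homomorphism of Lie groups, as a map of Lie algebras. -/
def lieDifferential (f : H →* H') : GroupLieAlgebra I H →L[ℝ] GroupLieAlgebra I' H' :=
  mfderiv I I' f 1

variable (I) in
/-- `(H, K)` is a symmetric pair by means of the involution `σ`. -/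
structure IsSymmetricPairWith (K : Subgroup H) (σ : H →* H) : Prop where
  lieGroup : LieGroup I ∞ H
  isClosed : IsClosed (K : Set H)
  contMDiff : ContMDiff I I ∞ σ
  involutive : ∀ h, σ (σ h) = h
  ne_id : σ ≠ MonoidHom.id H
  /-- The identity component of the fixed point group is contained in `K`. -/
  component_subset : connectedComponentIn {h : H | σ h = h} 1 ⊆ K
  le_fixed : ∀ h ∈ K, σ h = h

variable (I) in
/-- `(H, K)` is a Legendrian symmetric pair by means of the involution `σ` of `H` and the form `L`
on the Lie algebra of `H`. -/
structure IsLegendrianSymmetricPairWith (K : Subgroup H) (σ : H →* H)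
    (L : LinearMap.BilinForm ℝ (GroupLieAlgebra I H)) : Prop where
  symmetricPair : IsSymmetricPairWith I K σ
  legendrian : IsLegendrianForm
    (lieDifferential I I σ : GroupLieAlgebra I H →ₗ[ℝ] GroupLieAlgebra I H) L
  adInvariant : IsAdInvariant L
  groupInvariant : ∀ (h : H) (x y : GroupLieAlgebra I H),
    L (groupAd I h x) y = L x (groupAd I h⁻¹ y)

variable (I) in
/-- `(H, K)` is a Legendrian symmetric pair. -/
def IsLegendrianSymmetricPair (K : Subgroup H) : Prop :=
  ∃ (σ : H →* H) (L : LinearMap.BilinForm ℝ (GroupLieAlgebra I H)),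
    IsLegendrianSymmetricPairWith I K σ L

variable (I) in
/-- `(H, K)` is a Legendrian symmetric pair by means of the involution `σ`; under the
identification `φ` of Lie algebras, the associated symmetric Lie algebra is `(𝔥, s)` and the
Legendrian form is `L`. -/
structure IsLegendrianSymmetricPairVia {𝔥 : Type*} [LieRing 𝔥] [LieAlgebra ℝ 𝔥]
    (K : Subgroup H) (σ : H →* H) (s : 𝔥 →ₗ⁅ℝ⁆ 𝔥) (L : LinearMap.BilinForm ℝ 𝔥)
    (φ : 𝔥 ≃ₗ[ℝ] GroupLieAlgebra I H) : Prop where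
  map_lie : ∀ x y : 𝔥, φ ⁅x, y⁆ = ⁅φ x, φ y⁆
  differential : ∀ x : 𝔥, lieDifferential I I σ (φ x) = φ (s x)
  pair : IsLegendrianSymmetricPairWith I K σ (LinearMap.BilinForm.congr φ L)

end LieGroups

instance lieGroup_minSmoothness {E : Type*} [NormedAddCommGroup E] [NormedSpace ℝ E]
    {M : Type*} [TopologicalSpace M] {I : ModelWithCorners ℝ E M}
    {G : Type*} [TopologicalSpace G] [ChartedSpace M G] [Group G] [LieGroup I ∞ G] :
    LieGroup I (minSmoothness ℝ 3) G := by
  rw [minSmoothness_of_isRCLikeNormedField]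
  infer_instance

instance completeSpace_of_finiteDimensional_real (E : Type*) [NormedAddCommGroup E]
    [NormedSpace ℝ E] [FiniteDimensional ℝ E] : CompleteSpace E :=
  FiniteDimensional.complete ℝ E

section GroupExamples

variable {E : Type*} [NormedAddCommGroup E] [NormedSpace ℝ E]
  {G : Type*} [TopologicalSpace G] [ChartedSpace E G] [Group G]

section Ad

theorem groupAd_one : groupAd 𝓘(ℝ, E) (1 : G) = ContinuousLinearMap.id ℝ _ := by
  have h : (fun x : G => 1 * x * 1⁻¹) = id := by ext; simp
  unfold groupAd
  rw [h]
  exact mfderiv_id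

variable [LieGroup 𝓘(ℝ, E) ∞ G]

theorem contMDiff_conj (g : G) :
    ContMDiff 𝓘(ℝ, E) 𝓘(ℝ, E) ∞ (fun x : G => g * x * g⁻¹) :=
  (contMDiff_const.mul contMDiff_id).mul contMDiff_const

theorem groupAd_mul (g h : G) :
    groupAd 𝓘(ℝ, E) (g * h) = (groupAd 𝓘(ℝ, E) g).comp (groupAd 𝓘(ℝ, E) h) := by
  have e : (fun x : G => g * h * x * (g * h)⁻¹) =
      (fun x : G => g * x * g⁻¹) ∘ (fun x : G => h * x * h⁻¹) := by
    ext x; simp [mul_assoc]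
  unfold groupAd
  rw [e]
  have d (k x : G) : MDifferentiableAt 𝓘(ℝ, E) 𝓘(ℝ, E) (fun x : G => k * x * k⁻¹) x :=
    (contMDiff_conj k).mdifferentiableAt (by simp)
  ext v
  exact mfderiv_comp_apply_of_eq 1 (d g 1) (d h 1) (by simp) v

end Ad

variable (E G) in
/-- The group `G ⋊ 𝔤*`, as the product manifold `G × 𝔤*`. Here `𝔤*` is `E →L[ℝ] ℝ`, since the Lie
algebra of `G` is, as a vector space, the model space `E`. -/
def CoadjointGroup : Type _ := G × (E →L[ℝ] ℝ)

namespace CoadjointGroup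

variable (E) in
/-- The model of the manifold `G × 𝔤*`. -/
abbrev model : ModelWithCorners ℝ (E × (E →L[ℝ] ℝ)) (ModelProd E (E →L[ℝ] ℝ)) :=
  𝓘(ℝ, E).prod 𝓘(ℝ, E →L[ℝ] ℝ)

instance : TopologicalSpace (CoadjointGroup E G) :=
  inferInstanceAs (TopologicalSpace (G × (E →L[ℝ] ℝ)))

instance : ChartedSpace (ModelProd E (E →L[ℝ] ℝ)) (CoadjointGroup E G) :=
  inferInstanceAs (ChartedSpace (ModelProd E (E →L[ℝ] ℝ)) (G × (E →L[ℝ] ℝ)))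

/-- The coadjoint action `Ad*_g l = l ∘ Ad_{g⁻¹}` of `G` on `𝔤*`. -/
def coAd (g : G) (l : E →L[ℝ] ℝ) : E →L[ℝ] ℝ :=
  l.comp (groupAd 𝓘(ℝ, E) g⁻¹ : E →L[ℝ] E)

theorem coAd_add (g : G) (l m : E →L[ℝ] ℝ) : coAd g (l + m) = coAd g l + coAd g m := rfl

theorem coAd_neg (g : G) (l : E →L[ℝ] ℝ) : coAd g (-l) = -coAd g l := rfl

theorem coAd_zero (g : G) : coAd g (0 : E →L[ℝ] ℝ) = 0 := rfl

theorem coAd_one (l : E →L[ℝ] ℝ) : coAd (1 : G) l = l := by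
  unfold coAd
  rw [inv_one, groupAd_one]
  rfl

variable [LieGroup 𝓘(ℝ, E) ∞ G]

theorem coAd_mul (g h : G) (l : E →L[ℝ] ℝ) : coAd (g * h) l = coAd g (coAd h l) := by
  unfold coAd
  rw [mul_inv_rev, groupAd_mul]
  rfl

/-- The group law `(g₁, l₁) (g₂, l₂) = (g₁ g₂, l₁ + Ad*_{g₁} l₂)`. -/
instance : Group (CoadjointGroup E G) where
  mul x y := ((x.1 * y.1, x.2 + coAd x.1 y.2) : G × (E →L[ℝ] ℝ))
  one := ((1, 0) : G × (E →L[ℝ] ℝ))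
  inv x := ((x.1⁻¹, -coAd x.1⁻¹ x.2) : G × (E →L[ℝ] ℝ))
  mul_assoc x y z := by
    refine Prod.ext (mul_assoc x.1 y.1 z.1) ?_
    change x.2 + coAd x.1 y.2 + coAd (x.1 * y.1) z.2 = x.2 + coAd x.1 (y.2 + coAd y.1 z.2)
    rw [coAd_mul, coAd_add, add_assoc]
  one_mul x := by
    refine Prod.ext (one_mul x.1) ?_
    change 0 + coAd 1 x.2 = x.2
    rw [coAd_one, zero_add]
  mul_one x := by
    refine Prod.ext (mul_one x.1) ?_
    change x.2 + coAd x.1 0 = x.2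
    rw [coAd_zero, add_zero]
  inv_mul_cancel x := by
    refine Prod.ext (inv_mul_cancel x.1) ?_
    change -coAd x.1⁻¹ x.2 + coAd x.1⁻¹ x.2 = 0
    rw [neg_add_cancel]

variable (E G)

/-- The embedding `g ↦ (g, 0)` of `G` in `G ⋊ 𝔤*`. -/
def inl : G →* CoadjointGroup E G where
  toFun g := ((g, 0) : G × (E →L[ℝ] ℝ))
  map_one' := rfl
  map_mul' g h := by
    refine Prod.ext rfl ?_
    change (0 : E →L[ℝ] ℝ) = 0 + coAd g 0
    rw [coAd_zero, add_zero]

/-- The involution `σ₀ (g, l) = (g, -l)` of `G ⋊ 𝔤*`. -/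
def groupInvolution : CoadjointGroup E G →* CoadjointGroup E G where
  toFun x := ((x.1, -x.2) : G × (E →L[ℝ] ℝ))
  map_one' := Prod.ext rfl (neg_zero (G := E →L[ℝ] ℝ))
  map_mul' x y := by
    refine Prod.ext rfl ?_
    change -(x.2 + coAd x.1 y.2) = -x.2 + coAd x.1 (-y.2)
    rw [coAd_neg, neg_add]

/-- The identification of `𝔤 ⋊ 𝔤*` with the tangent space `E × (E →L[ℝ] ℝ)` of `G ⋊ 𝔤*` at the
identity; it regards a linear form on the finite-dimensional space `𝔤` as a continuous one. -/
def lieEquiv [FiniteDimensional ℝ E] :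
    CoadjointLie (GroupLieAlgebra 𝓘(ℝ, E) G) ≃ₗ[ℝ]
      GroupLieAlgebra (model E) (CoadjointGroup E G) :=
  CoadjointLie.toProdₗ (GroupLieAlgebra 𝓘(ℝ, E) G) ≪≫ₗ LinearEquiv.prodCongr (LinearEquiv.refl ℝ E)
    (LinearMap.toContinuousLinearMap : (E →ₗ[ℝ] ℝ) ≃ₗ[ℝ] (E →L[ℝ] ℝ))

end CoadjointGroup

/-- The diagonal subgroup `Δ(G)` of `G × G`. -/
def diagonalSubgroup (G : Type*) [Group G] : Subgroup (G × G) :=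
  ((MonoidHom.id G).prod (MonoidHom.id G)).range

/-- The involution `σ₊ (g₁, g₂) = (g₂, g₁)` of `G × G`. -/
def groupSwap (G : Type*) [Group G] : G × G →* G × G :=
  (MonoidHom.snd G G).prod (MonoidHom.fst G G)

variable (E G) in
/-- The identification of `𝔤 × 𝔤` with the tangent space `E × E` of `G × G` at the identity. -/
def productLieEquiv :
    (GroupLieAlgebra 𝓘(ℝ, E) G × GroupLieAlgebra 𝓘(ℝ, E) G) ≃ₗ[ℝ]
      GroupLieAlgebra (𝓘(ℝ, E).prod 𝓘(ℝ, E)) (G × G) :=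
  LinearEquiv.refl ℝ (E × E)

end GroupExamples

section Complexification

variable {E : Type*} [NormedAddCommGroup E] [NormedSpace ℝ E]
  {G : Type*} [TopologicalSpace G] [ChartedSpace E G] [Group G]
  {F : Type*} [NormedAddCommGroup F] [NormedSpace ℂ F]
  {H : Type*} [TopologicalSpace H] [ChartedSpace F H] [Group H]

variable (E F) in
/-- The complex linear map `𝔤 ⊗ ℂ → 𝔥` extending the differential `𝔤 → 𝔥` of `ι : G → H`, where
`H` is a complex Lie group and `𝔥` is, as a vector space, its model space `F`. -/
def complexifiedDifferential (ι : G →* H) : ℂ ⊗[ℝ] GroupLieAlgebra 𝓘(ℝ, E) G →ₗ[ℂ] F :=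
  let d : GroupLieAlgebra 𝓘(ℝ, E) G →ₗ[ℝ] F := (lieDifferential 𝓘(ℝ, E) 𝓘(ℝ, F) ι).toLinearMap
  d.liftBaseChange ℂ

variable (E F) in
/-- `H` is the complexification `G^ℂ` of `G`: a simply connected complex Lie group which contains
`G` as a Lie subgroup (through `ι`), and whose Lie algebra is the complexification of that of `G`
(through the differential of `ι`). -/
structure IsComplexification (ι : G →* H) : Prop where
  lieGroup : LieGroup 𝓘(ℂ, F) ∞ H
  simplyConnected : SimplyConnectedSpace H
  contMDiff : ContMDiff 𝓘(ℝ, E) 𝓘(ℝ, F) ∞ ι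
  injective : Function.Injective ι
  bijective : Function.Bijective (complexifiedDifferential E F ι)

/-- The identification of `𝔤 ⊗ ℂ` with the Lie algebra of `G^ℂ`, as real vector spaces. -/
def IsComplexification.lieEquiv {ι : G →* H} (hι : IsComplexification E F ι) :
    ℂ ⊗[ℝ] GroupLieAlgebra 𝓘(ℝ, E) G ≃ₗ[ℝ] GroupLieAlgebra 𝓘(ℝ, F) H :=
  (LinearEquiv.ofBijective (complexifiedDifferential E F ι) hι.bijective).restrictScalars ℝ

end Complexification

end

/-! The statements on Lie algebras are computations with explicit pairings. Nondegeneracy is tested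
on suitable vectors: for `Λ₀` because linear forms separate the points of `𝔤`, for `Λ₊` and `Λ₋`
because `B` is positive definite.

The statements on groups need Lie theory, developed in the chart at the identity. Let `L_p` and
`R_p` be the differentials at the identity of the left and right translations by `p`. Associativity
and the symmetry of second derivatives give the Maurer-Cartan equation for `L`; the bracket is the
antisymmetrized derivative of `L` at the identity; and `R_p ∘ Ad_p = L_p` shows that `Ad` is smooth
with differential `ad`. It follows that homomorphisms of Lie groups differentiate to homomorphisms
of Lie algebras, and that on a connected group a form invariant under `ad` is invariant under `Ad`.
This settles `G × G`. In `G ⋊ 𝔤*` both `Ad` and the bracket are computed explicitly, and group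
invariance comes down to the antisymmetry of the bracket, whether or not `G` is connected.

For `G^ℂ` the involution has to be constructed by Lie's second theorem,
`exists_monoidHom_homDeriv_eq`. A map with logarithmic derivative `θ` solves, in charts, `DF(p) =
L'_{F(p)} ∘ θ ∘ L_p⁻¹`. By Maurer-Cartan this equation is integrable when `θ` preserves brackets, so
the Frobenius theorem `exists_total_differential_solution` solves it locally. Maps with the same
logarithmic derivative differ by a left translation on connected sets, so the solution is
multiplicative near the identity; a section of a covering with discrete fibre extends it to the
simply connected group. The same uniqueness gives `σ² = id` and `σ = id` on `G`.

It remains to see that `G` is closed in `G^ℂ` and contains the identity component of the fixed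
points. Near the identity every element is a product of an element of `G` and a point of a
transversal in the direction `√-1 𝔤`, where the differential of `σ` is `-1`. The only fixed point on
a small transversal is the identity, so the fixed points near the identity lie in `G`
(`eventually_mem_range_of_fixed`). -/

set_option linter.unusedSectionVars false

section

open Set Filter Topology Metric
open scoped NNReal

noncomputable section

/-! ### Extension of local homomorphisms to simply connected groups -/

section LocalHomomorphisms

variable {H K : Type*} [TopologicalSpace H] [Group H] [IsTopologicalGroup H] [Group K]

/-- The covering of a topological group by its product with a discrete group, twisted by a local
homomorphism. -/
def localHomCore [TopologicalSpace K] [DiscreteTopology K] (f : H → K) (W V : Set H)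
    (hW : W ∈ 𝓝 (1 : H)) (hf : ∀ a ∈ W, ∀ b ∈ W, f (a * b) = f a * f b)
    (hV : IsOpen V) (hV1 : (1 : H) ∈ V) (hVW : V ⊆ W) : FiberBundleCore H H K where
  baseSet i := {h | h * i⁻¹ ∈ V}
  isOpen_baseSet i := hV.preimage (continuous_mul_const _)
  indexAt h := h
  mem_baseSet_at h := by simpa using hV1
  coordChange i j b k := (f (b * j⁻¹))⁻¹ * f (b * i⁻¹) * k
  coordChange_self i x _ v := by simp
  coordChange_comp i j k x _ v := by simp [mul_assoc]
  continuousOn_coordChange i j := by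
    -- The `i`-coordinate of a multiplicative section `τ` stands for `τ i = (f (b * i⁻¹))⁻¹ * τ b`.
    -- The transition function is locally constant, because moving `b` multiplies both values of `f`
    -- on the left by the same element, which cancels.
    have key : ∀ b ∈ {h | h * i⁻¹ ∈ V} ∩ {h | h * j⁻¹ ∈ V}, ∀ᶠ b' in 𝓝 b,
        (f (b' * j⁻¹))⁻¹ * f (b' * i⁻¹) = (f (b * j⁻¹))⁻¹ * f (b * i⁻¹) := by
      rintro b ⟨hi, hj⟩
      have h1 : Tendsto (fun b' => b' * b⁻¹) (𝓝 b) (𝓝 1) := by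
        have : Tendsto (fun b' => b' * b⁻¹) (𝓝 b) (𝓝 (b * b⁻¹)) :=
          (continuous_mul_const _).tendsto _
        simpa using this
      filter_upwards [h1 hW] with b' hb'
      have e (k : H) : b' * k⁻¹ = (b' * b⁻¹) * (b * k⁻¹) := by group
      rw [e i, e j, hf _ hb' _ (hVW hi), hf _ hb' _ (hVW hj)]
      group
    rintro ⟨b, k⟩ ⟨hb, -⟩
    apply ContinuousAt.continuousWithinAt
    have h2 : ∀ᶠ p : H × K in 𝓝 (b, k), p.2 = k := by
      rw [nhds_prod_eq, nhds_discrete K]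
      exact (eventually_pure.2 rfl : ∀ᶠ x in pure k, x = k).prod_inr _
    have h3 : ∀ᶠ p : H × K in 𝓝 (b, k),
        (f (p.1 * j⁻¹))⁻¹ * f (p.1 * i⁻¹) = (f (b * j⁻¹))⁻¹ * f (b * i⁻¹) := by
      rw [nhds_prod_eq]
      exact (key b hb).prod_inl _
    refine continuousAt_const.congr (f := fun _ => (f (b * j⁻¹))⁻¹ * f (b * i⁻¹) * k) ?_
    filter_upwards [h2, h3] with p hp2 hp3
    simp only [hp2, hp3]

/-- A map on a simply connected group which is multiplicative near the identity agrees near the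
identity with a homomorphism. -/
theorem exists_monoidHom_eventuallyEq [SimplyConnectedSpace H] [LocallyPathConnectedSpace H]
    (f : H → K) (W : Set H) (hW : W ∈ 𝓝 (1 : H))
    (hf : ∀ a ∈ W, ∀ b ∈ W, f (a * b) = f a * f b) :
    ∃ σ : H →* K, ∀ᶠ h in 𝓝 (1 : H), σ h = f h := by
  let _ : TopologicalSpace K := ⊥
  have : DiscreteTopology K := ⟨rfl⟩
  obtain ⟨V, ⟨hVo, hV1, hVc⟩, hVW⟩ :=
    (LocallyConnectedSpace.open_connected_basis (1 : H)).mem_iff.1 hW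
  simp only [id] at hVW
  have f1 : f 1 = 1 := by
    have := hf 1 (hVW hV1) 1 (hVW hV1)
    simpa using this
  let Z := localHomCore f W V hW hf hVo hV1 hVW
  have cov : IsCoveringMap (Bundle.TotalSpace.proj : Z.TotalSpace → H) :=
    FiberBundle.isCoveringMap (F := K) (E := Z.Fiber)
  -- Simple connectedness enters here: the identity of `H` lifts to a global section through the
  -- neutral element of the fibre over `1`.
  obtain ⟨s, ⟨hs1, hs⟩, -⟩ := cov.existsUnique_continuousMap_lifts (ContinuousMap.id H) 1
    (⟨1, (1 : K)⟩ : Z.TotalSpace) rfl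
  have hp (h : H) : (s h).1 = h := congrFun hs h
  let τ : H → K := fun h => (s h).2
  have τ1 : τ 1 = 1 := by
    have : ∀ z : Z.TotalSpace, z = ⟨1, (1 : K)⟩ → @Eq K z.2 1 := by rintro _ rfl; rfl
    exact this _ hs1
  -- In the trivialization `i` the section is a continuous map from the connected set `V i` to a
  -- discrete space, hence constant; compare its values at `u * i` and at `i`.
  have key (i u : H) (hu : u ∈ V) : τ (u * i) = f u * τ i := by
    have hcont : ContinuousOn (fun h => ((Z.localTriv i) (s h)).2) {h | h * i⁻¹ ∈ V} := by
      refine continuous_snd.comp_continuousOn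
        ((Z.localTriv i).continuousOn.comp s.continuous.continuousOn ?_)
      intro h hh
      rw [(Z.localTriv i).mem_source]
      change (s h).1 * i⁻¹ ∈ V
      rw [hp]
      exact hh
    have hval (h : H) : ((Z.localTriv i) (s h)).2 = (f (h * i⁻¹))⁻¹ * τ h := by
      have : ((Z.localTriv i) (s h)).2 = (f ((s h).1 * i⁻¹))⁻¹ * f ((s h).1 * (s h).1⁻¹) * τ h := rfl
      rw [this, hp, mul_inv_cancel, f1, mul_one]
    have hconn : IsPreconnected {h | h * i⁻¹ ∈ V} := by
      have : {h | h * i⁻¹ ∈ V} = (fun u => u * i) '' V := by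
        ext h
        constructor
        · intro hh
          exact ⟨_, hh, by simp⟩
        · rintro ⟨u, hu, rfl⟩
          simpa using hu
      rw [this]
      exact hVc.isPreconnected.image _ (continuous_mul_const i).continuousOn
    have := hconn.constant hcont (x := u * i) (y := i) (by simpa using hu) (by simpa using hV1)
    simp only [hval, mul_inv_cancel_right, mul_inv_cancel, f1, inv_one, one_mul] at this
    rw [← this]; group
  have hτV (u : H) (hu : u ∈ V) : τ u = f u := by simpa [τ1] using key 1 u hu
  -- Multiplicativity in the first factor holds on a subgroup. It contains the neighbourhood `V` of
  -- `1`, so it is open and closed in the connected group `H`.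
  let S : Subgroup H :=
    { carrier := {h | ∀ h', τ (h * h') = τ h * τ h'}
      mul_mem' := by
        intro a b ha hb h'
        rw [mul_assoc, ha, hb, ha, mul_assoc]
      one_mem' := by intro h'; simp [τ1]
      inv_mem' := by
        intro a ha h'
        have h1 := ha (a⁻¹ * h')
        have h2 := ha a⁻¹
        simp only [mul_inv_cancel_left, mul_inv_cancel, τ1] at h1 h2
        rw [h1, ← mul_assoc, mul_eq_one_iff_eq_inv.1 h2.symm]
        group }
  have hS : IsOpen (S : Set H) := S.isOpen_of_mem_nhds (g := 1) <| by
    filter_upwards [hVo.mem_nhds hV1] with u hu h'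
    rw [key h' u hu, hτV u hu]
  have hSuniv : (S : Set H) = univ :=
    IsClopen.eq_univ ⟨S.isClosed_of_isOpen hS, hS⟩ ⟨1, S.one_mem⟩
  refine ⟨⟨⟨τ, τ1⟩, fun a b => ?_⟩, ?_⟩
  · have : a ∈ (S : Set H) := hSuniv ▸ mem_univ a
    exact this b
  · filter_upwards [hVo.mem_nhds hV1] with u hu
    exact hτV u hu

end LocalHomomorphisms

/-! ### The local Frobenius theorem for total differential equations -/

section TotalDifferentialEquations

variable {E E' : Type*} [NormedAddCommGroup E] [NormedSpace ℝ E]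
  [NormedAddCommGroup E'] [NormedSpace ℝ E']

/-- A `C²` map is, near a given point, bounded with bounded and Lipschitz derivative. -/
theorem ContDiffAt.exists_ball_fderiv_lipschitz {A : E → E'} {z₀ : E} (hA : ContDiffAt ℝ 2 A z₀) :
    ∃ r > 0, ∃ K : ℝ≥0, 1 ≤ K ∧ (∀ z ∈ ball z₀ r, DifferentiableAt ℝ A z ∧ ‖A z‖ ≤ K ∧
      ‖fderiv ℝ A z‖ ≤ K) ∧ LipschitzOnWith K (fderiv ℝ A) (ball z₀ r) := by
  have hd : ContDiffAt ℝ 1 (fderiv ℝ A) z₀ := hA.fderiv_right (by norm_num)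
  obtain ⟨K₁, s, hs, hK₁⟩ := hd.exists_lipschitzOnWith
  have hdiff : ∀ᶠ z in 𝓝 z₀, DifferentiableAt ℝ A z := by
    filter_upwards [hA.eventually (by simp)] with z hz
    exact hz.differentiableAt (by simp)
  have hb1 : ∀ᶠ z in 𝓝 z₀, ‖A z‖ < ‖A z₀‖ + 1 :=
    hA.continuousAt.norm.eventually_lt_const (by simp)
  have hb2 : ∀ᶠ z in 𝓝 z₀, ‖fderiv ℝ A z‖ < ‖fderiv ℝ A z₀‖ + 1 :=
    hd.continuousAt.norm.eventually_lt_const (by simp)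
  obtain ⟨r, hr, hrs⟩ := Metric.mem_nhds_iff.1 (inter_mem hs (hdiff.and (hb1.and hb2)))
  refine ⟨r, hr, K₁ + (‖A z₀‖₊ + ‖fderiv ℝ A z₀‖₊ + 1), ?_, ?_, ?_⟩
  · exact le_add_left le_add_self
  · intro z hz
    obtain ⟨-, h1, h2, h3⟩ := hrs hz
    refine ⟨h1, h2.le.trans ?_, h3.le.trans ?_⟩ <;> push_cast <;>
      nlinarith [norm_nonneg (A z₀), norm_nonneg (fderiv ℝ A z₀), K₁.2]
  · exact (hK₁.mono fun z hz => (hrs hz).1).weaken (by simp)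

/-- On the segment from `z` to `w` the derivative differs from the one at `z` by at most `K * ‖w -
z‖`; the mean value inequality does the rest. -/
theorem Convex.norm_taylor_le {A : E → E'} {s : Set E} (hs : Convex ℝ s) {K : ℝ≥0}
    (hA : ∀ z ∈ s, DifferentiableAt ℝ A z) (hK : LipschitzOnWith K (fderiv ℝ A) s) {z w : E}
    (hz : z ∈ s) (hw : w ∈ s) :
    ‖A w - A z - fderiv ℝ A z (w - z)‖ ≤ K * ‖w - z‖ * ‖w - z‖ := by
  have hseg : segment ℝ z w ⊆ s := hs.segment_subset hz hw
  refine (convex_segment z w).norm_image_sub_le_of_norm_fderiv_le' (𝕜 := ℝ)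
    (fun x hx => hA x (hseg hx)) (fun x hx => ?_) (left_mem_segment ℝ z w)
    (right_mem_segment ℝ z w)
  refine (hK.norm_sub_le (hseg hx) hz).trans ?_
  gcongr
  exact norm_sub_le_of_mem_segment hx

/-- The radial equation `y' = A (c + t u, y) u`. -/
theorem exists_radial_solution [CompleteSpace E'] {A : E × E' → E →L[ℝ] E'} {c : E} {c' : E'}
    {r ρ : ℝ} {K : ℝ≥0} (hρr : ρ < r) (hKρ : K * ρ < r)
    (hA : ∀ z ∈ ball (c, c') r, DifferentiableAt ℝ A z ∧ ‖A z‖ ≤ K ∧ ‖fderiv ℝ A z‖ ≤ K)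
    {u : E} (hu : ‖u‖ ≤ ρ) :
    ∃ y : ℝ → E', y 0 = c' ∧ ∀ t ∈ Icc (0 : ℝ) 1,
      HasDerivWithinAt y (A (c + t • u, y t) u) (Icc 0 1) t ∧ ‖y t - c'‖ ≤ K * ‖u‖ := by
  have hmem : ∀ t ∈ Icc (0 : ℝ) 1, ∀ x ∈ closedBall c' (K * ‖u‖),
      (c + t • u, x) ∈ ball (c, c') r := by
    intro t ht x hx
    rw [mem_ball, Prod.dist_eq, max_lt_iff]
    constructor
    · simp only [dist_self_add_left, norm_smul, Real.norm_eq_abs, abs_of_nonneg ht.1]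
      nlinarith [ht.2, norm_nonneg u]
    · refine (mem_closedBall.1 hx).trans_lt (lt_of_le_of_lt ?_ hKρ)
      gcongr
  have hconv : Convex ℝ (ball (c, c') r) := convex_ball _ _
  have hL : LipschitzOnWith K A (ball (c, c') r) :=
    hconv.lipschitzOnWith_of_nnnorm_fderiv_le (𝕜 := ℝ) (fun z hz => (hA z hz).1)
      fun z hz => (hA z hz).2.2
  -- The speed is at most `K * ‖u‖`, so a solution starting at `c'` stays in the ball of radius `K *
  -- ‖u‖` during the whole unit of time.
  have hPL : IsPicardLindelof (fun t x => A (c + t • u, x) u) (tmin := 0) (tmax := 1)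
      ⟨0, by simp⟩ c' (K * ‖u‖₊) 0 (K * ‖u‖₊) (K * ‖u‖₊) := by
    refine ⟨fun t ht => ?_, fun x hx => ?_, fun t ht x hx => ?_, by simp⟩
    · refine LipschitzOnWith.of_dist_le_mul fun x hx y hy => ?_
      rw [dist_eq_norm, ← sub_apply]
      refine (ContinuousLinearMap.le_opNorm _ _).trans ?_
      have h := hL.norm_sub_le (hmem t ht x hx) (hmem t ht y hy)
      have e : ‖((c + t • u, x) : E × E') - (c + t • u, y)‖ = dist x y := by
        simp [Prod.norm_def, dist_eq_norm]
      rw [e] at h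
      calc _ ≤ K * dist x y * ‖u‖ := by gcongr
        _ = _ := by push_cast; ring
    · have : ContinuousOn (fun t : ℝ => A (c + t • u, x)) (Icc 0 1) := by
        refine hL.continuousOn.comp (by fun_prop) fun t ht => hmem t ht x hx
      exact this.clm_apply continuousOn_const
    · refine (ContinuousLinearMap.le_opNorm _ _).trans ?_
      push_cast
      gcongr
      exact (hA _ (hmem t ht x hx)).2.1
  -- The fixed point itself is kept, since membership in the function space provides the bound on
  -- `‖y t - c'‖`.
  obtain ⟨α, hα⟩ := ODE.FunSpace.exists_isFixedPt_next hPL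
    (mem_closedBall_self (x := c') (ε := ((0 : ℝ≥0) : ℝ)) le_rfl)
  have hball (t : ℝ) : α.compProj t ∈ closedBall c' (K * ‖u‖₊ : ℝ≥0) :=
    α.compProj_mem_closedBall hPL.mul_max_le
  refine ⟨α.compProj, ?_, fun t ht => ⟨?_, ?_⟩⟩
  · have : α.compProj ((⟨0, by simp⟩ : Icc (0 : ℝ) 1) : ℝ) = c' := by
      rw [ODE.FunSpace.compProj_val, ← hα, ODE.FunSpace.next_apply₀]
    exact this
  · apply ODE.hasDerivWithinAt_picard_Icc (t₀ := 0) (by simp) hPL.continuousOn_uncurry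
      α.continuous_compProj.continuousOn (fun _ _ => hball _) c' ht |>.congr_of_mem _ ht
    intro t' ht'
    nth_rw 1 [← hα]
    rw [ODE.FunSpace.compProj_of_mem ht', ODE.FunSpace.next_apply]
  · have := hball t
    rw [mem_closedBall, dist_eq_norm] at this
    simpa using this

/-- Comparison of neighbouring rays. The first order correction `w t = y t + t • A (c + t • u, y t)
v` of the solution in the direction `u` satisfies the equation for the direction `u + v` up to an
error quadratic in `v`, precisely by the compatibility condition. Gronwall's inequality then bounds
`y' 1 - w 1`, so that the endpoint of the radial solution, as a function of `u`, has differential `A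
(c + u, y 1)`. -/
theorem norm_radial_solution_sub_le {A : E × E' → E →L[ℝ] E'} {c : E} {c' : E'}
    {r ρ : ℝ} {K : ℝ≥0} (hK1 : 1 ≤ K) (hρ1 : ρ ≤ 1) (hρr : ρ ≤ r / 4) (hKρ : K * ρ ≤ r / 4)
    (hr : 0 < r)
    (hA : ∀ z ∈ ball (c, c') r, DifferentiableAt ℝ A z ∧ ‖A z‖ ≤ K ∧ ‖fderiv ℝ A z‖ ≤ K)
    (hAL : LipschitzOnWith K (fderiv ℝ A) (ball (c, c') r))
    (hcompat : ∀ z ∈ ball (c, c') r, ∀ v w,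
      fderiv ℝ A z (v, A z v) w = fderiv ℝ A z (w, A z w) v)
    {u v : E} (hu : ‖u‖ ≤ ρ) (huv : ‖u + v‖ ≤ ρ) {y y' : ℝ → E'} (hy0 : y 0 = c')
    (hy : ∀ t ∈ Icc (0 : ℝ) 1,
      HasDerivWithinAt y (A (c + t • u, y t) u) (Icc 0 1) t ∧ ‖y t - c'‖ ≤ K * ‖u‖)
    (hy'0 : y' 0 = c')
    (hy' : ∀ t ∈ Icc (0 : ℝ) 1,
      HasDerivWithinAt y' (A (c + t • (u + v), y' t) (u + v)) (Icc 0 1) t ∧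
        ‖y' t - c'‖ ≤ K * ‖u + v‖) :
    ‖y' 1 - y 1 - A (c + u, y 1) v‖ ≤
      gronwallBound 0 K ((K * (1 + K) + K * (1 + K) * (1 + K)) * ‖v‖ ^ 2) 1 := by
  have hv : ‖v‖ ≤ 2 * ρ := by
    have : v = (u + v) - u := by abel
    rw [this]
    exact (norm_sub_le _ _).trans (by linarith)
  have hK0 : (0 : ℝ) ≤ K := K.2
  have hmem : ∀ t ∈ Icc (0 : ℝ) 1, ∀ x : E, ‖x‖ ≤ ρ → ∀ q : E', ‖q - c'‖ < r →
      (c + t • x, q) ∈ ball (c, c') r := by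
    intro t ht x hx q hq
    rw [mem_ball, Prod.dist_eq, max_lt_iff]
    constructor
    · simp only [dist_self_add_left, norm_smul, Real.norm_eq_abs, abs_of_nonneg ht.1]
      nlinarith [ht.2, norm_nonneg x]
    · rwa [dist_eq_norm]
  have hyb : ∀ t ∈ Icc (0 : ℝ) 1, ‖y t - c'‖ ≤ r / 4 := fun t ht =>
    (hy t ht).2.trans (le_trans (by gcongr) hKρ)
  have hyb' : ∀ t ∈ Icc (0 : ℝ) 1, ‖y' t - c'‖ ≤ r / 4 := fun t ht =>
    (hy' t ht).2.trans (le_trans (by gcongr) hKρ)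
  have hz : ∀ t ∈ Icc (0 : ℝ) 1, (c + t • u, y t) ∈ ball (c, c') r := fun t ht =>
    hmem t ht u hu _ ((hyb t ht).trans_lt (by linarith))
  set w : ℝ → E' := fun t => y t + t • A (c + t • u, y t) v with hw
  have hAv : ∀ t ∈ Icc (0 : ℝ) 1, ‖t • A (c + t • u, y t) v‖ ≤ K * ‖v‖ := by
    intro t ht
    rw [norm_smul, Real.norm_eq_abs, abs_of_nonneg ht.1]
    calc _ ≤ 1 * (‖A (c + t • u, y t)‖ * ‖v‖) := by
          gcongr
          · exact ht.2
          · exact ContinuousLinearMap.le_opNorm _ _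
      _ ≤ K * ‖v‖ := by
          rw [one_mul]; gcongr; exact (hA _ (hz t ht)).2.1
  -- Room in the ball: `r / 4` for `y`, and `K * ‖v‖ ≤ 2 * K * ρ ≤ r / 2` for the correction.
  have hwb : ∀ t ∈ Icc (0 : ℝ) 1, ‖w t - c'‖ < r := by
    intro t ht
    have : w t - c' = (y t - c') + t • A (c + t • u, y t) v := by simp only [hw]; abel
    rw [this]
    refine (norm_add_le _ _).trans_lt ?_
    have h1 := hyb t ht
    have h2 := hAv t ht
    have h3 : K * ‖v‖ ≤ K * (2 * ρ) := by gcongr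
    linarith
  have hwz : ∀ t ∈ Icc (0 : ℝ) 1, (c + t • (u + v), w t) ∈ ball (c, c') r := fun t ht =>
    hmem t ht _ huv _ (hwb t ht)
  have hconv : Convex ℝ (ball (c, c') r) := convex_ball _ _
  have hL : LipschitzOnWith K A (ball (c, c') r) :=
    hconv.lipschitzOnWith_of_nnnorm_fderiv_le (𝕜 := ℝ) (fun z hz => (hA z hz).1)
      fun z hz => (hA z hz).2.2
  set w' : ℝ → E' := fun t => A (c + t • u, y t) u + (A (c + t • u, y t) v +
    t • fderiv ℝ A (c + t • u, y t) (u, A (c + t • u, y t) u) v) with hw'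
  have hwd : ∀ t ∈ Icc (0 : ℝ) 1, HasDerivWithinAt w (w' t) (Icc 0 1) t := by
    intro t ht
    have h1 : HasDerivWithinAt (fun t => (c + t • u, y t)) (u, A (c + t • u, y t) u)
        (Icc 0 1) t := by
      refine HasDerivWithinAt.prodMk ?_ (hy t ht).1
      simpa using ((hasDerivWithinAt_id t _).smul_const u).const_add c
    have h2 : HasDerivWithinAt (fun t => A (c + t • u, y t))
        (fderiv ℝ A (c + t • u, y t) (u, A (c + t • u, y t) u)) (Icc 0 1) t :=
      ((hA _ (hz t ht)).1.hasFDerivAt).comp_hasDerivWithinAt t h1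
    have h3 := h2.clm_apply (hasDerivWithinAt_const t (Icc 0 1) v)
    have h4 := (hy t ht).1.add ((hasDerivWithinAt_id t (Icc 0 1)).smul h3)
    refine h4.congr_deriv ?_
    simp only [hw', id, map_zero, add_zero, one_smul]
    abel
  have hbound : ∀ t ∈ Icc (0 : ℝ) 1, ‖w' t - A (c + t • (u + v), w t) (u + v)‖ ≤
      (K * (1 + K) + K * (1 + K) * (1 + K)) * ‖v‖ ^ 2 := by
    intro t ht
    have hzt := hz t ht
    obtain ⟨-, hA1, hA2⟩ := hA _ hzt
    have hT := hconv.norm_taylor_le (fun z hz => (hA z hz).1) hAL hzt (hwz t ht)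
    set z : E × E' := (c + t • u, y t) with hzdef
    have hk : ((c + t • (u + v), w t) : E × E') - z = t • (v, A z v) := by
      rw [hzdef, hw]
      ext <;> simp [smul_add]
    rw [hk] at hT
    set R := A (c + t • (u + v), w t) - A z - fderiv ℝ A z (t • (v, A z v)) with hR
    have hAzv : ‖A z v‖ ≤ K * ‖v‖ := (ContinuousLinearMap.le_opNorm _ _).trans (by gcongr)
    have hn : ‖((v, A z v) : E × E')‖ ≤ (1 + K) * ‖v‖ := by
      rw [Prod.norm_def]
      refine max_le ?_ ?_ <;> simp only <;> nlinarith [norm_nonneg v]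
    have hnt : ‖t • ((v, A z v) : E × E')‖ ≤ (1 + K) * ‖v‖ := by
      rw [norm_smul, Real.norm_eq_abs, abs_of_nonneg ht.1]
      nlinarith [ht.2, norm_nonneg ((v, A z v) : E × E')]
    -- Taylor expansion of `A` at `z` in the direction `t • (v, A z v)`: compatibility cancels the
    -- terms linear in `v`, leaving one term quadratic in `v` and the remainder `R`.
    have e : w' t - A (c + t • (u + v), w t) (u + v) =
        -(t • fderiv ℝ A z (v, A z v) v) - R (u + v) := by
      have hc := hcompat z hzt u v
      rw [hR, hw']
      simp only [map_add, sub_apply, map_smul,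
        smul_apply, ← hzdef]
      rw [hc]
      simp only [smul_add]
      abel
    rw [e]
    have hRuv : ‖R (u + v)‖ ≤ K * (1 + K) * (1 + K) * ‖v‖ ^ 2 := by
      calc ‖R (u + v)‖ ≤ ‖R‖ * ‖u + v‖ := ContinuousLinearMap.le_opNorm _ _
        _ ≤ (K * ((1 + K) * ‖v‖) * ((1 + K) * ‖v‖)) * 1 := by
            gcongr
            · exact hT.trans (by gcongr)
            · linarith
        _ = _ := by ring
    have h2 : ‖t • fderiv ℝ A z (v, A z v) v‖ ≤ K * (1 + K) * ‖v‖ ^ 2 := by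
      rw [norm_smul, Real.norm_eq_abs, abs_of_nonneg ht.1]
      calc _ ≤ 1 * (K * ((1 + K) * ‖v‖) * ‖v‖) := by
            gcongr
            · exact ht.2
            · refine (ContinuousLinearMap.le_opNorm _ _).trans ?_
              gcongr
              refine (ContinuousLinearMap.le_opNorm _ _).trans ?_
              gcongr
        _ = _ := by ring
    calc _ ≤ ‖-(t • fderiv ℝ A z (v, A z v) v)‖ + ‖R (u + v)‖ := norm_sub_le _ _
      _ ≤ _ := by rw [norm_neg]; linarith
  have hIci : ∀ {g : ℝ → E'} {g' : E'} {t : ℝ}, t ∈ Ico (0 : ℝ) 1 →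
      HasDerivWithinAt g g' (Icc 0 1) t → HasDerivWithinAt g g' (Ici t) t := by
    intro g g' t ht h
    exact h.mono_of_mem_nhdsWithin (Icc_mem_nhdsGE_of_mem ht)
  -- Gronwall with an exact solution `y'`, the approximate solution `w` and equal initial values.
  -- The Lipschitz constant in the second variable is `K`, because `‖u + v‖ ≤ ρ ≤ 1`.
  have hG := dist_le_of_approx_trajectories_ODE_of_mem (a := 0) (b := 1) (K := K)
    (v := fun t q => A (c + t • (u + v), q) (u + v)) (s := fun _ => {q | ‖q - c'‖ < r})
    (f := y') (g := w) (εf := 0)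
    (εg := (K * (1 + K) + K * (1 + K) * (1 + K)) * ‖v‖ ^ 2) (δ := 0)
    (f' := fun t => A (c + t • (u + v), y' t) (u + v)) (g' := w') ?_
    (fun t ht => (hy' t ht).1.continuousWithinAt)
    (fun t ht => hIci ht (hy' t (Ico_subset_Icc_self ht)).1) (by simp)
    (fun t ht => (hyb' t (Ico_subset_Icc_self ht)).trans_lt (by linarith))
    (fun t ht => (hwd t ht).continuousWithinAt)
    (fun t ht => hIci ht (hwd t (Ico_subset_Icc_self ht)))
    (fun t ht => by
      rw [dist_eq_norm]
      exact hbound t (Ico_subset_Icc_self ht))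
    (fun t ht => hwb t (Ico_subset_Icc_self ht))
    (by simp [hw, hy0, hy'0]) 1 (by simp)
  · rw [dist_eq_norm, zero_add, sub_zero] at hG
    have e : y' 1 - y 1 - A (c + u, y 1) v = y' 1 - w 1 := by
      simp only [hw, one_smul]; abel
    rw [e]
    exact hG
  · intro t ht
    refine LipschitzOnWith.of_dist_le_mul fun p hp q hq => ?_
    rw [dist_eq_norm, ← sub_apply]
    refine (ContinuousLinearMap.le_opNorm _ _).trans ?_
    have ht' := Ico_subset_Icc_self ht
    have h := hL.norm_sub_le (hmem t ht' _ huv p hp) (hmem t ht' _ huv q hq)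
    have e : ‖((c + t • (u + v), p) : E × E') - (c + t • (u + v), q)‖ = dist p q := by
      simp [Prod.norm_def, dist_eq_norm]
    rw [e] at h
    calc _ ≤ K * dist p q * 1 := by
          gcongr
          linarith
      _ = _ := by ring

/-- The local Frobenius theorem for the total differential equation `Df(x) = A(x, f(x))`. -/
theorem exists_total_differential_solution [CompleteSpace E'] {A : E × E' → E →L[ℝ] E'} {c : E}
    {c' : E'} (hA : ContDiffAt ℝ 2 A (c, c'))
    (hcompat : ∀ᶠ z in 𝓝 (c, c'), ∀ v w,
      fderiv ℝ A z (v, A z v) w = fderiv ℝ A z (w, A z w) v) :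
    ∃ f : E → E', f c = c' ∧ ∀ᶠ x in 𝓝 c, HasFDerivAt f (A (x, f x)) x := by
  obtain ⟨r₁, hr₁, K, hK1, hA1, hAL1⟩ := hA.exists_ball_fderiv_lipschitz
  obtain ⟨r₂, hr₂, hc2⟩ := Metric.mem_nhds_iff.1 hcompat
  set r := min r₁ r₂
  have hr : 0 < r := lt_min hr₁ hr₂
  have s1 : ball (c, c') r ⊆ ball (c, c') r₁ := ball_subset_ball (min_le_left _ _)
  have s2 : ball (c, c') r ⊆ ball (c, c') r₂ := ball_subset_ball (min_le_right _ _)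
  have hK0 : (1 : ℝ) ≤ K := hK1
  have hKpos : (0 : ℝ) < K := by linarith
  set ρ := min 1 (r / 4 / K)
  have hρ : 0 < ρ := lt_min one_pos (by positivity)
  have hρ1 : ρ ≤ 1 := min_le_left _ _
  have hKρ : K * ρ ≤ r / 4 := by
    have : ρ ≤ r / 4 / K := min_le_right _ _
    rw [le_div_iff₀ hKpos] at this
    linarith
  have hρr : ρ ≤ r / 4 := by nlinarith
  have hsol (u : E) : ∃ y : ℝ → E', ‖u‖ ≤ ρ → y 0 = c' ∧ ∀ t ∈ Icc (0 : ℝ) 1,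
      HasDerivWithinAt y (A (c + t • u, y t) u) (Icc 0 1) t ∧ ‖y t - c'‖ ≤ K * ‖u‖ := by
    by_cases hu : ‖u‖ ≤ ρ
    · obtain ⟨y, hy⟩ := exists_radial_solution (ρ := ρ) (by linarith) (by linarith)
        (fun z hz => hA1 z (s1 hz)) hu
      exact ⟨y, fun _ => hy⟩
    · exact ⟨0, fun h => absurd h hu⟩
  choose Y hY using hsol
  refine ⟨fun x => Y (x - c) 1, ?_, ?_⟩
  · have := ((hY 0 (by simpa using hρ.le)).2 1 (by simp)).2
    rw [norm_zero, mul_zero, norm_le_zero_iff, sub_eq_zero] at this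
    simpa using this
  · filter_upwards [ball_mem_nhds c hρ] with x hx
    have hu : ‖x - c‖ < ρ := by rwa [← dist_eq_norm]
    rw [hasFDerivAt_iff_isLittleO_nhds_zero]
    set C := (K * (1 + K) + K * (1 + K) * (1 + K)) * ((Real.exp K - 1) / K) with hC
    have hO : (fun h => Y (x + h - c) 1 - Y (x - c) 1 - A (x, Y (x - c) 1) h)
        =O[𝓝 0] fun h : E => ‖h‖ ^ 2 := by
      refine Asymptotics.IsBigO.of_bound C ?_
      have hev : ∀ᶠ h in 𝓝 (0 : E), ‖(x - c) + h‖ < ρ := by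
        have : ContinuousAt (fun h : E => ‖(x - c) + h‖) 0 := by fun_prop
        exact this.eventually_lt_const (by simpa using hu)
      filter_upwards [hev] with h hh
      have e : x + h - c = (x - c) + h := by abel
      have := norm_radial_solution_sub_le hK1 hρ1 hρr hKρ hr (fun z hz => hA1 z (s1 hz))
        (hAL1.mono s1) (fun z hz => hc2 (s2 hz)) hu.le hh.le (hY _ hu.le).1 (hY _ hu.le).2
        (hY _ hh.le).1 (hY _ hh.le).2
      rw [add_sub_cancel] at this
      rw [e]
      refine this.trans (le_of_eq ?_)
      rw [gronwallBound_of_K_ne_0 hKpos.ne', hC]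
      simp only [norm_pow, norm_norm, zero_mul, zero_add, mul_one]
      ring
    refine hO.trans_isLittleO ?_
    have := Asymptotics.isLittleO_norm_pow_id (E' := E) (n := 2) (by norm_num)
    exact this

end TotalDifferentialEquations

/-! ### Translations and the Maurer-Cartan equation in the chart at the identity -/

section ChartCalculus

variable {E : Type*} [NormedAddCommGroup E] [NormedSpace ℝ E]
  {M : Type*} [TopologicalSpace M] (I : ModelWithCorners ℝ E M)
  (G : Type*) [TopologicalSpace G] [ChartedSpace M G] [Group G]

/-- The multiplication of a Lie group in the chart at the identity. -/
def chartMul (p : E × E) : E :=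
  extChartAt I (1 : G) ((extChartAt I (1 : G)).symm p.1 * (extChartAt I (1 : G)).symm p.2)

/-- The differential at the identity of a left translation, in the chart at the identity. -/
def chartLeft (p : E) : E →L[ℝ] E :=
  fderiv ℝ (fun q => chartMul I G (p, q)) (extChartAt I (1 : G) 1)

/-- The differential at the identity of a right translation, in the chart at the identity. -/
def chartRight (p : E) : E →L[ℝ] E :=
  fderiv ℝ (fun q => chartMul I G (q, p)) (extChartAt I (1 : G) 1)

variable {I G} [I.Boundaryless] [LieGroup I ∞ G]

theorem two_le_infty : (2 : ℕ∞ω) ≤ ∞ := ENat.LEInfty.out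

local notation "φ" => extChartAt I (1 : G)

theorem extChartAt_target_mem_nhds_one : (φ).target ∈ 𝓝 (φ 1) :=
  (isOpen_extChartAt_target (I := I) (1 : G)).mem_nhds (mem_extChartAt_target (1 : G))

theorem contMDiffAt_extChartAt_symm_of_mem {p : E} (hp : p ∈ (φ).target) :
    ContMDiffAt 𝓘(ℝ, E) I ∞ (φ).symm p :=
  (contMDiffOn_extChartAt_symm (1 : G)).contMDiffAt
    ((isOpen_extChartAt_target (I := I) (1 : G)).mem_nhds hp)

theorem contMDiffAt_extChartAt_of_mem {g : G} (hg : g ∈ (φ).source) :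
    ContMDiffAt I 𝓘(ℝ, E) ∞ φ g :=
  contMDiffAt_extChartAt' (by rwa [extChartAt_source] at hg)

theorem contDiffAt_chartMul {p q : E} (hp : p ∈ (φ).target) (hq : q ∈ (φ).target)
    (hpq : (φ).symm p * (φ).symm q ∈ (φ).source) : ContDiffAt ℝ ∞ (chartMul I G) (p, q) := by
  rw [← contMDiffAt_iff_contDiffAt]
  have h1 : ContMDiffAt 𝓘(ℝ, E × E) I ∞ (fun z : E × E => (φ).symm z.1) (p, q) :=
    ContMDiffAt.comp (p, q) (contMDiffAt_extChartAt_symm_of_mem (p := (p, q).1) hp)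
      contDiff_fst.contMDiff.contMDiffAt
  have h2 : ContMDiffAt 𝓘(ℝ, E × E) I ∞ (fun z : E × E => (φ).symm z.2) (p, q) :=
    ContMDiffAt.comp (p, q) (contMDiffAt_extChartAt_symm_of_mem (p := (p, q).2) hq)
      contDiff_snd.contMDiff.contMDiffAt
  exact ContMDiffAt.comp (p, q) (contMDiffAt_extChartAt_of_mem (I := I) hpq) (h1.mul h2)

theorem extChartAt_symm_one : (φ).symm (φ 1) = 1 := extChartAt_to_inv (1 : G)

theorem contDiffAt_chartMul_left {p : E} (hp : p ∈ (φ).target) :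
    ContDiffAt ℝ ∞ (chartMul I G) (p, φ 1) := by
  refine contDiffAt_chartMul hp (mem_extChartAt_target (1 : G)) ?_
  rw [extChartAt_symm_one, mul_one]
  exact (φ).map_target hp

theorem contDiffAt_chartMul_right {p : E} (hp : p ∈ (φ).target) :
    ContDiffAt ℝ ∞ (chartMul I G) (φ 1, p) := by
  refine contDiffAt_chartMul (mem_extChartAt_target (1 : G)) hp ?_
  rw [extChartAt_symm_one, one_mul]
  exact (φ).map_target hp

theorem contDiffAt_chartLeft {p : E} (hp : p ∈ (φ).target) :
    ContDiffAt ℝ ∞ (chartLeft I G) p :=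
  ContDiffAt.fderiv (f := fun p q => chartMul I G (p, q)) (g := fun _ => φ 1) (n := ∞)
    (contDiffAt_chartMul_left hp) contDiffAt_const (by simp)

theorem contDiffAt_chartRight {p : E} (hp : p ∈ (φ).target) :
    ContDiffAt ℝ ∞ (chartRight I G) p := by
  have h : ContDiffAt ℝ ∞ (fun z : E × E => chartMul I G (z.2, z.1)) (p, φ 1) :=
    ContDiffAt.comp (p, φ 1) (g := chartMul I G) (f := fun z : E × E => (z.2, z.1))
      (contDiffAt_chartMul_right hp) (by fun_prop)
  exact ContDiffAt.fderiv (f := fun p q => chartMul I G (q, p)) (g := fun _ => φ 1) (n := ∞)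
    h contDiffAt_const (by simp)

theorem chartMul_one_left {p : E} (hp : p ∈ (φ).target) : chartMul I G (φ 1, p) = p := by
  simp only [chartMul, extChartAt_symm_one, one_mul]
  exact (φ).right_inv hp

theorem chartMul_one_right {p : E} (hp : p ∈ (φ).target) : chartMul I G (p, φ 1) = p := by
  simp only [chartMul, extChartAt_symm_one, mul_one]
  exact (φ).right_inv hp

theorem chartLeft_one : chartLeft I G (φ 1) = ContinuousLinearMap.id ℝ E := by
  have : (fun q => chartMul I G (φ 1, q)) =ᶠ[𝓝 (φ 1)] id := by
    filter_upwards [extChartAt_target_mem_nhds_one (I := I) (G := G)] with q hq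
    exact chartMul_one_left hq
  rw [chartLeft, this.fderiv_eq, fderiv_id]

theorem chartRight_one : chartRight I G (φ 1) = ContinuousLinearMap.id ℝ E := by
  have : (fun q => chartMul I G (q, φ 1)) =ᶠ[𝓝 (φ 1)] id := by
    filter_upwards [extChartAt_target_mem_nhds_one (I := I) (G := G)] with q hq
    exact chartMul_one_right hq
  rw [chartRight, this.fderiv_eq, fderiv_id]

/-- The structure constants of the Lie algebra in the chart at the identity. -/
theorem fderiv_chartLeft_eq_fderiv_chartRight (x y : E) :
    fderiv ℝ (chartLeft I G) (φ 1) x y = fderiv ℝ (chartRight I G) (φ 1) y x := by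
  have hc := contDiffAt_chartMul_left (I := I) (G := G) (mem_extChartAt_target (1 : G))
  set c : E := φ 1
  -- Both sides are the mixed second derivative of the multiplication at the identity, on `(x, 0)`
  -- and `(0, y)` in either order.
  have hsymm := hc.isSymmSndFDerivAt (n := ∞) (by
    rw [minSmoothness_of_isRCLikeNormedField]; exact two_le_infty)
  have hev : ∀ᶠ z : E × E in 𝓝 (c, c), DifferentiableAt ℝ (chartMul I G) z :=
    (hc.of_le (m := 1) (by simp) |>.eventually (by simp)).mono
      fun z hz => hz.differentiableAt (by simp)
  have hd2 : DifferentiableAt ℝ (fderiv ℝ (chartMul I G)) (c, c) :=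
    (hc.fderiv_right (m := 1) (n := ∞) (by
      rw [one_add_one_eq_two]; exact two_le_infty)).differentiableAt (by simp)
  have hL : chartLeft I G =ᶠ[𝓝 c] fun p =>
      (fderiv ℝ (chartMul I G) (p, c)).comp (ContinuousLinearMap.inr ℝ E E) := by
    have ht : Tendsto (fun p : E => (p, c)) (𝓝 c) (𝓝 (c, c)) :=
      (Continuous.prodMk_left c).tendsto c
    filter_upwards [ht.eventually hev] with p hp
    exact (hp.hasFDerivAt.comp c (hasFDerivAt_prodMk_right p c)).fderiv
  have hR : chartRight I G =ᶠ[𝓝 c] fun p =>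
      (fderiv ℝ (chartMul I G) (c, p)).comp (ContinuousLinearMap.inl ℝ E E) := by
    have ht : Tendsto (fun p : E => (c, p)) (𝓝 c) (𝓝 (c, c)) :=
      (Continuous.prodMk_right c).tendsto c
    filter_upwards [ht.eventually hev] with p hp
    exact (HasFDerivAt.comp c (g := chartMul I G) hp.hasFDerivAt
      (hasFDerivAt_prodMk_left c p)).fderiv
  have dL : HasFDerivAt (fun p => fderiv ℝ (chartMul I G) (p, c))
      ((fderiv ℝ (fderiv ℝ (chartMul I G)) (c, c)).comp (ContinuousLinearMap.inl ℝ E E)) c :=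
    HasFDerivAt.comp c (g := fderiv ℝ (chartMul I G)) hd2.hasFDerivAt (hasFDerivAt_prodMk_left c c)
  have dR : HasFDerivAt (fun p => fderiv ℝ (chartMul I G) (c, p))
      ((fderiv ℝ (fderiv ℝ (chartMul I G)) (c, c)).comp (ContinuousLinearMap.inr ℝ E E)) c :=
    HasFDerivAt.comp c (g := fderiv ℝ (chartMul I G)) hd2.hasFDerivAt (hasFDerivAt_prodMk_right c c)
  rw [hL.fderiv_eq, hR.fderiv_eq, (dL.clm_comp (hasFDerivAt_const _ c)).fderiv,
    (dR.clm_comp (hasFDerivAt_const _ c)).fderiv]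
  simpa using hsymm (x, 0) (0, y)

/-- Left translations act on the left invariant frame. -/
theorem fderiv_chartMul_comp_chartLeft {p : E} (hp : p ∈ (φ).target) :
    ∀ᶠ q in 𝓝 (φ 1), chartLeft I G (chartMul I G (p, q)) =
      (fderiv ℝ (fun q => chartMul I G (p, q)) q).comp (chartLeft I G q) := by
  have _ : ContinuousMul G := continuousMul_of_contMDiffMul I ∞
  have hcont : ContinuousAt (fun q => (φ).symm p * (φ).symm q) (φ 1) := by
    refine continuousAt_const.mul ?_
    exact (contMDiffAt_extChartAt_symm_of_mem (mem_extChartAt_target (1 : G))).continuousAt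
  have h1 : ∀ᶠ q in 𝓝 (φ 1), (φ).symm p * (φ).symm q ∈ (φ).source := by
    refine hcont.eventually_mem ?_
    rw [extChartAt_symm_one, mul_one]
    exact (isOpen_extChartAt_source (I := I) (1 : G)).mem_nhds ((φ).map_target hp)
  filter_upwards [h1, extChartAt_target_mem_nhds_one (I := I) (G := G)] with q hq1 hq
  have hd : DifferentiableAt ℝ (fun q => chartMul I G (p, q)) q :=
    ((contDiffAt_chartMul hp hq hq1).comp q (contDiffAt_const.prodMk contDiffAt_id)
      ).differentiableAt (by simp)
  have hd2 : DifferentiableAt ℝ (fun r => chartMul I G (q, r)) (φ 1) :=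
    ((contDiffAt_chartMul_left hq).comp (φ 1) (contDiffAt_const.prodMk contDiffAt_id)
      ).differentiableAt (by simp)
  -- Associativity `(p q) r = p (q r)`, to be differentiated in `r` at the identity.
  have e : (fun r => chartMul I G (chartMul I G (p, q), r)) =ᶠ[𝓝 (φ 1)]
      (fun q => chartMul I G (p, q)) ∘ (fun r => chartMul I G (q, r)) := by
    have hcont : ContinuousAt (fun r => (φ).symm q * (φ).symm r) (φ 1) := by
      refine continuousAt_const.mul ?_
      exact (contMDiffAt_extChartAt_symm_of_mem (mem_extChartAt_target (1 : G))).continuousAt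
    have h2 : ∀ᶠ r in 𝓝 (φ 1), (φ).symm q * (φ).symm r ∈ (φ).source := by
      refine hcont.eventually_mem ?_
      rw [extChartAt_symm_one, mul_one]
      exact (isOpen_extChartAt_source (I := I) (1 : G)).mem_nhds ((φ).map_target hq)
    filter_upwards [h2] with r hr
    simp only [chartMul, Function.comp_apply]
    rw [(φ).left_inv hq1, (φ).left_inv hr, mul_assoc]
  have hq' : chartMul I G (q, φ 1) = q := chartMul_one_right hq
  rw [chartLeft, e.fderiv_eq, fderiv_comp, hq']
  · rfl
  · rwa [hq']
  · exact hd2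

/-- The Maurer-Cartan equation in the chart at the identity. -/
theorem fderiv_chartLeft_sub_fderiv_chartLeft {p : E} (hp : p ∈ (φ).target) (x y : E) :
    fderiv ℝ (chartLeft I G) p (chartLeft I G p x) y -
      fderiv ℝ (chartLeft I G) p (chartLeft I G p y) x =
    chartLeft I G p (fderiv ℝ (chartLeft I G) (φ 1) x y - fderiv ℝ (chartLeft I G) (φ 1) y x) := by
  have hμ : ContDiffAt ℝ ∞ (fun q => chartMul I G (p, q)) (φ 1) :=
    (contDiffAt_chartMul_left hp).comp (φ 1) (contDiffAt_const.prodMk contDiffAt_id)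
  have hsymm := hμ.isSymmSndFDerivAt (n := ∞) (by
    rw [minSmoothness_of_isRCLikeNormedField]; exact two_le_infty)
  have hd1 : HasFDerivAt (fun q => chartMul I G (p, q)) (chartLeft I G p) (φ 1) :=
    (hμ.differentiableAt (by simp)).hasFDerivAt
  have hd2 : DifferentiableAt ℝ (fderiv ℝ (fun q => chartMul I G (p, q))) (φ 1) :=
    (hμ.fderiv_right (m := 1) (n := ∞) (by
      rw [one_add_one_eq_two]; exact two_le_infty)).differentiableAt (by simp)
  have hLp : DifferentiableAt ℝ (chartLeft I G) (chartMul I G (p, φ 1)) := by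
    rw [chartMul_one_right hp]
    exact (contDiffAt_chartLeft hp).differentiableAt (by simp)
  have hLc : DifferentiableAt ℝ (chartLeft I G) (φ 1) :=
    (contDiffAt_chartLeft (mem_extChartAt_target (1 : G))).differentiableAt (by simp)
  have e1 := hLp.hasFDerivAt.comp (φ 1) hd1
  have e2 := hd2.hasFDerivAt.clm_comp hLc.hasFDerivAt
  have hev : (fun q => (fderiv ℝ (fun q => chartMul I G (p, q)) q).comp (chartLeft I G q))
      =ᶠ[𝓝 (φ 1)] chartLeft I G ∘ fun q => chartMul I G (p, q) :=
    (fderiv_chartMul_comp_chartLeft hp).mono fun q hq => hq.symm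
  have e3 := (e1.congr_of_eventuallyEq hev).unique e2
  rw [chartMul_one_right hp, chartLeft_one] at e3
  -- This differentiates in `q` at the identity the relation between `chartLeft` at `p q` and at
  -- `q`. The second derivative of the left translation is symmetric, so it drops out on
  -- antisymmetrizing in `a` and `b`.
  have key (a b : E) : fderiv ℝ (chartLeft I G) p (chartLeft I G p a) b =
      chartLeft I G p (fderiv ℝ (chartLeft I G) (φ 1) a b) +
        fderiv ℝ (fderiv ℝ (fun q => chartMul I G (p, q))) (φ 1) a b := by
    have := congrArg (fun T => T a b) e3
    simpa [chartLeft] using this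
  rw [key, key, hsymm x y, map_sub]
  abel

end ChartCalculus

/-! ### The adjoint representation and its differential -/

section AdjointRepresentation

variable {E : Type*} [NormedAddCommGroup E] [NormedSpace ℝ E]
  {M : Type*} [TopologicalSpace M] {I : ModelWithCorners ℝ E M}
  {G : Type*} [TopologicalSpace G] [ChartedSpace M G] [Group G]
  {E' : Type*} [NormedAddCommGroup E'] [NormedSpace ℝ E']
  {M' : Type*} [TopologicalSpace M'] {J : ModelWithCorners ℝ E' M'}
  {X : Type*} [TopologicalSpace X] [ChartedSpace M' X]
  [I.Boundaryless] [LieGroup I ∞ G]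

local notation "φ" => extChartAt I (1 : G)

theorem hasMFDerivAt_one_iff {f : G → E'} {T : E →L[ℝ] E'} :
    HasMFDerivAt I 𝓘(ℝ, E') f 1 T ↔ ContinuousAt f 1 ∧ HasFDerivAt (f ∘ (φ).symm) T (φ 1) := by
  have h : HasMFDerivAt I 𝓘(ℝ, E') f 1 T ↔
      ContinuousAt f 1 ∧ HasFDerivWithinAt (f ∘ (φ).symm) T (range I) (φ 1) := Iff.rfl
  rw [h, I.range_eq_univ, hasFDerivWithinAt_univ]

/-- Chain rule with the base point matched only by a proved equality; derivatives are maps of model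
spaces, so no transport between tangent spaces occurs. -/
theorem hasMFDerivAt_comp_of_eq {E'' M'' Y : Type*} [NormedAddCommGroup E''] [NormedSpace ℝ E'']
    [TopologicalSpace M''] {J' : ModelWithCorners ℝ E'' M''} [TopologicalSpace Y]
    [ChartedSpace M'' Y] {X' F N : Type*} [NormedAddCommGroup F] [NormedSpace ℝ F]
    [TopologicalSpace N] {J₀ : ModelWithCorners ℝ F N} [TopologicalSpace X'] [ChartedSpace N X']
    {g : X → Y} {f : X' → X} {x : X'} {y : X} {g' : E' →L[ℝ] E''} {f' : F →L[ℝ] E'}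
    (hg : HasMFDerivAt J J' g y g') (hf : HasMFDerivAt J₀ J f x f') (h : f x = y) :
    HasMFDerivAt J₀ J' (g ∘ f) x (g'.comp f') := by
  subst h
  exact HasMFDerivAt.comp x hg hf

variable (I) in
/-- The adjoint action, as an endomorphism of the model space. -/
def adjointMap (g : G) : E →L[ℝ] E := groupAd I g

theorem hasMFDerivAt_extChartAt_one {g : G} (hg : g = 1) :
    HasMFDerivAt I 𝓘(ℝ, E) φ g (ContinuousLinearMap.id ℝ E) := by
  subst hg
  have := (mdifferentiableAt_extChartAt (I := I) (mem_chart_source M (1 : G))).hasMFDerivAt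
  rwa [mfderiv_extChartAt_self] at this

theorem hasMFDerivAt_chart_mul_left {p : E} (hp : p ∈ (φ).target) :
    HasMFDerivAt I 𝓘(ℝ, E) (fun a => φ ((φ).symm p * a)) 1 (chartLeft I G p : E →L[ℝ] E) := by
  have _ : ContinuousMul G := continuousMul_of_contMDiffMul I ∞
  rw [hasMFDerivAt_one_iff]
  constructor
  · refine ContinuousAt.comp (g := φ) ?_ (by fun_prop)
    rw [mul_one]
    exact continuousAt_extChartAt' ((φ).map_target hp)
  · exact (((contDiffAt_chartMul_left hp).comp (φ 1) (contDiffAt_const.prodMk contDiffAt_id)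
      ).differentiableAt (by simp)).hasFDerivAt

theorem hasMFDerivAt_chart_mul_right {p : E} (hp : p ∈ (φ).target) :
    HasMFDerivAt I 𝓘(ℝ, E) (fun a => φ (a * (φ).symm p)) 1 (chartRight I G p : E →L[ℝ] E) := by
  have _ : ContinuousMul G := continuousMul_of_contMDiffMul I ∞
  rw [hasMFDerivAt_one_iff]
  constructor
  · refine ContinuousAt.comp (g := φ) ?_ (by fun_prop)
    rw [one_mul]
    exact continuousAt_extChartAt' ((φ).map_target hp)
  · exact (((contDiffAt_chartMul_right hp).comp (φ 1) (contDiffAt_id.prodMk contDiffAt_const)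
      ).differentiableAt (by simp)).hasFDerivAt

theorem contMDiff_mul_mul_inv (g : G) : ContMDiff I I ∞ (fun x : G => g * x * g⁻¹) :=
  (contMDiff_const.mul contMDiff_id).mul contMDiff_const

theorem hasMFDerivAt_adjointMap (g : G) :
    HasMFDerivAt I I (fun x : G => g * x * g⁻¹) 1 (adjointMap I g : E →L[ℝ] E) :=
  ((contMDiff_mul_mul_inv g).mdifferentiableAt (by simp)).hasMFDerivAt

/-- Differentiate `(g x g⁻¹) g = g x` at `x = 1`. This expresses `Ad` through the two translation
frames, whose dependence on the point is known to be smooth. -/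
theorem chartRight_comp_adjointMap {p : E} (hp : p ∈ (φ).target) :
    (chartRight I G p).comp (adjointMap I ((φ).symm p)) = chartLeft I G p := by
  set g := (φ).symm p
  have h1 := hasMFDerivAt_chart_mul_right hp
  have h2 := hasMFDerivAt_comp_of_eq (x := (1 : G)) (f := fun x : G => g * x * g⁻¹)
    (g := fun a => φ (a * g)) h1 (hasMFDerivAt_adjointMap g) (by simp)
  have e : (fun a => φ (a * g)) ∘ (fun x : G => g * x * g⁻¹) = fun a => φ (g * a) := by
    ext x; simp
  rw [e] at h2
  exact hasMFDerivAt_unique h2 (hasMFDerivAt_chart_mul_left hp)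

theorem adjointMap_one : adjointMap I (1 : G) = ContinuousLinearMap.id ℝ E := by
  have h : (fun x : G => 1 * x * 1⁻¹) = id := by ext; simp
  unfold adjointMap groupAd
  rw [h]
  exact mfderiv_id

theorem adjointMap_mul (g h : G) :
    (adjointMap I (g * h)) = (adjointMap I g).comp (adjointMap I h) := by
  have e : (fun x : G => g * h * x * (g * h)⁻¹) =
      (fun x : G => g * x * g⁻¹) ∘ (fun x : G => h * x * h⁻¹) := by
    ext x; simp [mul_assoc]
  have h2 := hasMFDerivAt_comp_of_eq (x := (1 : G)) (f := fun x : G => h * x * h⁻¹)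
    (g := fun x : G => g * x * g⁻¹) (hasMFDerivAt_adjointMap (I := I) g)
    (hasMFDerivAt_adjointMap (I := I) h) (by simp)
  rw [← e] at h2
  exact hasMFDerivAt_unique (hasMFDerivAt_adjointMap (I := I) (g * h)) h2

variable (I G) in
/-- The bracket of the Lie algebra of a Lie group, as a continuous bilinear map. -/
def bracketCLM : E →L[ℝ] E →L[ℝ] E :=
  fderiv ℝ (chartLeft I G) (φ 1) - (fderiv ℝ (chartLeft I G) (φ 1)).flip

/-- Left invariant fields are by definition pushed forward by left translations, so `chartLeft` is
the left invariant frame in the chart. -/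
theorem mpullbackWithin_mulInvariantVectorField (v : GroupLieAlgebra I G) {p : E}
    (hp : p ∈ (φ).target) :
    VectorField.mpullbackWithin 𝓘(ℝ, E) I (φ).symm (mulInvariantVectorField v) (range I) p =
      chartLeft I G p v := by
  have hinv : (mfderivWithin 𝓘(ℝ, E) I (φ).symm (range I) p).inverse =
      mfderiv I 𝓘(ℝ, E) φ ((φ).symm p) :=
    ContinuousLinearMap.inverse_eq (mfderivWithin_extChartAt_symm_comp_mfderiv_extChartAt hp)
      (mfderiv_extChartAt_comp_mfderivWithin_extChartAt_symm hp)
  rw [VectorField.mpullbackWithin_apply, hinv]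
  set g := (φ).symm p with hg
  have hgs : g ∈ (chartAt M (1 : G)).source := by
    rw [← extChartAt_source I]; exact (φ).map_target hp
  have h1 := (mdifferentiableAt_extChartAt (I := I) hgs).hasMFDerivAt
  have h2 : HasMFDerivAt I I (fun a => g * a) 1 (mfderiv I I (fun a => g * a) 1) :=
    ((contMDiff_mul_left (I := I) (n := ∞) (a := g)).mdifferentiableAt (by simp)).hasMFDerivAt
  have h3 := hasMFDerivAt_comp_of_eq (x := (1 : G)) (f := fun x : G => g * x) (g := φ) h1 h2
    (mul_one g)
  exact congrArg (fun T : E →L[ℝ] E => T v)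
    (hasMFDerivAt_unique h3 (hasMFDerivAt_chart_mul_left hp))

/-- The bracket of left invariant fields at the identity is computed in the chart for `p ↦ chartLeft
I G p x` and `p ↦ chartLeft I G p y`, where the frame at the identity is the identity map. -/
theorem lie_eq_bracketCLM (x y : GroupLieAlgebra I G) : ⁅x, y⁆ = bracketCLM I G x y := by
  have hd : DifferentiableAt ℝ (chartLeft I G) (φ 1) :=
    (contDiffAt_chartLeft (mem_extChartAt_target (1 : G))).differentiableAt (by simp)
  let W (v : E) : E → E :=
    VectorField.mpullbackWithin 𝓘(ℝ, E) I (φ).symm (mulInvariantVectorField (I := I) v) (range I)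
  have hV (v : E) : W v =ᶠ[𝓝 (φ 1)] fun p => chartLeft I G p v := by
    filter_upwards [extChartAt_target_mem_nhds_one (I := I) (G := G)] with p hp
    exact mpullbackWithin_mulInvariantVectorField v hp
  have hf (v : E) (w : E) : fderiv ℝ (fun p => chartLeft I G p v) (φ 1) w =
      fderiv ℝ (chartLeft I G) (φ 1) w v := by
    rw [(hd.hasFDerivAt.clm_apply (hasFDerivAt_const v _)).fderiv]
    simp
  have huniv : (φ).symm ⁻¹' univ ∩ range I = univ := by simp [I.range_eq_univ]
  let D : E →L[ℝ] E := mfderiv I 𝓘(ℝ, E) φ 1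
  have hD : D = ContinuousLinearMap.id ℝ E := mfderiv_extChartAt_self
  have key (x y : E) : D.inverse (VectorField.lieBracketWithin ℝ (W x) (W y)
      ((φ).symm ⁻¹' univ ∩ range I) (φ 1)) = bracketCLM I G x y := by
    rw [huniv, hD, ContinuousLinearMap.inverse_id, VectorField.lieBracketWithin_univ,
      (hV x).lieBracket_vectorField_eq (hV y), VectorField.lieBracket, chartLeft_one]
    simp only [ContinuousLinearMap.id_apply, hf]
    rfl
  exact key x y

variable [CompleteSpace E]

theorem eventually_isInvertible_chartRight :
    ∀ᶠ p in 𝓝 (φ 1), (chartRight I G p).IsInvertible := by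
  have h := (contDiffAt_chartRight (I := I) (mem_extChartAt_target (1 : G))).continuousAt
  refine h.eventually_mem (s := range ((↑) : (E ≃L[ℝ] E) → E →L[ℝ] E)) ?_ |>.mono fun p hp => hp
  rw [chartRight_one]
  exact (ContinuousLinearEquiv.refl ℝ E).nhds

theorem eventually_isInvertible_chartLeft :
    ∀ᶠ p in 𝓝 (φ 1), (chartLeft I G p).IsInvertible := by
  have h := (contDiffAt_chartLeft (I := I) (mem_extChartAt_target (1 : G))).continuousAt
  refine h.eventually_mem (s := range ((↑) : (E ≃L[ℝ] E) → E →L[ℝ] E)) ?_ |>.mono fun p hp => hp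
  rw [chartLeft_one]
  exact (ContinuousLinearEquiv.refl ℝ E).nhds

/-- Near the identity `R_p` is invertible and `Ad = R_p⁻¹ ∘ L_p`; inversion of linear maps is
smooth. -/
theorem contDiffAt_adjointMap_comp_symm :
    ContDiffAt ℝ ∞ (fun p => adjointMap I ((φ).symm p)) (φ 1) := by
  have hc := mem_extChartAt_target (I := I) (1 : G)
  have h1 : ContDiffAt ℝ ∞ (fun p => (chartRight I G p).inverse) (φ 1) := by
    refine ContDiffAt.comp (φ 1) (g := ContinuousLinearMap.inverse) ?_ (contDiffAt_chartRight hc)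
    rw [chartRight_one]
    exact contDiffAt_map_inverse (ContinuousLinearEquiv.refl ℝ E)
  have h2 : ContDiffAt ℝ ∞ (fun p => (chartRight I G p).inverse.comp (chartLeft I G p)) (φ 1) :=
    h1.clm_comp (contDiffAt_chartLeft hc)
  refine h2.congr_of_eventuallyEq ?_
  filter_upwards [extChartAt_target_mem_nhds_one (I := I) (G := G),
    eventually_isInvertible_chartRight (I := I) (G := G)] with p hp hi
  rw [← chartRight_comp_adjointMap hp, ← ContinuousLinearMap.comp_assoc, hi.inverse_comp_self,
    ContinuousLinearMap.id_comp]

theorem contMDiffAt_one_of_contDiffAt {f : G → E'} (hf : ContDiffAt ℝ ∞ (f ∘ (φ).symm) (φ 1)) :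
    ContMDiffAt I 𝓘(ℝ, E') ∞ f 1 := by
  have h : ContMDiffAt I 𝓘(ℝ, E') ∞ ((f ∘ (φ).symm) ∘ φ) 1 :=
    hf.contMDiffAt.comp (1 : G) contMDiffAt_extChartAt
  refine h.congr_of_eventuallyEq ?_
  filter_upwards [extChartAt_source_mem_nhds (I := I) (1 : G)] with g hg
  change f g = f ((φ).symm (φ g))
  rw [(φ).left_inv hg]

/-- The adjoint representation is smooth. -/
theorem contMDiff_adjointMap : ContMDiff I 𝓘(ℝ, E →L[ℝ] E) ∞
    (fun g : G => adjointMap I g) := by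
  intro g
  have h1 : ContMDiffAt I 𝓘(ℝ, E →L[ℝ] E) ∞ (fun g : G => adjointMap I g) (g⁻¹ * g) := by
    rw [inv_mul_cancel]
    exact contMDiffAt_one_of_contDiffAt contDiffAt_adjointMap_comp_symm
  have h2 : ContMDiffAt I 𝓘(ℝ, E →L[ℝ] E) ∞
      (fun x : G => adjointMap I (g⁻¹ * x)) g :=
    ContMDiffAt.comp g (g := fun g : G => (adjointMap I g)) (f := fun x => g⁻¹ * x) h1
      contMDiff_mul_left.contMDiffAt
  have h3 := ContMDiffAt.clm_comp (contMDiffAt_const (c := adjointMap I g)) h2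
  refine h3.congr_of_eventuallyEq (Eventually.of_forall fun x => ?_)
  simp only
  rw [← adjointMap_mul, mul_inv_cancel_left]

/-- The differential of the adjoint representation is the bracket. -/
theorem hasMFDerivAt_adjointMap_one : HasMFDerivAt I 𝓘(ℝ, E →L[ℝ] E)
    (fun g : G => adjointMap I g) 1
    (bracketCLM I G : E →L[ℝ] E →L[ℝ] E) := by
  rw [hasMFDerivAt_one_iff]
  refine ⟨contMDiff_adjointMap.continuous.continuousAt, ?_⟩
  have hc := mem_extChartAt_target (I := I) (1 : G)
  have hA : HasFDerivAt (fun p => adjointMap I ((φ).symm p)) _ (φ 1) :=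
    (contDiffAt_adjointMap_comp_symm.differentiableAt (by simp)).hasFDerivAt
  have hL : HasFDerivAt (chartLeft I G) _ (φ 1) :=
    ((contDiffAt_chartLeft hc).differentiableAt (by simp)).hasFDerivAt
  have hR : HasFDerivAt (chartRight I G) _ (φ 1) :=
    ((contDiffAt_chartRight hc).differentiableAt (by simp)).hasFDerivAt
  have h1 := hR.clm_comp hA
  have hev : (fun p => (chartRight I G p).comp (adjointMap I ((φ).symm p)))
      =ᶠ[𝓝 (φ 1)] chartLeft I G := by
    filter_upwards [extChartAt_target_mem_nhds_one (I := I) (G := G)] with p hp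
    exact chartRight_comp_adjointMap hp
  -- The product rule for `R ∘ Ad = L` at the identity gives `DL(x) y = D(Ad)(x) y + DR(x) y`, and
  -- `DR(x) y = DL(y) x` by the symmetry of the mixed derivative.
  have h2 := (hL.congr_of_eventuallyEq hev).unique h1
  refine hA.congr_fderiv ?_
  ext x y
  have h3 := congrArg (fun T => T x y) h2
  simp only [extChartAt_symm_one, adjointMap_one, chartRight_one] at h3
  have h4 : fderiv ℝ (chartLeft I G) (φ 1) x y =
      fderiv ℝ (fun p => adjointMap I ((φ).symm p)) (φ 1) x y +
        fderiv ℝ (chartRight I G) (φ 1) x y := by simpa using h3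
  rw [bracketCLM]
  simp only [sub_apply, ContinuousLinearMap.flip_apply]
  rw [fderiv_chartLeft_eq_fderiv_chartRight y x, h4]
  abel

end AdjointRepresentation

/-- Replaces a derivative by an equal one while the equality is stated between model spaces, where
rewriting is not obstructed by tangent space types. -/
theorem HasMFDerivAt.congr_clm {E : Type*} [NormedAddCommGroup E] [NormedSpace ℝ E]
    {M : Type*} [TopologicalSpace M] {I : ModelWithCorners ℝ E M}
    {X : Type*} [TopologicalSpace X] [ChartedSpace M X]
    {E' : Type*} [NormedAddCommGroup E'] [NormedSpace ℝ E']
    {M' : Type*} [TopologicalSpace M'] {I' : ModelWithCorners ℝ E' M'}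
    {Y : Type*} [TopologicalSpace Y] [ChartedSpace M' Y] {f : X → Y} {x : X}
    {S T : E →L[ℝ] E'} (h : HasMFDerivAt I I' f x S) (e : S = T) : HasMFDerivAt I I' f x T :=
  e ▸ h

theorem MDifferentiableAt.exists_clm {E : Type*} [NormedAddCommGroup E] [NormedSpace ℝ E]
    {M : Type*} [TopologicalSpace M] {I : ModelWithCorners ℝ E M}
    {X : Type*} [TopologicalSpace X] [ChartedSpace M X]
    {E' : Type*} [NormedAddCommGroup E'] [NormedSpace ℝ E']
    {M' : Type*} [TopologicalSpace M'] {I' : ModelWithCorners ℝ E' M'}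
    {Y : Type*} [TopologicalSpace Y] [ChartedSpace M' Y] {f : X → Y} {x : X}
    (h : MDifferentiableAt I I' f x) : ∃ T : E →L[ℝ] E', HasMFDerivAt I I' f x T :=
  ⟨_, h.hasMFDerivAt⟩

/-! ### Maps with vanishing differential -/

section LocallyConstant

variable {E : Type*} [NormedAddCommGroup E] [NormedSpace ℝ E]
  {M : Type*} [TopologicalSpace M] {I : ModelWithCorners ℝ E M} [I.Boundaryless]
  {X : Type*} [TopologicalSpace X] [ChartedSpace M X] [IsManifold I 1 X]
  {E' : Type*} [NormedAddCommGroup E'] [NormedSpace ℝ E']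
  {M' : Type*} [TopologicalSpace M'] {I' : ModelWithCorners ℝ E' M'}
  {Y : Type*} [TopologicalSpace Y] [ChartedSpace M' Y] [IsManifold I' 1 Y]

/-- In charts the map has zero derivative on a ball, which is convex, so it is constant there; the
chart of the target is injective on its source. -/
theorem eventually_eq_of_hasMFDerivAt_zero {f : X → Y} {x₀ : X}
    (hf : ∀ᶠ x in 𝓝 x₀, HasMFDerivAt I I' f x (0 : E →L[ℝ] E')) : ∀ᶠ x in 𝓝 x₀, f x = f x₀ := by
  set α := extChartAt I x₀
  set β := extChartAt I' (f x₀)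
  have hfc : ContinuousAt f x₀ := hf.self_of_nhds.continuousAt
  have h1 : ∀ᶠ x in 𝓝 x₀, HasMFDerivAt I I' f x (0 : E →L[ℝ] E') ∧ f x ∈ β.source :=
    hf.and (hfc.eventually_mem (extChartAt_source_mem_nhds (f x₀)))
  have hα : Tendsto α.symm (𝓝 (α x₀)) (𝓝 x₀) := by
    have := continuousAt_extChartAt_symm (I := I) x₀
    rwa [ContinuousAt, extChartAt_to_inv] at this
  have h2 := (hα.eventually h1).and
    ((isOpen_extChartAt_target (I := I) x₀).mem_nhds (mem_extChartAt_target x₀))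
  obtain ⟨r, hr, hball⟩ := Metric.mem_nhds_iff.1 h2
  have hd : ∀ p ∈ ball (α x₀) r, HasFDerivAt (β ∘ f ∘ α.symm) (0 : E →L[ℝ] E') p := by
    intro p hp
    obtain ⟨⟨hp1, hp2⟩, hp3⟩ := hball hp
    have d1 : MDifferentiableAt 𝓘(ℝ, E) I α.symm p := by
      have := mdifferentiableWithinAt_extChartAt_symm (I := I) (x := x₀) hp3
      rwa [I.range_eq_univ, mdifferentiableWithinAt_univ] at this
    have d2 : MDifferentiableAt I' 𝓘(ℝ, E') β (f (α.symm p)) :=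
      mdifferentiableAt_extChartAt (by rwa [extChartAt_source] at hp2)
    obtain ⟨T₁, hT₁⟩ := d1.exists_clm
    obtain ⟨T₂, hT₂⟩ := d2.exists_clm
    have := hasMFDerivAt_comp_of_eq hT₂ (hasMFDerivAt_comp_of_eq hp1 hT₁ rfl) rfl
    have e0 : T₂.comp ((0 : E →L[ℝ] E').comp T₁) = 0 := by
      rw [ContinuousLinearMap.zero_comp, ContinuousLinearMap.comp_zero]
    have h0 : HasMFDerivAt 𝓘(ℝ, E) 𝓘(ℝ, E') (β ∘ f ∘ α.symm) p (0 : E →L[ℝ] E') :=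
      HasMFDerivAt.congr_clm this e0
    exact hasMFDerivAt_iff_hasFDerivAt.1 h0
  have hconst : ∀ p ∈ ball (α x₀) r, (β ∘ f ∘ α.symm) p = (β ∘ f ∘ α.symm) (α x₀) :=
    fun p hp => (convex_ball _ r).is_const_of_fderivWithin_eq_zero (𝕜 := ℝ)
      (fun q hq => (hd q hq).differentiableAt.differentiableWithinAt)
      (fun q hq => by rw [fderivWithin_of_isOpen isOpen_ball hq, (hd q hq).fderiv])
      hp (mem_ball_self hr)
  have h3 : ∀ᶠ x in 𝓝 x₀, α x ∈ ball (α x₀) r :=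
    (continuousAt_extChartAt (I := I) x₀).eventually_mem (ball_mem_nhds _ hr)
  filter_upwards [h1, h3, extChartAt_source_mem_nhds (I := I) x₀] with x hx1 hx3 hx
  have := hconst _ hx3
  simp only [Function.comp_apply] at this
  rw [α.left_inv hx, extChartAt_to_inv] at this
  exact β.injOn hx1.2 (mem_extChartAt_source (f x₀)) this

theorem IsPreconnected.eq_of_hasMFDerivAt_zero {f : X → Y} {U : Set X} (hU : IsPreconnected U)
    (hUo : IsOpen U) (hf : ∀ x ∈ U, HasMFDerivAt I I' f x (0 : E →L[ℝ] E')) {x y : X} (hx : x ∈ U)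
    (hy : y ∈ U) : f x = f y := by
  have _ : PreconnectedSpace U := isPreconnected_iff_preconnectedSpace.1 hU
  have hl : IsLocallyConstant (U.domRestrict f) := by
    rw [IsLocallyConstant.iff_eventually_eq]
    intro u
    have h := eventually_eq_of_hasMFDerivAt_zero (I := I) (I' := I') (f := f) (x₀ := u) <| by
      filter_upwards [hUo.mem_nhds u.2] with z hz using hf z hz
    exact continuous_subtype_val.continuousAt.eventually h
  exact hl.apply_eq_of_preconnectedSpace ⟨x, hx⟩ ⟨y, hy⟩

end LocallyConstant

/-! ### Logarithmic derivatives and uniqueness of homomorphisms -/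

section LogarithmicDerivative

variable {E : Type*} [NormedAddCommGroup E] [NormedSpace ℝ E]
  {M : Type*} [TopologicalSpace M] {I : ModelWithCorners ℝ E M}
  {G : Type*} [TopologicalSpace G] [ChartedSpace M G] [Group G]
  {E' : Type*} [NormedAddCommGroup E'] [NormedSpace ℝ E']
  {M' : Type*} [TopologicalSpace M'] {I' : ModelWithCorners ℝ E' M'}
  {G' : Type*} [TopologicalSpace G'] [ChartedSpace M' G'] [Group G']
  [I.Boundaryless] [LieGroup I ∞ G] [I'.Boundaryless] [LieGroup I' ∞ G']

variable (I I') in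
/-- The left logarithmic derivative at `h` of a map between Lie groups is `T`. -/
def HasLogDerivAt (f : G → G') (T : E →L[ℝ] E') (h : G) : Prop :=
  HasMFDerivAt I I' (fun a => (f h)⁻¹ * f (h * a)) 1 T

variable (I I') in
/-- The differential at the identity of a homomorphism of Lie groups, as a map of model spaces. -/
def homDeriv (f : G →* G') : E →L[ℝ] E' := lieDifferential I I' f

theorem hasMFDerivAt_homDeriv {f : G →* G'} (hf : ContMDiff I I' ∞ f) :
    HasMFDerivAt I I' f 1 (homDeriv I I' f : E →L[ℝ] E') :=
  (hf.mdifferentiableAt (by simp)).hasMFDerivAt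

theorem hasLogDerivAt_of_monoidHom {f : G →* G'} (hf : ContMDiff I I' ∞ f) (h : G) :
    HasLogDerivAt I I' f (homDeriv I I' f) h := by
  have e : (fun a => (f h)⁻¹ * f (h * a)) = f := by ext a; simp
  rw [HasLogDerivAt, e]
  exact hasMFDerivAt_homDeriv hf

theorem HasLogDerivAt.mul_left {f : G → G'} {T : E →L[ℝ] E'} {h : G}
    (hf : HasLogDerivAt I I' f T h) (g : G') : HasLogDerivAt I I' (fun x => g * f x) T h := by
  have e : (fun a => (g * f h)⁻¹ * (g * f (h * a))) = fun a => (f h)⁻¹ * f (h * a) := by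
    ext a; group
  rw [HasLogDerivAt, e]
  exact hf

theorem HasLogDerivAt.comp_mul_left {f : G → G'} {T : E →L[ℝ] E'} {g h : G}
    (hf : HasLogDerivAt I I' f T (g * h)) : HasLogDerivAt I I' (fun x => f (g * x)) T h := by
  have e : (fun a => (f (g * h))⁻¹ * (f (g * (h * a)))) =
      fun a => (f (g * h))⁻¹ * f (g * h * a) := by
    ext a; rw [mul_assoc]
  rw [HasLogDerivAt, e]
  exact hf

/-- The quotient is `D (u₁, u₂)`, where `uᵢ = (fᵢ h)⁻¹ * fᵢ x` are both `1` at `x = h` with the same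
derivative there. Since `D` is constant on the diagonal, its differential kills diagonal vectors. -/
theorem HasLogDerivAt.hasMFDerivAt_mul_inv {f₁ f₂ : G → G'} {T : E →L[ℝ] E'} {h : G}
    (h₁ : HasLogDerivAt I I' f₁ T h) (h₂ : HasLogDerivAt I I' f₂ T h) :
    HasMFDerivAt I I' (fun x => f₁ x * (f₂ x)⁻¹) h (0 : E →L[ℝ] E') := by
  let D : G' × G' → G' := fun z => f₁ h * (z.1 * z.2⁻¹) * (f₂ h)⁻¹
  have hD : ContMDiff (I'.prod I') I' ∞ D :=
    (contMDiff_const.mul (contMDiff_fst.mul contMDiff_snd.inv)).mul contMDiff_const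
  have hD1 : HasMFDerivAt (I'.prod I') I' D (1, 1) (mfderiv (I'.prod I') I' D (1, 1)) :=
    (hD.mdifferentiableAt (by simp)).hasMFDerivAt
  set D' : E' × E' →L[ℝ] E' := mfderiv (I'.prod I') I' D (1, 1)
  have hdiag : HasMFDerivAt I' (I'.prod I') (fun z : G' => (z, z)) 1
      ((ContinuousLinearMap.id ℝ E').prod (ContinuousLinearMap.id ℝ E')) :=
    (hasMFDerivAt_id (I := I') (1 : G')).prodMk (hasMFDerivAt_id (I := I') (1 : G'))
  have hzero : D'.comp ((ContinuousLinearMap.id ℝ E').prod (ContinuousLinearMap.id ℝ E')) = 0 := by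
    have c1 := hasMFDerivAt_comp_of_eq hD1 hdiag rfl
    have e : D ∘ (fun z : G' => (z, z)) = fun _ => f₁ h * (f₂ h)⁻¹ := by
      ext z; simp [D]
    rw [e] at c1
    exact hasMFDerivAt_unique c1 (hasMFDerivAt_const (I := I') (I' := I') _ _)
  have hpair : HasMFDerivAt I (I'.prod I')
      (fun a => ((f₁ h)⁻¹ * f₁ (h * a), (f₂ h)⁻¹ * f₂ (h * a))) 1 (T.prod T) :=
    HasMFDerivAt.prodMk h₁ h₂
  have c2 := hasMFDerivAt_comp_of_eq hD1 hpair (by simp)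
  obtain ⟨S, hL⟩ := ((contMDiff_mul_left (I := I) (n := ∞) (a := h⁻¹)).mdifferentiableAt
    (x := h) (by simp)).exists_clm
  have c3 := hasMFDerivAt_comp_of_eq c2 hL (by simp)
  have hTT : D'.comp (T.prod T) = 0 := by
    ext v
    exact congrArg (fun S : E' →L[ℝ] E' => S (T v)) hzero
  have hS : (D'.comp (T.prod T)).comp S = 0 := by rw [hTT, ContinuousLinearMap.zero_comp]
  have c4 : HasMFDerivAt I I' _ h (0 : E →L[ℝ] E') := HasMFDerivAt.congr_clm c3 hS
  refine c4.congr_of_eventuallyEq (Eventually.of_forall fun x => ?_)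
  simp [D, mul_assoc]

/-- Two maps with the same logarithmic derivatives which agree at a point agree. -/
theorem IsPreconnected.eq_of_hasLogDerivAt {f₁ f₂ : G → G'} {T : G → E →L[ℝ] E'} {U : Set G}
    (hU : IsPreconnected U) (hUo : IsOpen U) (h₁ : ∀ x ∈ U, HasLogDerivAt I I' f₁ (T x) x)
    (h₂ : ∀ x ∈ U, HasLogDerivAt I I' f₂ (T x) x) {x y : G} (hx : x ∈ U) (hy : y ∈ U)
    (hxy : f₁ x = f₂ x) : f₁ y = f₂ y := by
  have h := hU.eq_of_hasMFDerivAt_zero (I := I) (I' := I') hUo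
    (f := fun x => f₁ x * (f₂ x)⁻¹)
    (fun x hx => (h₁ x hx).hasMFDerivAt_mul_inv (h₂ x hx)) hx hy
  simp only [hxy, mul_inv_cancel] at h
  exact mul_inv_eq_one.1 h.symm

theorem MonoidHom.eq_of_homDeriv_eq [PreconnectedSpace G] {f₁ f₂ : G →* G'}
    (h₁ : ContMDiff I I' ∞ f₁) (h₂ : ContMDiff I I' ∞ f₂)
    (h : homDeriv I I' f₁ = homDeriv I I' f₂) : f₁ = f₂ := by
  ext g
  refine isPreconnected_univ.eq_of_hasLogDerivAt (I := I) (I' := I') isOpen_univ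
    (T := fun _ => homDeriv I I' f₁)
    (fun x _ => hasLogDerivAt_of_monoidHom h₁ x) (fun x _ => ?_) (mem_univ 1) (mem_univ g) (by simp)
  rw [h]
  exact hasLogDerivAt_of_monoidHom h₂ x

/-- A homomorphism intertwines conjugation by `g` and by `f g`. Differentiating once more, in `g`,
will give compatibility with brackets. -/
theorem homDeriv_comp_adjointMap {f : G →* G'} (hf : ContMDiff I I' ∞ f) (g : G) :
    (homDeriv I I' f).comp (adjointMap I g) = (adjointMap I' (f g)).comp (homDeriv I I' f) := by
  have h1 := hasMFDerivAt_comp_of_eq (hasMFDerivAt_homDeriv hf)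
    (hasMFDerivAt_adjointMap (I := I) g) (by simp)
  have h2 := hasMFDerivAt_comp_of_eq (hasMFDerivAt_adjointMap (I := I') (f g))
    (hasMFDerivAt_homDeriv hf) (map_one f)
  have e : f ∘ (fun x : G => g * x * g⁻¹) = (fun x => f g * x * (f g)⁻¹) ∘ f := by
    ext x; simp
  rw [e] at h1
  exact hasMFDerivAt_unique h1 h2

/-- The differential of a homomorphism of Lie groups is a homomorphism of Lie algebras. -/
theorem homDeriv_bracketCLM [CompleteSpace E] [CompleteSpace E'] {f : G →* G'}
    (hf : ContMDiff I I' ∞ f) (x y : E) :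
    homDeriv I I' f (bracketCLM I G x y) =
      bracketCLM I' G' (homDeriv I I' f x) (homDeriv I I' f y) := by
  have h1 := (hasMFDerivAt_one_iff.1 (hasMFDerivAt_adjointMap_one (I := I) (G := G))).2
  have h2 := (hasMFDerivAt_one_iff.1 (hasMFDerivAt_comp_of_eq
    (hasMFDerivAt_adjointMap_one (I := I') (G := G')) (hasMFDerivAt_homDeriv hf) (map_one f))).2
  have h3 := (hasFDerivAt_const (homDeriv I I' f) _).clm_comp h1
  have h4 := h2.clm_comp (hasFDerivAt_const (homDeriv I I' f) _)
  have e : (fun p => (homDeriv I I' f).comp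
      (((fun g : G => adjointMap I g) ∘ (extChartAt I (1 : G)).symm) p)) =
      fun p => ((((fun g : G' => adjointMap I' g) ∘ f) ∘ (extChartAt I (1 : G)).symm) p).comp
        (homDeriv I I' f) := by
    ext1 p
    exact homDeriv_comp_adjointMap hf _
  rw [e] at h3
  have := congrArg (fun S => S x y) (h3.unique h4)
  simp at this
  exact this

theorem hasFDerivAt_adjointMap_apply [CompleteSpace E] (x : E) :
    HasFDerivAt (fun p => adjointMap I ((extChartAt I (1 : G)).symm p) x)
      ((bracketCLM I G).flip x) (extChartAt I (1 : G) 1) := by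
  have h := (hasMFDerivAt_one_iff.1 (hasMFDerivAt_adjointMap_one (I := I) (G := G))).2
  refine (h.clm_apply (hasFDerivAt_const x _)).congr_fderiv ?_
  ext v
  simp

/-- On a connected Lie group, forms invariant under the Lie algebra are invariant under the
group. -/
theorem adjointMap_invariant_of_isAdInvariant [FiniteDimensional ℝ E] [PreconnectedSpace G]
    {L : LinearMap.BilinForm ℝ (GroupLieAlgebra I G)} (hL : IsAdInvariant L) (g : G)
    (x y : GroupLieAlgebra I G) : L (groupAd I g x) (groupAd I g y) = L x y := by
  let B : E →ₗ[ℝ] E →ₗ[ℝ] ℝ := L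
  let Bc : E →L[ℝ] E →L[ℝ] ℝ := LinearMap.toContinuousLinearMap
    ((LinearMap.toContinuousLinearMap : (E →ₗ[ℝ] ℝ) ≃ₗ[ℝ] (E →L[ℝ] ℝ)).toLinearMap ∘ₗ B)
  have hB (x y : E) : Bc x y = B x y := rfl
  have hBinv (z x y : GroupLieAlgebra I G) : B (bracketCLM I G z x) y = -B x (bracketCLM I G z y) := by
    have := hL z x y
    rw [lie_eq_bracketCLM, lie_eq_bracketCLM] at this
    exact this
  let F (x y : E) : G → ℝ := fun g => Bc (adjointMap I g x) (adjointMap I g y)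
  have h1 (x y : E) : HasMFDerivAt I 𝓘(ℝ, ℝ) (F x y) 1 (0 : E →L[ℝ] ℝ) := by
    rw [hasMFDerivAt_one_iff]
    constructor
    · have hc := (contMDiff_adjointMap (I := I) (G := G)).continuous
      exact ((Bc.continuous.comp (hc.clm_apply continuous_const)).clm_apply
        (hc.clm_apply continuous_const)).continuousAt
    · have hx := hasFDerivAt_adjointMap_apply (I := I) (G := G) x
      have hy := hasFDerivAt_adjointMap_apply (I := I) (G := G) y
      have := (Bc.hasFDerivAt.comp _ hx).clm_apply hy
      refine this.congr_fderiv ?_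
      ext z
      simp only [Function.comp_apply, extChartAt_symm_one, adjointMap_one]
      have := hBinv z x y
      simp [hB]
      linarith
  -- A right translation moves the point `g` to `1`, at the cost of replacing `x` and `y` by `Ad_g
  -- x` and `Ad_g y`.
  have h2 (x y : E) (g : G) : HasMFDerivAt I 𝓘(ℝ, ℝ) (F x y) g (0 : E →L[ℝ] ℝ) := by
    obtain ⟨S, hR⟩ := ((contMDiff_mul_right (I := I) (n := ∞) (a := g⁻¹)).mdifferentiableAt
      (x := g) (by simp)).exists_clm
    have := hasMFDerivAt_comp_of_eq (h1 (adjointMap I g x) (adjointMap I g y)) hR (by simp)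
    have h0 : HasMFDerivAt I 𝓘(ℝ, ℝ) _ g (0 : E →L[ℝ] ℝ) :=
      HasMFDerivAt.congr_clm this (ContinuousLinearMap.zero_comp _)
    refine h0.congr_of_eventuallyEq (Eventually.of_forall fun z => ?_)
    have e (w : E) : adjointMap I z w = adjointMap I (z * g⁻¹) (adjointMap I g w) := by
      rw [← ContinuousLinearMap.comp_apply, ← adjointMap_mul, inv_mul_cancel_right]
    simp only [F, Function.comp_apply, e x, e y]
  have h3 := isPreconnected_univ.eq_of_hasMFDerivAt_zero (I := I) isOpen_univ
    (fun g _ => h2 x y g) (mem_univ g) (mem_univ 1)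
  simp only [F, adjointMap_one] at h3
  exact h3

end LogarithmicDerivative

/-! ### Lie's second theorem -/

section Integration

variable {E : Type*} [NormedAddCommGroup E] [NormedSpace ℝ E]
  {M : Type*} [TopologicalSpace M] {I : ModelWithCorners ℝ E M}
  {G : Type*} [TopologicalSpace G] [ChartedSpace M G] [Group G]
  {E' : Type*} [NormedAddCommGroup E'] [NormedSpace ℝ E']
  {M' : Type*} [TopologicalSpace M'] {I' : ModelWithCorners ℝ E' M'}
  {G' : Type*} [TopologicalSpace G'] [ChartedSpace M' G'] [Group G']

/-- Bootstrapping: if `F` is `C^n`, so is its derivative `A (x, F x)`, hence `F` is `C^(n+1)`. -/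
theorem ContDiffAt.of_total_differential {A : E × E' → E →L[ℝ] E'} {F : E → E'} {c : E}
    (hF : ∀ᶠ x in 𝓝 c, HasFDerivAt F (A (x, F x)) x)
    (hA : ∀ᶠ x in 𝓝 c, ContDiffAt ℝ ∞ A (x, F x)) : ContDiffAt ℝ ∞ F c := by
  have key (n : ℕ) : ∀ᶠ x in 𝓝 c, ContDiffAt ℝ n F x := by
    induction n with
    | zero =>
      filter_upwards [hF.eventually_nhds] with x hx
      refine contDiffAt_zero.2 ⟨_, hx, fun y hy => ?_⟩
      exact (HasFDerivAt.continuousAt hy).continuousWithinAt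
    | succ n ih =>
      filter_upwards [hF.eventually_nhds, hA, ih] with x hx hAx hn
      push_cast
      refine contDiffAt_succ_iff_hasFDerivAt.2 ⟨fun x => A (x, F x), ⟨_, hx, fun y hy => hy⟩, ?_⟩
      exact ContDiffAt.comp x (g := A) (f := fun x => (x, F x))
        (hAx.of_le (by exact_mod_cast le_top)) (contDiffAt_id.prodMk hn)
  exact contDiffAt_infty.2 fun n => (key n).self_of_nhds

variable [I.Boundaryless] [LieGroup I ∞ G] [I'.Boundaryless] [LieGroup I' ∞ G']

local notation "φ" => extChartAt I (1 : G)
local notation "ψ" => extChartAt I' (1 : G')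

variable (I I' G G') in
/-- The coefficients of the total differential equation satisfied, in the charts at the identity,
by a homomorphism with differential `θ`. -/
def homEquation (θ : E →L[ℝ] E') (z : E × E') : E →L[ℝ] E' :=
  (chartLeft I' G' z.2).comp (θ.comp (chartLeft I G z.1).inverse)

theorem contDiffAt_homEquation [CompleteSpace E] (θ : E →L[ℝ] E') {p : E} {q : E'}
    (hp : p ∈ (φ).target)
    (hpi : (chartLeft I G p).IsInvertible) (hq : q ∈ (ψ).target) :
    ContDiffAt ℝ ∞ (homEquation I G I' G' θ) (p, q) := by
  have h1 : ContDiffAt ℝ ∞ (fun z : E × E' => chartLeft I' G' z.2) (p, q) :=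
    ContDiffAt.comp (p, q) (g := chartLeft I' G') (f := Prod.snd) (contDiffAt_chartLeft hq)
      contDiffAt_snd
  have h2 : ContDiffAt ℝ ∞ (fun z : E × E' => chartLeft I G z.1) (p, q) :=
    ContDiffAt.comp (p, q) (g := chartLeft I G) (f := Prod.fst) (contDiffAt_chartLeft hp)
      contDiffAt_fst
  have h3 : ContDiffAt ℝ ∞ (fun z : E × E' => (chartLeft I G z.1).inverse) (p, q) :=
    ContDiffAt.comp (p, q) (g := ContinuousLinearMap.inverse)
      (f := fun z : E × E' => chartLeft I G z.1) hpi.contDiffAt_map_inverse h2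
  exact h1.clm_comp (contDiffAt_const.clm_comp h3)

theorem homEquation_comp_chartLeft (θ : E →L[ℝ] E') {p : E} (q : E')
    (hpi : (chartLeft I G p).IsInvertible) :
    (homEquation I G I' G' θ (p, q)).comp (chartLeft I G p) = (chartLeft I' G' q).comp θ := by
  rw [homEquation, ContinuousLinearMap.comp_assoc, ContinuousLinearMap.comp_assoc,
    hpi.inverse_comp_self, ContinuousLinearMap.comp_id]

/-- Differentiate `A ∘ L = L' ∘ θ` and antisymmetrize on the frame vectors `L_p a`, `L_p b`. By
Maurer-Cartan the derivatives of the two frames contribute `A L_p [a, b] = L'_q θ [a, b]` and `L'_q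
[θ a, θ b]`, which agree; what remains is the symmetry required by the Frobenius theorem. -/
theorem homEquation_integrable [CompleteSpace E] {θ : E →L[ℝ] E'}
    (hθ : ∀ x y, θ (bracketCLM I G x y) = bracketCLM I' G' (θ x) (θ y)) {p : E} {q : E'}
    (hp : p ∈ (φ).target)
    (hpi : ∀ᶠ p' in 𝓝 p, (chartLeft I G p').IsInvertible) (hq : q ∈ (ψ).target) (v w : E) :
    fderiv ℝ (homEquation I G I' G' θ) (p, q) (v, homEquation I G I' G' θ (p, q) v) w =
      fderiv ℝ (homEquation I G I' G' θ) (p, q) (w, homEquation I G I' G' θ (p, q) w) v := by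
  set A := homEquation I G I' G' θ with hAdef
  have hpi0 := hpi.self_of_nhds
  have hA : HasFDerivAt A (fderiv ℝ A (p, q)) (p, q) :=
    ((contDiffAt_homEquation θ hp hpi0 hq).differentiableAt (by simp)).hasFDerivAt
  have hM : HasFDerivAt (chartLeft I G) (fderiv ℝ (chartLeft I G) p) p :=
    ((contDiffAt_chartLeft hp).differentiableAt (by simp)).hasFDerivAt
  have hM' : HasFDerivAt (chartLeft I' G') (fderiv ℝ (chartLeft I' G') q) q :=
    ((contDiffAt_chartLeft hq).differentiableAt (by simp)).hasFDerivAt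
  have hM1 : HasFDerivAt (fun z : E × E' => chartLeft I G z.1)
      ((fderiv ℝ (chartLeft I G) p).comp (ContinuousLinearMap.fst ℝ E E')) (p, q) :=
    HasFDerivAt.comp (p, q) (g := chartLeft I G) hM hasFDerivAt_fst
  have hM2 : HasFDerivAt (fun z : E × E' => chartLeft I' G' z.2)
      ((fderiv ℝ (chartLeft I' G') q).comp (ContinuousLinearMap.snd ℝ E E')) (p, q) :=
    HasFDerivAt.comp (p, q) (g := chartLeft I' G') hM' hasFDerivAt_snd
  have d1 := hA.clm_comp hM1
  have d2 := hM2.clm_comp (hasFDerivAt_const θ (p, q))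
  have hev : (fun z : E × E' => (A z).comp (chartLeft I G z.1)) =ᶠ[𝓝 (p, q)]
      fun z => (chartLeft I' G' z.2).comp θ := by
    have : ∀ᶠ z : E × E' in 𝓝 (p, q), (chartLeft I G z.1).IsInvertible :=
      (continuous_fst.tendsto (p, q)).eventually hpi
    filter_upwards [this] with z hz using homEquation_comp_chartLeft θ z.2 hz
  have d3 := (d2.congr_of_eventuallyEq hev).unique d1
  have key (a b : E) (e : E') : fderiv ℝ (chartLeft I' G') q e (θ b) =
      A (p, q) (fderiv ℝ (chartLeft I G) p a b) + fderiv ℝ A (p, q) (a, e) (chartLeft I G p b) := by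
    have := congrArg (fun T => T (a, e) b) d3
    simpa using this
  have hAM (a : E) : A (p, q) (chartLeft I G p a) = chartLeft I' G' q (θ a) :=
    congrArg (fun T => T a) (homEquation_comp_chartLeft θ q hpi0)
  obtain ⟨e, he⟩ := hpi0
  obtain ⟨a, rfl⟩ : ∃ a, chartLeft I G p a = v := ⟨e.symm v, by rw [← he]; simp⟩
  obtain ⟨b, rfl⟩ : ∃ b, chartLeft I G p b = w := ⟨e.symm w, by rw [← he]; simp⟩
  have k1 := key (chartLeft I G p a) b (A (p, q) (chartLeft I G p a))
  have k2 := key (chartLeft I G p b) a (A (p, q) (chartLeft I G p b))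
  have m1 := fderiv_chartLeft_sub_fderiv_chartLeft (I := I) (G := G) hp a b
  have m2 := fderiv_chartLeft_sub_fderiv_chartLeft (I := I') (G := G') hq (θ a) (θ b)
  have hb := hθ a b
  simp only [bracketCLM, sub_apply, ContinuousLinearMap.flip_apply] at hb
  rw [hAM] at k1 k2
  have h3 := hAM (bracketCLM I G a b)
  simp only [bracketCLM, sub_apply, ContinuousLinearMap.flip_apply] at h3
  rw [k1, k2, ← hb, ← h3, ← m1, map_sub] at m2
  rw [hAM, hAM]
  have : ∀ x y z t : E', x + y - (z + t) = x - z → y = t := by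
    intro x y z t h
    rw [add_sub_add_comm, add_eq_left, sub_eq_zero] at h
    exact h
  exact this _ _ _ _ m2

/-- A homomorphism of Lie algebras is the logarithmic derivative of a map defined near the
identity. -/
theorem exists_hasLogDerivAt [CompleteSpace E] [CompleteSpace E'] {θ : E →L[ℝ] E'}
    (hθ : ∀ x y, θ (bracketCLM I G x y) = bracketCLM I' G' (θ x) (θ y)) :
    ∃ f : G → G', f 1 = 1 ∧ ContMDiffAt I I' ∞ f 1 ∧
      ∀ᶠ h in 𝓝 (1 : G), HasLogDerivAt I I' f θ h := by
  have hc := mem_extChartAt_target (I := I) (1 : G)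
  have hc' := mem_extChartAt_target (I := I') (1 : G')
  have ht : ∀ᶠ p in 𝓝 (φ 1), p ∈ (φ).target := extChartAt_target_mem_nhds_one
  have ht' : ∀ᶠ q in 𝓝 (ψ 1), q ∈ (ψ).target := extChartAt_target_mem_nhds_one
  have hi := eventually_isInvertible_chartLeft (I := I) (G := G)
  obtain ⟨F, hF1, hF⟩ := exists_total_differential_solution (c := φ 1) (c' := ψ 1)
    (A := homEquation I G I' G' θ)
    ((contDiffAt_homEquation θ hc hi.self_of_nhds hc').of_le two_le_infty) (by
      rw [nhds_prod_eq]
      filter_upwards [(hi.eventually_nhds.and ht).prod_mk ht'] with z hz v w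
      exact homEquation_integrable hθ hz.1.2 hz.1.1 hz.2 v w)
  have hFc : ContinuousAt F (φ 1) := hF.self_of_nhds.continuousAt
  have hFt : ∀ᶠ p in 𝓝 (φ 1), F p ∈ (ψ).target := hFc.eventually_mem (by rwa [hF1])
  have hFs : ContDiffAt ℝ ∞ F (φ 1) := by
    refine ContDiffAt.of_total_differential hF ?_
    filter_upwards [ht, hi, hFt] with p hp hpi hFp
    exact contDiffAt_homEquation θ hp hpi hFp
  refine ⟨fun g => (ψ).symm (F (φ g)), ?_, ?_, ?_⟩
  · change (ψ).symm (F (φ 1)) = 1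
    rw [hF1, extChartAt_symm_one]
  · have h1 : ContMDiffAt I 𝓘(ℝ, E') ∞ (fun g => F (φ g)) 1 :=
      ContMDiffAt.comp (1 : G) (g := F) hFs.contMDiffAt contMDiffAt_extChartAt
    refine ContMDiffAt.comp (1 : G) (g := (ψ).symm) ?_ h1
    rw [hF1]
    exact contMDiffAt_extChartAt_symm_of_mem hc'
  · have hφ : Tendsto φ (𝓝 1) (𝓝 (φ 1)) := continuousAt_extChartAt (I := I) (1 : G)
    filter_upwards [hφ.eventually (ht.and (hi.and (hFt.and hF))),
      extChartAt_source_mem_nhds (I := I) (1 : G)] with h ⟨hp, hpi, hFp, hFd⟩ hh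
    have e1 : (φ).symm (φ h) = h := (φ).left_inv hh
    have d1 := hasMFDerivAt_chart_mul_left hp
    rw [e1] at d1
    have d2 := hasMFDerivAt_comp_of_eq (HasFDerivAt.hasMFDerivAt hFd) d1 (by rw [mul_one])
    have e2 := homEquation_comp_chartLeft (I' := I') (G' := G') θ (F (φ h)) hpi
    have d3 : HasMFDerivAt I 𝓘(ℝ, E') (F ∘ fun a => φ (h * a)) (1 : G)
        ((chartLeft I' G' (F (φ h))).comp θ) :=
      HasMFDerivAt.congr_clm d2 e2
    set q := F (φ h) with hq
    have hS : ContMDiffAt 𝓘(ℝ, E') I' ∞ (fun y => ((ψ).symm q)⁻¹ * (ψ).symm y) q :=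
      contMDiffAt_const.mul (contMDiffAt_extChartAt_symm_of_mem hFp)
    obtain ⟨S, hS⟩ := (hS.mdifferentiableAt (by simp)).exists_clm
    have d4 := hasMFDerivAt_chart_mul_left (I := I') (G := G') hFp
    have eq1 : ψ ((ψ).symm q * 1) = q := by rw [mul_one]; exact (ψ).right_inv hFp
    have d5 := hasMFDerivAt_comp_of_eq hS d4 eq1
    -- Going from `G'` to the chart by translation by `q` and back is the identity. So `S` cancels
    -- the factor `L'_q` in `DF ∘ L_p = L'_q ∘ θ`, and the logarithmic derivative is `θ`.
    have hid : S.comp (chartLeft I' G' q) = ContinuousLinearMap.id ℝ E' := by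
      have _ : ContinuousMul G' := continuousMul_of_contMDiffMul I' ∞
      have hev : (fun a : G' => a) =ᶠ[𝓝 1]
          (fun y => ((ψ).symm q)⁻¹ * (ψ).symm y) ∘ fun a => ψ ((ψ).symm q * a) := by
        have hcont : ContinuousAt (fun a : G' => (ψ).symm q * a) 1 := by fun_prop
        have hmem : (ψ).source ∈ 𝓝 ((ψ).symm q * 1) := by
          rw [mul_one]
          exact (isOpen_extChartAt_source (I := I') (1 : G')).mem_nhds ((ψ).map_target hFp)
        filter_upwards [hcont.eventually_mem hmem] with a ha
        change a = ((ψ).symm q)⁻¹ * (ψ).symm (ψ ((ψ).symm q * a))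
        rw [(ψ).left_inv ha, inv_mul_cancel_left]
      exact hasMFDerivAt_unique (d5.congr_of_eventuallyEq hev) (hasMFDerivAt_id (I := I') (1 : G'))
    have eq2 : F (φ (h * 1)) = q := by rw [mul_one]
    have d6 := hasMFDerivAt_comp_of_eq hS d3 eq2
    have e3 : S.comp ((chartLeft I' G' q).comp θ) = θ := by
      rw [← ContinuousLinearMap.comp_assoc, hid, ContinuousLinearMap.id_comp]
    exact HasMFDerivAt.congr_clm d6 e3

/-- Smoothness at `1` is carried to `g` by `f x = f g * f (g⁻¹ * x)`. -/
theorem MonoidHom.contMDiff_of_contMDiffAt_one {f : G →* G'} (hf : ContMDiffAt I I' ∞ f 1) :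
    ContMDiff I I' ∞ f := by
  intro g
  have h1 : ContMDiffAt I I' ∞ f (g⁻¹ * g) := by rwa [inv_mul_cancel]
  have h2 : ContMDiffAt I I' ∞ (fun x => f g * f (g⁻¹ * x)) g :=
    contMDiffAt_const.mul (ContMDiffAt.comp g (g := f) (f := fun x => g⁻¹ * x) h1
      contMDiff_mul_left.contMDiffAt)
  refine h2.congr_of_eventuallyEq (Eventually.of_forall fun x => ?_)
  simp only [map_mul, map_inv, mul_inv_cancel_left]

/-- Lie's second theorem: a homomorphism from the Lie algebra of a simply connected Lie group
integrates to a homomorphism of Lie groups. -/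
theorem exists_monoidHom_homDeriv_eq [CompleteSpace E] [CompleteSpace E']
    [SimplyConnectedSpace G] [LocallyPathConnectedSpace G] {θ : E →L[ℝ] E'}
    (hθ : ∀ x y, θ (bracketCLM I G x y) = bracketCLM I' G' (θ x) (θ y)) :
    ∃ σ : G →* G', ContMDiff I I' ∞ σ ∧ homDeriv I I' σ = θ := by
  have _ : IsTopologicalGroup G := topologicalGroup_of_lieGroup I ∞
  obtain ⟨f, f1, hfs, hf⟩ := exists_hasLogDerivAt (I := I) (G := G) (I' := I') (G' := G') hθ
  obtain ⟨V, hVo, hV1, hV⟩ := exists_open_nhds_one_mul_subset hf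
  obtain ⟨W, ⟨hWo, hW1, hWc⟩, hWV⟩ :=
    (LocallyConnectedSpace.open_connected_basis (1 : G)).mem_iff.1
      (inter_mem hf (hVo.mem_nhds hV1))
  simp only [id] at hWV
  -- As functions of `b`, both sides have logarithmic derivative `θ` on the connected set `W` and
  -- agree at `b = 1`. The choice of `V` keeps `a * b` where the logarithmic derivative is known.
  have hloc : ∀ a ∈ W, ∀ b ∈ W, f (a * b) = f a * f b := by
    intro a ha b hb
    refine hWc.isPreconnected.eq_of_hasLogDerivAt (I := I) (I' := I') hWo (T := fun _ => θ)
      (f₁ := fun b => f (a * b)) (f₂ := fun b => f a * f b) (fun x hx => ?_) (fun x hx => ?_)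
      hW1 hb (by simp [f1])
    · exact HasLogDerivAt.comp_mul_left (hV (Set.mul_mem_mul (hWV ha).2 (hWV hx).2))
    · exact HasLogDerivAt.mul_left (hWV hx).1 (f a)
  obtain ⟨σ, hσ⟩ := exists_monoidHom_eventuallyEq f W (hWo.mem_nhds hW1) hloc
  have hσs : ContMDiff I I' ∞ σ :=
    MonoidHom.contMDiff_of_contMDiffAt_one (hfs.congr_of_eventuallyEq hσ)
  refine ⟨σ, hσs, ?_⟩
  have h1 : HasLogDerivAt I I' f θ 1 := hf.self_of_nhds
  have e : (fun a => (f 1)⁻¹ * f (1 * a)) = f := by ext a; simp [f1]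
  rw [HasLogDerivAt, e] at h1
  exact hasMFDerivAt_unique (hasMFDerivAt_homDeriv hσs) (h1.congr_of_eventuallyEq hσ)

end Integration

/-! ### Invariant Legendrian forms on the three Lie algebras -/

section LieAlgebras

variable {𝔤 : Type*} [LieRing 𝔤] [LieAlgebra ℝ 𝔤]

theorem LinearMap.BilinForm.nondegenerate_of_isSymm {k W : Type*} [Field k] [AddCommGroup W]
    [Module k W] {L : LinearMap.BilinForm k W} (hs : L.IsSymm)
    (h : ∀ x, (∀ y, L x y = 0) → x = 0) : L.Nondegenerate :=
  ⟨h, fun y hy => h y fun x => by rw [← hs.eq x y]; simpa using hy x⟩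

theorem CoadjointLie.isLegendrianStructure :
    IsLegendrianStructure (CoadjointLie.involution 𝔤) (CoadjointLie.pairing 𝔤) := by
  have hs : (CoadjointLie.pairing 𝔤).IsSymm := ⟨fun x y => by
    simp [CoadjointLie.pairing, add_comm]⟩
  refine ⟨⟨fun w => ?_, hs, ?_, fun x y => ?_⟩, fun x y z => ?_⟩
  · ext <;> simp [CoadjointLie.involution]
  · refine LinearMap.BilinForm.nondegenerate_of_isSymm hs fun x hx => ?_
    have h1 (y : CoadjointLie 𝔤) : y.right x.left + x.right y.left = 0 := hx y
    have h2 : x.right = 0 := by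
      ext y
      simpa using h1 ⟨y, 0⟩
    have h3 : x.left = 0 := by
      rw [← Module.forall_dual_apply_eq_zero_iff ℝ]
      intro l
      simpa using h1 ⟨0, l⟩
    exact CoadjointLie.ext h3 h2
  · simp [CoadjointLie.pairing, CoadjointLie.involution, add_comm]
  · simp only [CoadjointLie.pairing, LinearMap.mk₂_apply, CoadjointLie.left_lie,
      CoadjointLie.right_lie, LinearMap.sub_apply, Module.Dual.lie_apply]
    rw [← lie_skew x.left y.left, ← lie_skew y.left z.left, ← lie_skew x.left z.left]
    simp only [map_neg]
    ring

theorem productPairing_isLegendrianStructure {B : LinearMap.BilinForm ℝ 𝔤}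
    (hB : IsInvariantInnerProduct B) :
    IsLegendrianStructure (swapInvolution 𝔤) (productPairing B) := by
  have hs : (productPairing B).IsSymm := ⟨fun x y => by
    have h1 : B x.1 y.1 = B y.1 x.1 := hB.symm.eq x.1 y.1
    have h2 : B x.2 y.2 = B y.2 x.2 := hB.symm.eq x.2 y.2
    simp [productPairing, h1, h2]⟩
  refine ⟨⟨fun w => rfl, hs, ?_, fun x y => ?_⟩, fun x y z => ?_⟩
  · refine LinearMap.BilinForm.nondegenerate_of_isSymm hs fun x hx => ?_
    have h1 (y : 𝔤 × 𝔤) : (1 / 2 : ℝ) * (B x.1 y.1 - B x.2 y.2) = 0 := hx y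
    have h2 : x.1 = 0 := by
      by_contra h
      have := h1 (x.1, 0)
      have := hB.pos _ h
      simp_all
    have h3 : x.2 = 0 := by
      by_contra h
      have := h1 (0, x.2)
      have := hB.pos _ h
      simp_all
    exact Prod.ext h2 h3
  · change (1 / 2 : ℝ) * (B x.2 y.1 - B x.1 y.2) = -((1 / 2 : ℝ) * (B x.1 y.2 - B x.2 y.1))
    ring
  · have h1 := hB.invariant x.1 y.1 z.1
    have h2 := hB.invariant x.2 y.2 z.2
    change (1 / 2 : ℝ) * (B ⁅x.1, y.1⁆ z.1 - B ⁅x.2, y.2⁆ z.2) =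
      -((1 / 2 : ℝ) * (B y.1 ⁅x.1, z.1⁆ - B y.2 ⁅x.2, z.2⁆))
    rw [h1, h2]
    ring

theorem eq_zero_of_neg_eq_self {V : Type*} [AddCommGroup V] [Module ℝ V] {l : V} (h : -l = l) :
    l = 0 := by
  have h1 : (2 : ℝ) • l = 0 := by
    rw [two_smul]
    nth_rw 1 [← h]
    exact neg_add_cancel l
  exact (smul_eq_zero.1 h1).resolve_left two_ne_zero

theorem exists_eq_one_tmul_add_I_tmul {V : Type*} [AddCommGroup V] [Module ℝ V] (z : ℂ ⊗[ℝ] V) :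
    ∃ x y : V, z = (1 : ℂ) ⊗ₜ[ℝ] x + Complex.I ⊗ₜ[ℝ] y := by
  induction z using TensorProduct.induction_on with
  | zero => exact ⟨0, 0, by simp⟩
  | tmul c v =>
    refine ⟨c.re • v, c.im • v, ?_⟩
    rw [TensorProduct.tmul_smul, TensorProduct.tmul_smul, TensorProduct.smul_tmul',
      TensorProduct.smul_tmul', ← TensorProduct.add_tmul]
    congr 1
    simp
  | add z w hz hw =>
    obtain ⟨x, y, rfl⟩ := hz
    obtain ⟨x', y', rfl⟩ := hw
    refine ⟨x + x', y + y', ?_⟩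
    rw [TensorProduct.tmul_add, TensorProduct.tmul_add]
    abel

theorem conjInvolution_tmul (c : ℂ) (x : 𝔤) :
    conjInvolution 𝔤 (c ⊗ₜ x) = (starRingEnd ℂ c) ⊗ₜ x := by
  simp [conjInvolution]

/-- Both sides are biadditive, so pure tensors suffice. It serves to show that the complexified
differential preserves brackets. -/
theorem lie_eq_of_tmul {V : Type*} [NormedAddCommGroup V] [NormedSpace ℝ V]
    (f : ℂ ⊗[ℝ] 𝔤 →ₗ[ℝ] V) (b : V →L[ℝ] V →L[ℝ] V)
    (h : ∀ (c c' : ℂ) (x y : 𝔤), f ((c * c') ⊗ₜ ⁅x, y⁆) = b (f (c ⊗ₜ x)) (f (c' ⊗ₜ y)))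
    (z w : ℂ ⊗[ℝ] 𝔤) : f ⁅z, w⁆ = b (f z) (f w) := by
  induction z using TensorProduct.induction_on with
  | zero => simp
  | add z z' hz hz' => simp only [add_lie, map_add, add_apply, hz, hz']
  | tmul c x =>
    induction w using TensorProduct.induction_on with
    | zero =>
      have h0 : ⁅c ⊗ₜ[ℝ] x, (0 : ℂ ⊗[ℝ] 𝔤)⁆ = 0 := lie_zero (c ⊗ₜ[ℝ] x)
      simp only [h0, map_zero]
    | add w w' hw hw' =>
      have h0 : ⁅c ⊗ₜ[ℝ] x, w + w'⁆ = ⁅c ⊗ₜ[ℝ] x, w⁆ + ⁅c ⊗ₜ[ℝ] x, w'⁆ := lie_add (c ⊗ₜ[ℝ] x) w w'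
      rw [h0, map_add, map_add, map_add, hw, hw']
    | tmul c' y => rw [LieAlgebra.ExtendScalars.bracket_tmul, h]

theorem baseChange_isSymm {B : LinearMap.BilinForm ℝ 𝔤} (hB : B.IsSymm) :
    (B.baseChange ℂ).IsSymm := 
  ⟨fun z w => (LinearMap.BilinForm.IsSymm.baseChange ℂ ⟨hB.eq⟩ : LinearMap.IsSymm _).eq z w⟩

/-- For `z = x + √-1 y`, pairing with `y` has imaginary part `B y y`, and pairing with `√-1 x` has
imaginary part `B x x`. Using imaginary parts alone covers both `B^ℂ` and `Λ₋`. -/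
theorem baseChange_nondegenerate {B : LinearMap.BilinForm ℝ 𝔤} (hB : IsInvariantInnerProduct B)
    {z : ℂ ⊗[ℝ] 𝔤} (hz : ∀ w, (B.baseChange ℂ z w).im = 0) : z = 0 := by
  obtain ⟨x, y, rfl⟩ := exists_eq_one_tmul_add_I_tmul z
  have h1 := hz ((1 : ℂ) ⊗ₜ y)
  have h2 := hz (Complex.I ⊗ₜ x)
  simp at h1 h2
  have hy : y = 0 := by
    by_contra h
    exact (hB.pos y h).ne' h1
  have hx : x = 0 := by
    by_contra h
    exact (hB.pos x h).ne' h2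
  simp [hx, hy]

theorem baseChange_isAdInvariant {B : LinearMap.BilinForm ℝ 𝔤} (hB : IsAdInvariant B) :
    IsAdInvariant (B.baseChange ℂ) := by
  intro x y z
  induction x using TensorProduct.induction_on with
  | zero => simp
  | add x x' hx hx' => simp only [add_lie, map_add, LinearMap.add_apply, hx, hx', neg_add]
  | tmul a x =>
    induction y using TensorProduct.induction_on with
    | zero => simp
    | add y y' hy hy' => simp only [lie_add, map_add, LinearMap.add_apply, hy, hy', neg_add]
    | tmul b y =>
      induction z using TensorProduct.induction_on with
      | zero => simp
      | add z z' hz hz' => simp only [lie_add, map_add, hz, hz', neg_add]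
      | tmul c z =>
        simp only [LieAlgebra.ExtendScalars.bracket_tmul, LinearMap.BilinForm.baseChange_tmul, hB x y z]
        rw [neg_smul, mul_right_comm, mul_comm]

theorem imPairing_isLegendrianStructure {B : LinearMap.BilinForm ℝ 𝔤}
    (hB : IsInvariantInnerProduct B) :
    IsLegendrianStructure (conjInvolution 𝔤) (imPairing B) := by
  have hs : (imPairing B).IsSymm := ⟨fun x y => by
    have : B.baseChange ℂ x y = B.baseChange ℂ y x := (baseChange_isSymm hB.symm).eq x y
    simp [imPairing, this]⟩
  refine ⟨⟨fun w => ?_, hs, ?_, fun x y => ?_⟩, fun x y z => ?_⟩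
  · obtain ⟨x, y, rfl⟩ := exists_eq_one_tmul_add_I_tmul w
    simp [conjInvolution]
  · exact LinearMap.BilinForm.nondegenerate_of_isSymm hs fun z hz => baseChange_nondegenerate hB hz
  · obtain ⟨x, x', rfl⟩ := exists_eq_one_tmul_add_I_tmul x
    obtain ⟨y, y', rfl⟩ := exists_eq_one_tmul_add_I_tmul y
    simp [conjInvolution, imPairing, add_comm]
  · have := congrArg Complex.im (baseChange_isAdInvariant hB.invariant x y z)
    rwa [Complex.neg_im] at this

end LieAlgebras

/-! ### From symmetric pairs to Legendrian symmetric pairs -/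

section Pairs

variable {E : Type*} [NormedAddCommGroup E] [NormedSpace ℝ E]
  {M : Type*} [TopologicalSpace M] {I : ModelWithCorners ℝ E M}
  {H : Type*} [TopologicalSpace H] [ChartedSpace M H] [Group H]
  {𝔥 : Type*} [LieRing 𝔥] [LieAlgebra ℝ 𝔥]

theorem IsLegendrianSymmetricPairVia.isLegendrianSymmetricPair {K : Subgroup H} {σ : H →* H}
    {s : 𝔥 →ₗ⁅ℝ⁆ 𝔥} {L : LinearMap.BilinForm ℝ 𝔥} {f : 𝔥 ≃ₗ[ℝ] GroupLieAlgebra I H}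
    (h : IsLegendrianSymmetricPairVia I K σ s L f) : IsLegendrianSymmetricPair I K :=
  ⟨σ, _, h.pair⟩

/-- A symmetric pair is Legendrian if its Lie algebra has an invariant Legendrian form which is
invariant under the group. -/
theorem IsSymmetricPairWith.isLegendrianSymmetricPairVia {K : Subgroup H} {σ : H →* H}
    {s : 𝔥 →ₗ⁅ℝ⁆ 𝔥} {L : LinearMap.BilinForm ℝ 𝔥} {f : 𝔥 ≃ₗ[ℝ] GroupLieAlgebra I H}
    (hp : IsSymmetricPairWith I K σ) (hL : IsLegendrianStructure s L)
    (hf : ∀ x y : 𝔥, f ⁅x, y⁆ = ⁅f x, f y⁆) (hs : ∀ x, lieDifferential I I σ (f x) = f (s x))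
    (hinv : ∀ (h : H) (x y : GroupLieAlgebra I H), LinearMap.BilinForm.congr f L (groupAd I h x) y =
      LinearMap.BilinForm.congr f L x (groupAd I h⁻¹ y)) :
    IsLegendrianSymmetricPairVia I K σ s L f := by
  have hσ (x : GroupLieAlgebra I H) : f.symm (lieDifferential I I σ x) = s (f.symm x) := by
    rw [LinearEquiv.symm_apply_eq, ← hs, LinearEquiv.apply_symm_apply]
  have hb (x y : GroupLieAlgebra I H) : f.symm ⁅x, y⁆ = ⁅f.symm x, f.symm y⁆ := by
    rw [LinearEquiv.symm_apply_eq, hf, LinearEquiv.apply_symm_apply, LinearEquiv.apply_symm_apply]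
  refine ⟨hf, hs, hp, ⟨fun w => ?_, ⟨fun x y => ?_⟩, ?_, fun x y => ?_⟩, fun x y z => ?_, hinv⟩
  · obtain ⟨x, rfl⟩ := f.surjective w
    simp only [ContinuousLinearMap.coe_coe, hs]
    exact congrArg f (hL.legendrian.involutive x)
  · exact hL.legendrian.symm.eq (f.symm x) (f.symm y)
  · exact hL.legendrian.nondegenerate.congr f
  · simp only [ContinuousLinearMap.coe_coe, LinearMap.BilinForm.congr_apply, hσ]
    exact hL.legendrian.skew _ _
  · simp only [LinearMap.BilinForm.congr_apply, hb]
    exact hL.invariant _ _ _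

end Pairs

/-! ### The pair `(G × G, Δ(G))` -/

section Product

variable {E : Type*} [NormedAddCommGroup E] [NormedSpace ℝ E] [FiniteDimensional ℝ E]
  {G : Type*} [TopologicalSpace G] [ChartedSpace E G] [Group G] [LieGroup 𝓘(ℝ, E) ∞ G]

theorem homDeriv_fst : homDeriv (𝓘(ℝ, E).prod 𝓘(ℝ, E)) 𝓘(ℝ, E) (MonoidHom.fst G G) =
    ContinuousLinearMap.fst ℝ E E :=
  (hasMFDerivAt_fst (I := 𝓘(ℝ, E)) (I' := 𝓘(ℝ, E)) (1 : G × G)).mfderiv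

theorem homDeriv_snd : homDeriv (𝓘(ℝ, E).prod 𝓘(ℝ, E)) 𝓘(ℝ, E) (MonoidHom.snd G G) =
    ContinuousLinearMap.snd ℝ E E :=
  (hasMFDerivAt_snd (I := 𝓘(ℝ, E)) (I' := 𝓘(ℝ, E)) (1 : G × G)).mfderiv

theorem homDeriv_groupSwap : homDeriv (𝓘(ℝ, E).prod 𝓘(ℝ, E)) (𝓘(ℝ, E).prod 𝓘(ℝ, E))
    (groupSwap G) = (ContinuousLinearMap.snd ℝ E E).prod (ContinuousLinearMap.fst ℝ E E) :=
  ((hasMFDerivAt_snd (I := 𝓘(ℝ, E)) (I' := 𝓘(ℝ, E)) (1 : G × G)).prodMk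
    (hasMFDerivAt_fst (I := 𝓘(ℝ, E)) (I' := 𝓘(ℝ, E)) (1 : G × G))).mfderiv

/-- The two projections are homomorphisms of Lie groups, so their differentials preserve brackets.
The same argument computes `Ad`. -/
theorem bracketCLM_prod (x y : E × E) : bracketCLM (𝓘(ℝ, E).prod 𝓘(ℝ, E)) (G × G) x y =
    (bracketCLM 𝓘(ℝ, E) G x.1 y.1, bracketCLM 𝓘(ℝ, E) G x.2 y.2) := by
  have h1 := homDeriv_bracketCLM (I := 𝓘(ℝ, E).prod 𝓘(ℝ, E)) (I' := 𝓘(ℝ, E))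
    (f := MonoidHom.fst G G) contMDiff_fst x y
  have h2 := homDeriv_bracketCLM (I := 𝓘(ℝ, E).prod 𝓘(ℝ, E)) (I' := 𝓘(ℝ, E))
    (f := MonoidHom.snd G G) contMDiff_snd x y
  rw [homDeriv_fst] at h1
  rw [homDeriv_snd] at h2
  exact Prod.ext h1 h2

theorem adjointMap_prod (g : G × G) (x : E × E) : adjointMap (𝓘(ℝ, E).prod 𝓘(ℝ, E)) g x =
    (adjointMap 𝓘(ℝ, E) g.1 x.1, adjointMap 𝓘(ℝ, E) g.2 x.2) := by
  have h1 := homDeriv_comp_adjointMap (I := 𝓘(ℝ, E).prod 𝓘(ℝ, E)) (I' := 𝓘(ℝ, E))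
    (f := MonoidHom.fst G G) contMDiff_fst g
  have h2 := homDeriv_comp_adjointMap (I := 𝓘(ℝ, E).prod 𝓘(ℝ, E)) (I' := 𝓘(ℝ, E))
    (f := MonoidHom.snd G G) contMDiff_snd g
  rw [homDeriv_fst] at h1
  rw [homDeriv_snd] at h2
  exact Prod.ext (congrArg (fun T => T x) h1) (congrArg (fun T => T x) h2)

theorem adjointMap_inv_apply (g : G) (x : E) :
    adjointMap 𝓘(ℝ, E) g (adjointMap 𝓘(ℝ, E) g⁻¹ x) = x := by
  have h := adjointMap_mul (I := 𝓘(ℝ, E)) g g⁻¹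
  rw [mul_inv_cancel, adjointMap_one] at h
  exact (congrArg (fun T => T x) h).symm

theorem groupAd_invariant_inv [PreconnectedSpace G]
    {L : LinearMap.BilinForm ℝ (GroupLieAlgebra 𝓘(ℝ, E) G)} (hL : IsAdInvariant L) (g : G)
    (x y : GroupLieAlgebra 𝓘(ℝ, E) G) :
    L (groupAd 𝓘(ℝ, E) g x) y = L x (groupAd 𝓘(ℝ, E) g⁻¹ y) := by
  rw [← adjointMap_invariant_of_isAdInvariant hL g x]
  exact congrArg (L (groupAd 𝓘(ℝ, E) g x)) (adjointMap_inv_apply (E := E) g y).symm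

/-- On a one-point group the chart would have an open singleton as target, impossible in a nonzero
normed space. Needed for the swap to differ from the identity. -/
theorem ChartedSpace.nontrivial [Nontrivial E] : Nontrivial G := by
  by_contra h
  have _ : Subsingleton G := not_nontrivial_iff_subsingleton.1 h
  have h1 := (chartAt E (1 : G)).open_target
  have h2 : (chartAt E (1 : G)).target ⊆ {chartAt E (1 : G) 1} := by
    intro x hx
    rw [mem_singleton_iff, ← (chartAt E (1 : G)).right_inv hx]
    exact congrArg _ (Subsingleton.elim _ _)
  have _ := Module.punctured_nhds_neBot ℝ E (chartAt E (1 : G) 1)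
  have h3 : (chartAt E (1 : G)).target = {chartAt E (1 : G) 1} :=
    h2.antisymm (singleton_subset_iff.2 ((chartAt E (1 : G)).map_source (mem_chart_source E 1)))
  rw [h3] at h1
  exact not_isOpen_singleton _ h1

theorem mem_diagonalSubgroup {g : G × G} : g ∈ diagonalSubgroup G ↔ groupSwap G g = g := by
  constructor
  · rintro ⟨a, rfl⟩
    rfl
  · intro h
    have h1 : g.1 = g.2 := congrArg Prod.snd h
    exact ⟨g.1, Prod.ext rfl h1⟩

theorem isSymmetricPairWith_groupSwap [Nontrivial E] [T2Space G] :
    IsSymmetricPairWith (𝓘(ℝ, E).prod 𝓘(ℝ, E)) (diagonalSubgroup G) (groupSwap G) where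
  lieGroup := inferInstance
  isClosed := by
    have h : (diagonalSubgroup G : Set (G × G)) = {g | groupSwap G g = g} :=
      Set.ext fun _ => mem_diagonalSubgroup
    rw [h]
    exact isClosed_eq (continuous_snd.prodMk continuous_fst) continuous_id
  contMDiff := contMDiff_snd.prodMk contMDiff_fst
  involutive _ := rfl
  ne_id h := by
    obtain ⟨a, ha⟩ := @exists_ne G (ChartedSpace.nontrivial (E := E)) 1
    exact ha (congrArg Prod.snd (DFunLike.congr_fun h (a, 1)))
  component_subset := (connectedComponentIn_subset _ _).trans fun _ h => mem_diagonalSubgroup.2 h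
  le_fixed _ h := mem_diagonalSubgroup.1 h

theorem isLegendrianSymmetricPairVia_groupSwap [Nontrivial E] [T2Space G] [PreconnectedSpace G]
    {B : LinearMap.BilinForm ℝ (GroupLieAlgebra 𝓘(ℝ, E) G)} (hB : IsInvariantInnerProduct B) :
    IsLegendrianSymmetricPairVia (𝓘(ℝ, E).prod 𝓘(ℝ, E)) (diagonalSubgroup G) (groupSwap G)
      (swapInvolution (GroupLieAlgebra 𝓘(ℝ, E) G)) (productPairing B) (productLieEquiv E G) := by
  refine isSymmetricPairWith_groupSwap.isLegendrianSymmetricPairVia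
    (productPairing_isLegendrianStructure hB) (fun x y => ?_) (fun x => ?_) (fun h x y => ?_)
  · let x' : E × E := x
    let y' : E × E := y
    rw [lie_eq_bracketCLM]
    refine Eq.trans ?_ (bracketCLM_prod (G := G) x' y').symm
    exact Prod.ext (lie_eq_bracketCLM (I := 𝓘(ℝ, E)) (G := G) x.1 y.1)
      (lie_eq_bracketCLM (I := 𝓘(ℝ, E)) (G := G) x.2 y.2)
  · exact congrArg (fun T => T x) (homDeriv_groupSwap (E := E) (G := G))
  · have h1 := adjointMap_prod (E := E) h x
    have h2 := adjointMap_prod (E := E) h⁻¹ y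
    have h3 := groupAd_invariant_inv hB.invariant h.1 x.1 y.1
    have h4 := groupAd_invariant_inv hB.invariant h.2 x.2 y.2
    let P : E × E → E × E → ℝ := fun x y => productPairing B x y
    change P (adjointMap _ h x) y = P x (adjointMap _ h⁻¹ y)
    rw [h1, h2]
    change (1 / 2 : ℝ) * (B _ _ - B _ _) = (1 / 2 : ℝ) * (B _ _ - B _ _)
    exact congrArg (fun t : ℝ => 1 / 2 * t) (congrArg₂ (· - ·) h3 h4)

end Product

/-! ### Conjugations and the inverse of the adjoint representation -/

section Conjugation

variable {E : Type*} [NormedAddCommGroup E] [NormedSpace ℝ E] [CompleteSpace E]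
  {M : Type*} [TopologicalSpace M] {I : ModelWithCorners ℝ E M}
  {G : Type*} [TopologicalSpace G] [ChartedSpace M G] [Group G]
  [I.Boundaryless] [LieGroup I ∞ G]

theorem adjointMap_bracketCLM (g : G) (x y : E) :
    adjointMap I g (bracketCLM I G x y) =
      bracketCLM I G (adjointMap I g x) (adjointMap I g y) :=
  homDeriv_bracketCLM (I := I) (I' := I) (f := (MulAut.conj g).toMonoidHom)
    (contMDiff_mul_mul_inv g) x y

theorem bracketCLM_swap (x y : E) : bracketCLM I G x y = -bracketCLM I G y x := by
  simp [bracketCLM]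

/-- Product rule at the identity for `Ad_g ∘ Ad_{g⁻¹} = id`. -/
theorem hasMFDerivAt_adjointMap_inv_one :
    HasMFDerivAt I 𝓘(ℝ, E →L[ℝ] E) (fun g : G => adjointMap I g⁻¹) 1
      (-bracketCLM I G : E →L[ℝ] E →L[ℝ] E) := by
  have hs : ContMDiff I 𝓘(ℝ, E →L[ℝ] E) ∞ (fun g : G => adjointMap I g⁻¹) :=
    contMDiff_adjointMap.comp (contMDiff_inv I ∞)
  obtain ⟨T, hT⟩ := ((hs 1).mdifferentiableAt (by simp)).exists_clm
  have h1 := (hasMFDerivAt_one_iff.1 (hasMFDerivAt_adjointMap_one (I := I) (G := G))).2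
  have h2 := (hasMFDerivAt_one_iff.1 hT).2
  have h3 := h1.clm_comp h2
  have h4 : HasFDerivAt (fun _ : E => ContinuousLinearMap.id ℝ E)
      (0 : E →L[ℝ] E →L[ℝ] E) (extChartAt I (1 : G) 1) :=
    hasFDerivAt_const _ _
  have e : (fun p : E => (((fun g : G => adjointMap I g) ∘ (extChartAt I (1 : G)).symm) p).comp
      (((fun g : G => adjointMap I g⁻¹) ∘ (extChartAt I (1 : G)).symm) p)) =
      fun _ => ContinuousLinearMap.id ℝ E := by
    ext1 p
    simp only [Function.comp]
    rw [← adjointMap_mul, mul_inv_cancel, adjointMap_one]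
  rw [e] at h3
  have h5 := h3.unique h4
  simp only [Function.comp, extChartAt_symm_one, inv_one, adjointMap_one] at h5
  refine HasMFDerivAt.congr_clm hT ?_
  ext x y
  have := congrArg (fun S => S x y) h5
  simp at this
  rw [neg_apply, neg_apply]
  exact eq_neg_of_add_eq_zero_left this

end Conjugation

/-! ### Lie group structure, adjoint action and bracket of `G ⋊ 𝔤*` -/

namespace CoadjointGroup

variable {E : Type*} [NormedAddCommGroup E] [NormedSpace ℝ E]
  {G : Type*} [TopologicalSpace G] [ChartedSpace E G] [Group G]

theorem contMDiff_fst : ContMDiff (model E) 𝓘(ℝ, E) ∞ (fun x : CoadjointGroup E G => x.1) :=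
  _root_.contMDiff_fst (M := G) (N := E →L[ℝ] ℝ)

theorem contMDiff_snd :
    ContMDiff (model E) 𝓘(ℝ, E →L[ℝ] ℝ) ∞ (fun x : CoadjointGroup E G => x.2) :=
  _root_.contMDiff_snd (M := G) (N := E →L[ℝ] ℝ)

theorem contMDiff_mk {E' M' X : Type*} [NormedAddCommGroup E'] [NormedSpace ℝ E']
    [TopologicalSpace M'] {J : ModelWithCorners ℝ E' M'} [TopologicalSpace X] [ChartedSpace M' X]
    {f : X → G} {l : X → E →L[ℝ] ℝ} (hf : ContMDiff J 𝓘(ℝ, E) ∞ f)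
    (hl : ContMDiff J 𝓘(ℝ, E →L[ℝ] ℝ) ∞ l) :
    ContMDiff J (model E) ∞ (fun x => ((f x, l x) : CoadjointGroup E G)) :=
  hf.prodMk hl

variable [LieGroup 𝓘(ℝ, E) ∞ G]

theorem fst_one : (1 : CoadjointGroup E G).1 = 1 := rfl

theorem snd_one : (1 : CoadjointGroup E G).2 = 0 := rfl

theorem fst_mul (x y : CoadjointGroup E G) : (x * y).1 = x.1 * y.1 := rfl

theorem snd_mul (x y : CoadjointGroup E G) :
    (x * y).2 = x.2 + y.2.comp (adjointMap 𝓘(ℝ, E) x.1⁻¹) := rfl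

theorem fst_inv (x : CoadjointGroup E G) : x⁻¹.1 = x.1⁻¹ := rfl

theorem snd_inv (x : CoadjointGroup E G) : x⁻¹.2 = -x.2.comp (adjointMap 𝓘(ℝ, E) x.1) := by
  change -x.2.comp (adjointMap 𝓘(ℝ, E) x.1⁻¹⁻¹) = _
  rw [inv_inv]

variable [CompleteSpace E]

/-- Smoothness of the product and the inverse rests on the smoothness of `Ad` on `G`. -/
instance : LieGroup (model E) ∞ (CoadjointGroup E G) where
  toIsManifold := inferInstanceAs (IsManifold (model E) ∞ (G × (E →L[ℝ] ℝ)))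
  contMDiff_mul := by
    have h1 := contMDiff_fst.comp (_root_.contMDiff_fst (I := model E) (J := model E) (n := ∞)
      (M := CoadjointGroup E G) (N := CoadjointGroup E G))
    have h2 := contMDiff_fst.comp (_root_.contMDiff_snd (I := model E) (J := model E) (n := ∞)
      (M := CoadjointGroup E G) (N := CoadjointGroup E G))
    have h3 := contMDiff_snd.comp (_root_.contMDiff_fst (I := model E) (J := model E) (n := ∞)
      (M := CoadjointGroup E G) (N := CoadjointGroup E G))
    have h4 := contMDiff_snd.comp (_root_.contMDiff_snd (I := model E) (J := model E) (n := ∞)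
      (M := CoadjointGroup E G) (N := CoadjointGroup E G))
    exact contMDiff_mk (h1.mul h2)
      (h3.add (h4.clm_comp (contMDiff_adjointMap.comp h1.inv)))
  contMDiff_inv := by
    have h1 := contMDiff_fst (E := E) (G := G)
    exact contMDiff_mk h1.inv
      ((contMDiff_snd.clm_comp (contMDiff_adjointMap.comp h1.inv.inv)).neg)

variable (E G) in
/-- The projection `G ⋊ 𝔤* → G`. -/
def fstHom : CoadjointGroup E G →* G where
  toFun x := x.1
  map_one' := rfl
  map_mul' _ _ := rfl

theorem hasMFDerivAt_fst : HasMFDerivAt (model E) 𝓘(ℝ, E) (fun x : CoadjointGroup E G => x.1) 1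
    (ContinuousLinearMap.fst ℝ E (E →L[ℝ] ℝ)) :=
  _root_.hasMFDerivAt_fst (I := 𝓘(ℝ, E)) (I' := 𝓘(ℝ, E →L[ℝ] ℝ)) ((1, 0) : G × (E →L[ℝ] ℝ))

theorem hasMFDerivAt_snd :
    HasMFDerivAt (model E) 𝓘(ℝ, E →L[ℝ] ℝ) (fun x : CoadjointGroup E G => x.2) 1
      (ContinuousLinearMap.snd ℝ E (E →L[ℝ] ℝ)) :=
  _root_.hasMFDerivAt_snd (I := 𝓘(ℝ, E)) (I' := 𝓘(ℝ, E →L[ℝ] ℝ)) ((1, 0) : G × (E →L[ℝ] ℝ))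

theorem homDeriv_fstHom : homDeriv (model E) 𝓘(ℝ, E) (fstHom E G) =
    ContinuousLinearMap.fst ℝ E (E →L[ℝ] ℝ) :=
  hasMFDerivAt_fst.mfderiv

theorem homDeriv_groupInvolution : homDeriv (model E) (model E) (groupInvolution E G) =
    (ContinuousLinearMap.fst ℝ E (E →L[ℝ] ℝ)).prod (-ContinuousLinearMap.snd ℝ E (E →L[ℝ] ℝ)) := by
  have h : HasMFDerivAt (model E) 𝓘(ℝ, E →L[ℝ] ℝ) (fun x : CoadjointGroup E G => -x.2) 1
      (-ContinuousLinearMap.snd ℝ E (E →L[ℝ] ℝ) : E × (E →L[ℝ] ℝ) →L[ℝ] (E →L[ℝ] ℝ)) :=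
    hasMFDerivAt_one_iff.2 ⟨(hasMFDerivAt_one_iff.1 hasMFDerivAt_snd).1.neg,
      (hasMFDerivAt_one_iff.1 hasMFDerivAt_snd).2.neg⟩
  exact (HasMFDerivAt.prodMk hasMFDerivAt_fst h).mfderiv

theorem hasMFDerivAt_mul_mul_inv_snd (a : CoadjointGroup E G) :
    HasMFDerivAt (model E) 𝓘(ℝ, E →L[ℝ] ℝ) (fun x : CoadjointGroup E G => (a * x * a⁻¹).2) 1
      ((((ContinuousLinearMap.compL ℝ E E ℝ).flip (adjointMap 𝓘(ℝ, E) a.1⁻¹)).comp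
        (ContinuousLinearMap.snd ℝ E (E →L[ℝ] ℝ)) +
      (ContinuousLinearMap.compL ℝ E E ℝ a.2).comp ((bracketCLM 𝓘(ℝ, E) G).comp
        ((adjointMap 𝓘(ℝ, E) a.1).comp (ContinuousLinearMap.fst ℝ E (E →L[ℝ] ℝ))))) :
        E × (E →L[ℝ] ℝ) →L[ℝ] (E →L[ℝ] ℝ)) := by
  have h1 := hasMFDerivAt_comp_of_eq (hasMFDerivAt_adjointMap a.1)
    (hasMFDerivAt_fst (E := E) (G := G)) rfl
  have h2 := hasMFDerivAt_comp_of_eq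
    (hasMFDerivAt_adjointMap_inv_one (I := 𝓘(ℝ, E)) (G := G)) h1
    (by change a.1 * 1 * a.1⁻¹ = 1; simp)
  have h3 := (hasMFDerivAt_one_iff.1 h2).2
  have h4 := (hasMFDerivAt_one_iff.1 (hasMFDerivAt_snd (E := E) (G := G))).2
  have h5 := (((ContinuousLinearMap.compL ℝ E E ℝ).flip
    (adjointMap 𝓘(ℝ, E) a.1⁻¹)).hasFDerivAt.comp _ h4).sub
    ((ContinuousLinearMap.compL ℝ E E ℝ a.2).hasFDerivAt.comp _ h3)
  -- Only two terms depend on `x`: one is linear in `x.2`, the other contains `Ad` at the inverse of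
  -- the conjugate of `x.1`, whose differential brings in `-ad`.
  have e (x : CoadjointGroup E G) : (a * x * a⁻¹).2 = a.2 +
      (x.2.comp (adjointMap 𝓘(ℝ, E) a.1⁻¹) -
        a.2.comp (adjointMap 𝓘(ℝ, E) (a.1 * x.1 * a.1⁻¹)⁻¹)) := by
    rw [snd_mul, snd_mul, snd_inv, fst_mul, add_assoc, mul_inv_rev (a.1 * x.1), inv_inv,
      adjointMap_mul, sub_eq_add_neg]
    rfl
  refine hasMFDerivAt_one_iff.2 ⟨?_, ?_⟩
  · exact (contMDiff_snd.comp (contMDiff_mul_mul_inv (I := model E) a)).continuous.continuousAt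
  · refine ((h5.const_add a.2).congr_of_eventuallyEq (Eventually.of_forall fun p => e _)).congr_fderiv
      ?_
    refine ContinuousLinearMap.ext fun v => ContinuousLinearMap.ext fun w => ?_
    change v.2 (adjointMap 𝓘(ℝ, E) a.1⁻¹ w) -
      a.2 (-(bracketCLM 𝓘(ℝ, E) G (adjointMap 𝓘(ℝ, E) a.1 v.1) w)) = v.2 _ + a.2 _
    rw [map_neg, sub_neg_eq_add]
    rfl

theorem adjointMap_eq (a : CoadjointGroup E G) (x : E × (E →L[ℝ] ℝ)) :
    adjointMap (model E) a x = (adjointMap 𝓘(ℝ, E) a.1 x.1,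
      x.2.comp (adjointMap 𝓘(ℝ, E) a.1⁻¹) +
        a.2.comp (bracketCLM 𝓘(ℝ, E) G (adjointMap 𝓘(ℝ, E) a.1 x.1))) := by
  have h1 := hasMFDerivAt_comp_of_eq (hasMFDerivAt_adjointMap a.1)
    (hasMFDerivAt_fst (E := E) (G := G)) rfl
  have h2 : adjointMap (model E) a = _ :=
    (HasMFDerivAt.prodMk h1 (hasMFDerivAt_mul_mul_inv_snd a)).mfderiv
  exact congrArg (fun T => T x) h2

/-- The first component follows from the projection to `G`. The second is the derivative at the
identity of `a ↦ Ad_a y`; since `a.2` vanishes there, the factor multiplying it need not be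
differentiated. -/
theorem bracketCLM_eq (x y : E × (E →L[ℝ] ℝ)) :
    bracketCLM (model E) (CoadjointGroup E G) x y = (bracketCLM 𝓘(ℝ, E) G x.1 y.1,
      -y.2.comp (bracketCLM 𝓘(ℝ, E) G x.1) + x.2.comp (bracketCLM 𝓘(ℝ, E) G y.1)) := by
  have h1 := homDeriv_bracketCLM (I := model E) (I' := 𝓘(ℝ, E)) (f := fstHom E G)
    contMDiff_fst x y
  rw [homDeriv_fstHom] at h1
  refine Prod.ext h1 ?_
  have h2 := (ContinuousLinearMap.snd ℝ E (E →L[ℝ] ℝ)).hasFDerivAt.comp _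
    (hasFDerivAt_adjointMap_apply (I := model E) (G := CoadjointGroup E G) y)
  have h3 := (hasMFDerivAt_one_iff.1 (hasMFDerivAt_comp_of_eq
    (hasMFDerivAt_adjointMap_inv_one (I := 𝓘(ℝ, E)) (G := G)) hasMFDerivAt_fst rfl)).2
  have h4 := (hasMFDerivAt_one_iff.1 (hasMFDerivAt_comp_of_eq
    (hasMFDerivAt_adjointMap_one (I := 𝓘(ℝ, E)) (G := G)) hasMFDerivAt_fst rfl)).2
  have h5 := (hasMFDerivAt_one_iff.1 (hasMFDerivAt_snd (E := E) (G := G))).2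
  have h6 := ((hasFDerivAt_const y.2 _).clm_comp h3).add (h5.clm_comp
    ((bracketCLM 𝓘(ℝ, E) G).hasFDerivAt.comp _ (h4.clm_apply (hasFDerivAt_const y.1 _))))
  have h7 := (h2.congr_of_eventuallyEq (Eventually.of_forall fun p =>
    (congrArg Prod.snd (adjointMap_eq _ y)).symm)).unique h6
  simp only [Function.comp_apply, extChartAt_symm_one, fst_one, snd_one, inv_one, adjointMap_one,
    ContinuousLinearMap.comp_zero, add_zero, zero_add, ContinuousLinearMap.id_apply] at h7
  have h8 := congrArg (fun T => T x) h7
  refine h8.trans ?_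
  refine ContinuousLinearMap.ext fun v => ?_
  change y.2 (-(bracketCLM 𝓘(ℝ, E) G x.1 v)) + ((0 : E →L[ℝ] ℝ) _ + x.2 _) = -(y.2 _) + x.2 _
  rw [map_neg, zero_apply, zero_add]
  rfl

end CoadjointGroup

/-! ### The pair `(G ⋊ 𝔤*, G)` -/

namespace CoadjointGroup

variable {E : Type*} [NormedAddCommGroup E] [NormedSpace ℝ E] [FiniteDimensional ℝ E]
  {G : Type*} [TopologicalSpace G] [ChartedSpace E G] [Group G] [LieGroup 𝓘(ℝ, E) ∞ G]

theorem mem_range_inl {a : CoadjointGroup E G} :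
    a ∈ (inl E G).range ↔ groupInvolution E G a = a := by
  constructor
  · rintro ⟨g, rfl⟩
    exact Prod.ext rfl (neg_zero (G := E →L[ℝ] ℝ))
  · intro h
    have h1 : -a.2 = a.2 := congrArg Prod.snd h
    exact ⟨a.1, Prod.ext rfl (eq_zero_of_neg_eq_self h1).symm⟩

theorem isSymmetricPairWith_groupInvolution [Nontrivial E] :
    IsSymmetricPairWith (model E) (inl E G).range (groupInvolution E G) where
  lieGroup := inferInstance
  isClosed := by
    have h : ((inl E G).range : Set (CoadjointGroup E G)) = {a | a.2 = 0} := by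
      ext a
      refine mem_range_inl.trans ⟨fun h => ?_, fun h => ?_⟩
      · have h1 : -a.2 = a.2 := congrArg Prod.snd h
        exact eq_zero_of_neg_eq_self h1
      · have h1 : -a.2 = a.2 := by rw [show a.2 = 0 from h, neg_zero]
        exact Prod.ext rfl h1
    rw [h]
    exact isClosed_eq contMDiff_snd.continuous continuous_const
  contMDiff := contMDiff_mk contMDiff_fst contMDiff_snd.neg
  involutive a := Prod.ext rfl (neg_neg a.2)
  ne_id h := by
    obtain ⟨v, hv⟩ := exists_ne (0 : E)
    -- A nonzero linear form `l` is moved by the involution; it exists because `E` is nonzero.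
    obtain ⟨l, hl⟩ := exists_dual_vector ℝ v (norm_ne_zero_iff.2 hv)
    have h1 : -l = l := congrArg Prod.snd (DFunLike.congr_fun h (1, l))
    rw [eq_zero_of_neg_eq_self h1] at hl
    simp at hl
  component_subset := (connectedComponentIn_subset _ _).trans fun _ h => mem_range_inl.2 h
  le_fixed _ h := mem_range_inl.1 h

theorem isLegendrianSymmetricPairVia_groupInvolution [Nontrivial E] :
    IsLegendrianSymmetricPairVia (model E) (inl E G).range (groupInvolution E G)
      (CoadjointLie.involution (GroupLieAlgebra 𝓘(ℝ, E) G))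
      (CoadjointLie.pairing (GroupLieAlgebra 𝓘(ℝ, E) G)) (lieEquiv E G) := by
  refine isSymmetricPairWith_groupInvolution.isLegendrianSymmetricPairVia
    CoadjointLie.isLegendrianStructure (fun x y => ?_) (fun x => ?_) (fun a x y => ?_)
  · rw [lie_eq_bracketCLM]
    let x' : E × (E →L[ℝ] ℝ) := lieEquiv E G x
    let y' : E × (E →L[ℝ] ℝ) := lieEquiv E G y
    refine Eq.trans ?_ (bracketCLM_eq (G := G) x' y').symm
    refine Prod.ext (lie_eq_bracketCLM (I := 𝓘(ℝ, E)) (G := G) x.left y.left) ?_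
    refine ContinuousLinearMap.ext fun v => ?_
    let v' : GroupLieAlgebra 𝓘(ℝ, E) G := v
    have h1 : ⁅x.left, v'⁆ = bracketCLM 𝓘(ℝ, E) G x.left v' := lie_eq_bracketCLM _ _
    have h2 : ⁅y.left, v'⁆ = bracketCLM 𝓘(ℝ, E) G y.left v' := lie_eq_bracketCLM _ _
    change -y.right ⁅x.left, v'⁆ - -x.right ⁅y.left, v'⁆ = -y.right _ + x.right _
    rw [h1, h2, sub_neg_eq_add]
    rfl
  · exact congrArg (fun T => T (lieEquiv E G x)) (homDeriv_groupInvolution (E := E) (G := G))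
  · let P : E × (E →L[ℝ] ℝ) → E × (E →L[ℝ] ℝ) → ℝ := fun x y => y.2 x.1 + x.2 y.1
    -- Apart from matching terms, the two sides contain `a.2 [Ad x.1, y.1]` and `-a.2 (Ad [Ad⁻¹ y.1,
    -- x.1])`, with `Ad` taken at `a.1`. They agree because `Ad` preserves brackets and the bracket
    -- is antisymmetric.
    have key (x y : E × (E →L[ℝ] ℝ)) :
        P (adjointMap (model E) a x) y = P x (adjointMap (model E) a⁻¹ y) := by
      have h1 := adjointMap_bracketCLM (I := 𝓘(ℝ, E)) a.1 (adjointMap 𝓘(ℝ, E) a.1⁻¹ y.1) x.1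
      rw [adjointMap_inv_apply] at h1
      simp only [adjointMap_eq, P, fst_inv, snd_inv, inv_inv, add_apply, neg_apply,
        ContinuousLinearMap.comp_apply, h1]
      rw [bracketCLM_swap y.1, map_neg]
      ring
    exact key x y

end CoadjointGroup

/-! ### Complex Lie groups as real Lie groups -/

section RestrictScalars

variable {F : Type*} [NormedAddCommGroup F] [NormedSpace ℂ F]
  {H : Type*} [TopologicalSpace H] [ChartedSpace F H]
  {F' : Type*} [NormedAddCommGroup F'] [NormedSpace ℂ F']
  {H' : Type*} [TopologicalSpace H'] [ChartedSpace F' H']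

theorem IsManifold.restrictScalars_real [IsManifold 𝓘(ℂ, F) ∞ H] : IsManifold 𝓘(ℝ, F) ∞ H := by
  refine isManifold_of_contDiffOn _ _ _ fun e e' he he' => ?_
  have h := (contDiffGroupoid ∞ 𝓘(ℂ, F)).compatible he he'
  exact ContDiffOn.restrict_scalars ℝ h.1

theorem ContMDiff.restrictScalars_real {f : H → H'} (hf : ContMDiff 𝓘(ℂ, F) 𝓘(ℂ, F') ∞ f) :
    ContMDiff 𝓘(ℝ, F) 𝓘(ℝ, F') ∞ f := fun x =>
  contMDiffAt_iff.2 ⟨(contMDiffAt_iff.1 (hf x)).1, (contMDiffAt_iff.1 (hf x)).2.restrict_scalars ℝ⟩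

theorem ContMDiff.restrictScalars_real_prod {f : H × H → H'}
    (hf : ContMDiff (𝓘(ℂ, F).prod 𝓘(ℂ, F)) 𝓘(ℂ, F') ∞ f) :
    ContMDiff (𝓘(ℝ, F).prod 𝓘(ℝ, F)) 𝓘(ℝ, F') ∞ f := fun x =>
  contMDiffAt_iff.2 ⟨(contMDiffAt_iff.1 (hf x)).1, (contMDiffAt_iff.1 (hf x)).2.restrict_scalars ℝ⟩

theorem HasMFDerivAt.restrictScalars_real {f : H → H'} {x : H} {T : F →L[ℂ] F'}
    (hf : HasMFDerivAt 𝓘(ℂ, F) 𝓘(ℂ, F') f x T) :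
    HasMFDerivAt 𝓘(ℝ, F) 𝓘(ℝ, F') f x (T.restrictScalars ℝ : F →L[ℝ] F') :=
  ⟨hf.1, HasFDerivWithinAt.restrictScalars ℝ (E := F) (F := F') (f' := T) hf.2⟩

variable [Group H] [LieGroup 𝓘(ℂ, F) ∞ H]

theorem LieGroup.restrictScalars_real : LieGroup 𝓘(ℝ, F) ∞ H :=
  { IsManifold.restrictScalars_real with
    contMDiff_mul := (contMDiff_mul 𝓘(ℂ, F) ∞).restrictScalars_real_prod
    contMDiff_inv := (_root_.contMDiff_inv 𝓘(ℂ, F) ∞).restrictScalars_real }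

/-- Conjugation is holomorphic, so its real differential is the restriction of a complex linear map.
Differentiating in `h` makes the bracket complex linear in its second argument. -/
theorem adjointMap_smul (h : H) (c : ℂ) (v : F) :
    adjointMap 𝓘(ℝ, F) h (c • v) = c • adjointMap 𝓘(ℝ, F) h v := by
  have h1 : ContMDiff 𝓘(ℂ, F) 𝓘(ℂ, F) ∞ (fun x : H => h * x * h⁻¹) :=
    (contMDiff_const.mul contMDiff_id).mul contMDiff_const
  let T : F →L[ℂ] F := mfderiv 𝓘(ℂ, F) 𝓘(ℂ, F) (fun x : H => h * x * h⁻¹) 1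
  have h2 : HasMFDerivAt 𝓘(ℂ, F) 𝓘(ℂ, F) (fun x : H => h * x * h⁻¹) 1 T :=
    ((h1 1).mdifferentiableAt (by simp)).hasMFDerivAt
  have h3 : adjointMap 𝓘(ℝ, F) h = T.restrictScalars ℝ := h2.restrictScalars_real.mfderiv
  rw [h3]
  exact T.map_smul c v

theorem bracketCLM_smul_right [CompleteSpace F] (c : ℂ) (x y : F) :
    bracketCLM 𝓘(ℝ, F) H x (c • y) = c • bracketCLM 𝓘(ℝ, F) H x y := by
  have _ : LieGroup 𝓘(ℝ, F) ∞ H := LieGroup.restrictScalars_real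
  have h1 := hasFDerivAt_adjointMap_apply (I := 𝓘(ℝ, F)) (G := H) (c • y)
  have h2 := (hasFDerivAt_adjointMap_apply (I := 𝓘(ℝ, F)) (G := H) y).const_smul c
  have h3 := h1.unique (h2.congr_of_eventuallyEq (Eventually.of_forall fun p => adjointMap_smul _ c y))
  exact congrArg (fun T => T x) h3

theorem bracketCLM_smul_left [CompleteSpace F] (c : ℂ) (x y : F) :
    bracketCLM 𝓘(ℝ, F) H (c • x) y = c • bracketCLM 𝓘(ℝ, F) H x y := by
  have _ : LieGroup 𝓘(ℝ, F) ∞ H := LieGroup.restrictScalars_real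
  rw [bracketCLM_swap, bracketCLM_smul_right, ← smul_neg, ← bracketCLM_swap]

end RestrictScalars

/-! ### Fixed points of an endomorphism near the identity -/

section FixedPoints

/-- A limit `h` of `K` is fixed. For `k ∈ K` close to `h`, the fixed element `h⁻¹ * k` is close to
`1`, hence in `K`, and so is `h`. -/
theorem isClosed_of_eventually_fixed {H : Type*} [Group H] [TopologicalSpace H]
    [IsTopologicalGroup H] [T2Space H] {σ : H →* H} (hσ : Continuous σ) {K : Subgroup H}
    (hK : ∀ h ∈ K, σ h = h) (hloc : ∀ᶠ h in 𝓝 (1 : H), σ h = h → h ∈ K) :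
    IsClosed (K : Set H) := by
  have hS : IsClosed {h : H | σ h = h} := isClosed_eq hσ continuous_id
  refine isClosed_of_closure_subset fun h hh => ?_
  have hs : σ h = h := closure_minimal (fun k hk => hK k hk) hS hh
  have h1 : ∀ᶠ k in 𝓝 h, σ (h⁻¹ * k) = h⁻¹ * k → h⁻¹ * k ∈ K := by
    have hc : Tendsto (fun k => h⁻¹ * k) (𝓝 h) (𝓝 1) := by
      have : ContinuousAt (fun k => h⁻¹ * k) h := by fun_prop
      simpa [ContinuousAt] using this
    exact hc.eventually hloc
  obtain ⟨k, hk, hkK⟩ := mem_closure_iff_nhds.1 hh _ h1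
  have h2 : h⁻¹ * k ∈ K := hk (by rw [map_mul, map_inv, hs, hK k hkK])
  have h3 := K.mul_mem hkK (K.inv_mem h2)
  simpa using h3

open scoped Pointwise in
-- Within the fixed point set `K` is closed, and open because it is cut out by the open set `K * U`;
-- a connected set of fixed points through `1` cannot leave it.
theorem connectedComponentIn_fixed_subset {H : Type*} [Group H] [TopologicalSpace H]
    [IsTopologicalGroup H] [T2Space H] {σ : H →* H} (hσ : Continuous σ) {K : Subgroup H}
    (hK : ∀ h ∈ K, σ h = h) (hloc : ∀ᶠ h in 𝓝 (1 : H), σ h = h → h ∈ K) :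
    connectedComponentIn {h : H | σ h = h} 1 ⊆ K := by
  obtain ⟨U, hU, hUo, hU1⟩ := eventually_nhds_iff.1 hloc
  intro x hx
  by_contra hxK
  have key : ∀ y ∈ connectedComponentIn {h : H | σ h = h} 1, y ∈ (K : Set H) * U → y ∈ K := by
    rintro y hy ⟨k, hk, u, hu, rfl⟩
    have h1 : σ (k * u) = k * u := connectedComponentIn_subset {h : H | σ h = h} 1 hy
    rw [map_mul, hK k hk, mul_right_inj] at h1
    exact K.mul_mem hk (hU u hu h1)
  obtain ⟨y, hy, hyU, hyK⟩ := isPreconnected_connectedComponentIn (F := {h : H | σ h = h}) (x := 1)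
    ((K : Set H) * U) (K : Set H)ᶜ hUo.mul_left
    (isClosed_of_eventually_fixed hσ hK hloc).isOpen_compl
    (fun y hy => by
      by_cases h : y ∈ K
      · exact Or.inl ⟨y, h, 1, hU1, mul_one y⟩
      · exact Or.inr h)
    ⟨1, mem_connectedComponentIn (map_one σ), 1, K.one_mem, 1, hU1, mul_one 1⟩
    ⟨x, hx, hxK⟩
  exact hyK (key y hy hyU)

variable {E : Type*} [NormedAddCommGroup E] [NormedSpace ℝ E] [FiniteDimensional ℝ E]
  {M : Type*} [TopologicalSpace M] {I : ModelWithCorners ℝ E M}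
  {G : Type*} [TopologicalSpace G] [ChartedSpace M G] [Group G]
  {E' : Type*} [NormedAddCommGroup E'] [NormedSpace ℝ E'] [CompleteSpace E']
  {M' : Type*} [TopologicalSpace M'] {I' : ModelWithCorners ℝ E' M'}
  {H : Type*} [TopologicalSpace H] [ChartedSpace M' H] [Group H]
  [I.Boundaryless] [LieGroup I ∞ G] [I'.Boundaryless] [LieGroup I' ∞ H]

local notation "φ" => extChartAt I (1 : G)
local notation "ψ" => extChartAt I' (1 : H)

/-- Both partial maps at the identity are the identity near it, and a linear map on a product is the
sum of its restrictions to the factors. -/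
theorem fderiv_chartMul_one : fderiv ℝ (chartMul I' H) (ψ 1, ψ 1) =
    ContinuousLinearMap.fst ℝ E' E' + ContinuousLinearMap.snd ℝ E' E' := by
  have hc := contDiffAt_chartMul_left (I := I') (G := H) (mem_extChartAt_target (1 : H))
  have hd := (hc.differentiableAt (by simp)).hasFDerivAt
  have h1 := HasFDerivAt.comp (ψ 1) (f := fun p => (ψ 1, p)) hd
    ((hasFDerivAt_const (ψ 1) (ψ 1)).prodMk (hasFDerivAt_id (ψ 1)))
  have h2 := HasFDerivAt.comp (ψ 1) (f := fun p => (p, ψ 1)) hd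
    ((hasFDerivAt_id (ψ 1)).prodMk (hasFDerivAt_const (ψ 1) (ψ 1)))
  have h3 := h1.fderiv.symm.trans (chartLeft_one (I := I') (G := H))
  have h4 := h2.fderiv.symm.trans (chartRight_one (I := I') (G := H))
  refine ContinuousLinearMap.ext fun v => ?_
  have h5 := congrArg (fun T => T v.2) h3
  have h6 := congrArg (fun T => T v.1) h4
  have h7 : v = (v.1, 0) + (0, v.2) := by simp
  rw [h7, map_add]
  simpa using congrArg₂ (· + ·) h6 h5

/-- Near the identity, the fixed points of an endomorphism `σ` of a Lie group lie in a subgroup of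
fixed points whose Lie algebra is complementary to a subspace on which the differential of `σ` is
`-1`. -/
theorem eventually_mem_range_of_fixed {f : G →* H} (hf : ContMDiff I I' ∞ f) {σ : H →* H}
    (hσ : ContMDiff I' I' ∞ σ) (hσf : ∀ g, σ (f g) = f g) {n : E →L[ℝ] E'}
    (hn : Function.Injective n) (hσn : ∀ x, homDeriv I' I' σ (n x) = -n x)
    (hsurj : ∀ y, ∃ a b, homDeriv I I' f a + n b = y) :
    ∀ᶠ h in 𝓝 (1 : H), σ h = h → h ∈ f.range := by
  have _ : ContinuousMul H := continuousMul_of_contMDiffMul I' ∞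
  have hc := mem_extChartAt_target (I := I) (1 : G)
  have hc' := mem_extChartAt_target (I := I') (1 : H)
  have hφ1 : (φ).symm (φ 1) = 1 := extChartAt_symm_one
  have hψ1 : (ψ).symm (ψ 1) = 1 := extChartAt_symm_one
  have hφc : ContinuousAt (φ).symm (φ 1) := (contMDiffAt_extChartAt_symm_of_mem hc).continuousAt
  have hψc : ContinuousAt (ψ).symm (ψ 1) := (contMDiffAt_extChartAt_symm_of_mem hc').continuousAt
  let q : E → E' := fun v => ψ 1 + n v
  have hq : HasFDerivAt q n 0 := n.hasFDerivAt.const_add (ψ 1)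
  have hq0 : q 0 = ψ 1 := by simp [q]
  have hψq : ContinuousAt (fun v => (ψ).symm (q v)) 0 :=
    ContinuousAt.comp (g := (ψ).symm) (by rwa [hq0]) hq.continuousAt
  -- the transversal `q` meets the fixed point set only at the identity
  have htrans : ∀ᶠ v in 𝓝 (0 : E), σ ((ψ).symm (q v)) = (ψ).symm (q v) → v = 0 := by
    have h1 : HasMFDerivAt I' 𝓘(ℝ, E') (fun h => ψ (σ h)) 1 (homDeriv I' I' σ : E' →L[ℝ] E') := by
      have := hasMFDerivAt_comp_of_eq (hasMFDerivAt_extChartAt_one (I := I') (map_one σ))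
        (hasMFDerivAt_homDeriv hσ) rfl
      exact HasMFDerivAt.congr_clm this (ContinuousLinearMap.id_comp _)
    have h2 := (hasMFDerivAt_one_iff.1 h1).2
    rw [← hq0] at h2
    have h3 := (h2.comp (0 : E) hq).sub hq
    -- In the chart, `σ ∘ q - q` has derivative `-2 n` at `0`. This is injective on a
    -- finite-dimensional space, hence bounded below, so `σ ∘ q - q` has no other zeros near `0`.
    have h4 : ∀ x, ((homDeriv I' I' σ).comp n - n) x = (-2 : ℝ) • n x := by
      intro x
      rw [sub_apply, ContinuousLinearMap.comp_apply, hσn, neg_smul, two_smul, neg_add, sub_eq_add_neg]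
    have h5 : Function.Injective ((homDeriv I' I' σ).comp n - n) := by
      intro x y hxy
      rw [h4, h4] at hxy
      exact hn (smul_right_injective _ (by norm_num) hxy)
    obtain ⟨C, _, hC⟩ := LinearMap.exists_antilipschitzWith
      ((homDeriv I' I' σ).comp n - n : E →L[ℝ] E').toLinearMap (LinearMap.ker_eq_bot.2 h5)
    have h6 := h3.eventually_ne (c := 0) ⟨C, hC⟩
    rw [eventually_nhdsWithin_iff] at h6
    filter_upwards [h6, hq.continuousAt.eventually_mem
      (by rw [hq0]; exact extChartAt_target_mem_nhds_one)] with v hv hvt hvs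
    by_contra hv0
    refine hv hv0 ?_
    change ψ (σ ((ψ).symm (q v))) - q v = 0
    rw [hvs, (ψ).right_inv hvt, sub_self]
  let γ : E → E' := fun x => ψ (f ((φ).symm x))
  have hfc : ContinuousAt (fun x => f ((φ).symm x)) (φ 1) :=
    hf.continuous.continuousAt.comp hφc
  have hγs : ContDiffAt ℝ ∞ γ (φ 1) := by
    rw [← contMDiffAt_iff_contDiffAt]
    refine ContMDiffAt.comp (φ 1) (g := ψ) ?_
      (hf.contMDiffAt.comp _ (contMDiffAt_extChartAt_symm_of_mem hc))
    rw [hφ1, map_one]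
    exact contMDiffAt_extChartAt
  have hγ : HasFDerivAt γ (homDeriv I I' f) (φ 1) := by
    have h1 := hasMFDerivAt_comp_of_eq (hasMFDerivAt_extChartAt_one (I := I') (map_one f))
        (hasMFDerivAt_homDeriv hf) rfl
    have h2 : HasMFDerivAt I 𝓘(ℝ, E') (ψ ∘ f) 1 (homDeriv I I' f : E →L[ℝ] E') :=
      HasMFDerivAt.congr_clm h1 (ContinuousLinearMap.id_comp _)
    exact (hasMFDerivAt_one_iff.1 h2).2
  have hγ1 : γ (φ 1) = ψ 1 := by
    change ψ (f ((φ).symm (φ 1))) = ψ 1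
    rw [hφ1, map_one]
  -- The product of a point of the subgroup and a point of the transversal. Its derivative at the
  -- base point is surjective, so it maps neighbourhoods onto neighbourhoods of the identity.
  let P : E × E → E' := fun z => chartMul I' H (γ z.1, q z.2)
  have hz0 : (γ (φ 1, (0 : E)).1, q (φ 1, (0 : E)).2) = (ψ 1, ψ 1) := by
    change (γ (φ 1), q 0) = _
    rw [hγ1, hq0]
  have hPs : ContDiffAt ℝ ∞ P (φ 1, 0) := by
    refine ContDiffAt.comp (φ 1, (0 : E)) (g := chartMul I' H)
      (f := fun z : E × E => (γ z.1, q z.2)) ?_ ?_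
    · rw [hz0]
      exact contDiffAt_chartMul_left hc'
    · have : ContDiff ℝ ∞ q := contDiff_const.add n.contDiff
      exact (ContDiffAt.comp (φ 1, (0 : E)) (g := γ) (f := Prod.fst) hγs contDiffAt_fst).prodMk
        (this.comp contDiff_snd).contDiffAt
  have hP : HasFDerivAt P ((homDeriv I I' f).coprod n) (φ 1, 0) := by
    have h1 : HasFDerivAt (fun z : E × E => (γ z.1, q z.2)) _ (φ 1, (0 : E)) :=
      (HasFDerivAt.comp (φ 1, (0 : E)) (g := γ) (f := Prod.fst) hγ hasFDerivAt_fst).prodMk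
        (HasFDerivAt.comp (φ 1, (0 : E)) (g := q) (f := Prod.snd) hq hasFDerivAt_snd)
    have h2 := ((contDiffAt_chartMul_left (I := I') (G := H) hc').differentiableAt
      (by simp)).hasFDerivAt
    rw [fderiv_chartMul_one, ← hz0] at h2
    refine (h2.comp (φ 1, (0 : E)) h1).congr_fderiv ?_
    refine ContinuousLinearMap.ext fun v => ?_
    rfl
  have hP0 : P (φ 1, 0) = ψ 1 := by
    change chartMul I' H (γ (φ 1, (0 : E)).1, q (φ 1, (0 : E)).2) = ψ 1
    rw [hz0]
    exact chartMul_one_left hc'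
  have hPstrict : HasStrictFDerivAt P ((homDeriv I I' f).coprod n) (φ 1, 0) :=
    hPs.hasStrictFDerivAt' hP (by simp)
  have hmap := hPstrict.map_nhds_eq_of_surj (LinearMap.range_eq_top.2 fun y => by
    obtain ⟨a, b, hab⟩ := hsurj y
    exact ⟨(a, b), hab⟩)
  rw [hP0] at hmap
  have hfst : Tendsto Prod.fst (𝓝 ((φ 1, 0) : E × E)) (𝓝 (φ 1)) := continuousAt_fst
  have hsnd : Tendsto Prod.snd (𝓝 ((φ 1, 0) : E × E)) (𝓝 (0 : E)) := continuousAt_snd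
  have hcs := extChartAt_source_mem_nhds (I := I') (1 : H)
  have h1 : ∀ᶠ z in 𝓝 ((φ 1, 0) : E × E), f ((φ).symm z.1) ∈ (ψ).source :=
    hfst.eventually (hfc.eventually_mem (by rwa [hφ1, map_one]))
  have h2 : ∀ᶠ z in 𝓝 ((φ 1, 0) : E × E),
      f ((φ).symm z.1) * (ψ).symm (q z.2) ∈ (ψ).source := by
    have h3 : ContinuousAt (fun z : E × E => f ((φ).symm z.1) * (ψ).symm (q z.2)) (φ 1, 0) :=
      (ContinuousAt.comp (x := ((φ 1, 0) : E × E)) (f := Prod.fst) hfc continuousAt_fst).mul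
        (ContinuousAt.comp (x := ((φ 1, 0) : E × E)) (f := Prod.snd) hψq continuousAt_snd)
    refine h3.eventually_mem ?_
    rw [hφ1, hq0, hψ1, map_one, mul_one]
    exact hcs
  have h4 : ∀ᶠ z in 𝓝 ((φ 1, 0) : E × E),
      σ ((ψ).symm (P z)) = (ψ).symm (P z) → (ψ).symm (P z) ∈ f.range := by
    filter_upwards [h1, h2, hsnd.eventually htrans] with z hz1 hz2 hz3 hz
    have e1 : (ψ).symm (P z) = f ((φ).symm z.1) * (ψ).symm (q z.2) := by
      change (ψ).symm (ψ ((ψ).symm (ψ (f ((φ).symm z.1))) * (ψ).symm (q z.2))) = _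
      rw [(ψ).left_inv hz1, (ψ).left_inv hz2]
    -- Cancelling the factor from the subgroup, which `σ` fixes, leaves a fixed point of the
    -- transversal; so that factor is trivial.
    rw [e1, map_mul, hσf, mul_right_inj] at hz
    rw [e1, hz3 hz, hq0, hψ1, mul_one]
    exact ⟨_, rfl⟩
  have h5 : ∀ᶠ y in 𝓝 (ψ 1), σ ((ψ).symm y) = (ψ).symm y → (ψ).symm y ∈ f.range := by
    rw [← hmap]
    exact h4
  filter_upwards [(continuousAt_extChartAt (I := I') (1 : H)).eventually h5, hcs] with h hh hs
  rwa [(ψ).left_inv hs] at hh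

end FixedPoints

/-! ### Functoriality of the differential -/

section HomDeriv

variable {E : Type*} [NormedAddCommGroup E] [NormedSpace ℝ E]
  {M : Type*} [TopologicalSpace M] {I : ModelWithCorners ℝ E M}
  {G : Type*} [TopologicalSpace G] [ChartedSpace M G] [Group G]
  {E' : Type*} [NormedAddCommGroup E'] [NormedSpace ℝ E']
  {M' : Type*} [TopologicalSpace M'] {I' : ModelWithCorners ℝ E' M'}
  {G' : Type*} [TopologicalSpace G'] [ChartedSpace M' G'] [Group G']
  {E'' : Type*} [NormedAddCommGroup E''] [NormedSpace ℝ E'']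
  {M'' : Type*} [TopologicalSpace M''] {I'' : ModelWithCorners ℝ E'' M''}
  {G'' : Type*} [TopologicalSpace G''] [ChartedSpace M'' G''] [Group G'']

theorem homDeriv_id : homDeriv I I (MonoidHom.id G) = ContinuousLinearMap.id ℝ E :=
  (hasMFDerivAt_id (I := I) (1 : G)).mfderiv

variable [I.Boundaryless] [LieGroup I ∞ G] [I'.Boundaryless] [LieGroup I' ∞ G']
  [I''.Boundaryless] [LieGroup I'' ∞ G'']

theorem homDeriv_comp {f : G →* G'} {k : G' →* G''} (hk : ContMDiff I' I'' ∞ k)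
    (hf : ContMDiff I I' ∞ f) :
    homDeriv I I'' (k.comp f) = (homDeriv I' I'' k).comp (homDeriv I I' f) :=
  (hasMFDerivAt_comp_of_eq (hasMFDerivAt_homDeriv hk) (hasMFDerivAt_homDeriv hf)
    (map_one f)).mfderiv

end HomDeriv

/-! ### The pair `(G^ℂ, G)` -/

section Complexification

variable {E : Type*} [NormedAddCommGroup E] [NormedSpace ℝ E] [FiniteDimensional ℝ E]
  {G : Type*} [TopologicalSpace G] [ChartedSpace E G] [Group G] [LieGroup 𝓘(ℝ, E) ∞ G]
  {F : Type*} [NormedAddCommGroup F] [NormedSpace ℂ F]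
  {H : Type*} [TopologicalSpace H] [ChartedSpace F H] [Group H] {ι : G →* H}

namespace IsComplexification

/-- The identification of `𝔤 ⊗ ℂ` with the model space of `G^ℂ`. -/
def modelEquiv (hι : IsComplexification E F ι) : ℂ ⊗[ℝ] GroupLieAlgebra 𝓘(ℝ, E) G ≃ₗ[ℝ] F :=
  hι.lieEquiv

theorem modelEquiv_tmul (hι : IsComplexification E F ι) (c : ℂ) (x : GroupLieAlgebra 𝓘(ℝ, E) G) :
    hι.modelEquiv (c ⊗ₜ x) = c • homDeriv 𝓘(ℝ, E) 𝓘(ℝ, F) ι x :=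
  let d : GroupLieAlgebra 𝓘(ℝ, E) G →ₗ[ℝ] F := (lieDifferential 𝓘(ℝ, E) 𝓘(ℝ, F) ι).toLinearMap
  LinearMap.liftBaseChange_tmul (A := ℂ) d c x

theorem finiteDimensional (hι : IsComplexification E F ι) : FiniteDimensional ℝ F := by
  have _ : FiniteDimensional ℝ (GroupLieAlgebra 𝓘(ℝ, E) G) :=
    inferInstanceAs (FiniteDimensional ℝ E)
  exact hι.modelEquiv.finiteDimensional

variable [FiniteDimensional ℝ F]

/-- On pure tensors this is compatibility of `dι` with brackets, together with the complex
bilinearity of the bracket of `G^ℂ`. -/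
theorem modelEquiv_lie (hι : IsComplexification E F ι)
    (z w : ℂ ⊗[ℝ] GroupLieAlgebra 𝓘(ℝ, E) G) :
    hι.modelEquiv ⁅z, w⁆ = bracketCLM 𝓘(ℝ, F) H (hι.modelEquiv z) (hι.modelEquiv w) := by
  have _ := hι.lieGroup
  have _ : LieGroup 𝓘(ℝ, F) ∞ H := LieGroup.restrictScalars_real
  refine lie_eq_of_tmul hι.modelEquiv.toLinearMap (bracketCLM 𝓘(ℝ, F) H) (fun a b x y => ?_) z w
  simp only [LinearEquiv.coe_coe]
  rw [modelEquiv_tmul, modelEquiv_tmul, modelEquiv_tmul, bracketCLM_smul_left,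
    bracketCLM_smul_right, lie_eq_bracketCLM, mul_smul]
  exact congrArg (fun t : F => a • b • t) (homDeriv_bracketCLM hι.contMDiff x y)

/-- The differential of the conjugation of `G^ℂ`. -/
def conjDifferential (hι : IsComplexification E F ι) : F →L[ℝ] F :=
  LinearMap.toContinuousLinearMap (hι.modelEquiv.toLinearMap ∘ₗ
    (conjInvolution (GroupLieAlgebra 𝓘(ℝ, E) G) :
      ℂ ⊗[ℝ] GroupLieAlgebra 𝓘(ℝ, E) G →ₗ[ℝ] ℂ ⊗[ℝ] GroupLieAlgebra 𝓘(ℝ, E) G) ∘ₗ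
      hι.modelEquiv.symm.toLinearMap)

theorem conjDifferential_modelEquiv (hι : IsComplexification E F ι)
    (z : ℂ ⊗[ℝ] GroupLieAlgebra 𝓘(ℝ, E) G) :
    hι.conjDifferential (hι.modelEquiv z) = hι.modelEquiv (conjInvolution _ z) := by
  simp [conjDifferential]

theorem conjDifferential_bracketCLM (hι : IsComplexification E F ι) (x y : F) :
    hι.conjDifferential (bracketCLM 𝓘(ℝ, F) H x y) =
      bracketCLM 𝓘(ℝ, F) H (hι.conjDifferential x) (hι.conjDifferential y) := by
  obtain ⟨z, rfl⟩ := hι.modelEquiv.surjective x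
  obtain ⟨w, rfl⟩ := hι.modelEquiv.surjective y
  rw [← modelEquiv_lie, conjDifferential_modelEquiv, conjDifferential_modelEquiv,
    conjDifferential_modelEquiv, LieHom.map_lie, modelEquiv_lie]

theorem conjDifferential_conjDifferential (hι : IsComplexification E F ι) (x : F) :
    hι.conjDifferential (hι.conjDifferential x) = x := by
  obtain ⟨z, rfl⟩ := hι.modelEquiv.surjective x
  obtain ⟨x, y, rfl⟩ := exists_eq_one_tmul_add_I_tmul z
  simp [conjDifferential_modelEquiv, conjInvolution]

theorem conjDifferential_homDeriv (hι : IsComplexification E F ι) (x : E) :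
    hι.conjDifferential (homDeriv 𝓘(ℝ, E) 𝓘(ℝ, F) ι x) = homDeriv 𝓘(ℝ, E) 𝓘(ℝ, F) ι x := by
  let x' : GroupLieAlgebra 𝓘(ℝ, E) G := x
  have h := hι.conjDifferential_modelEquiv ((1 : ℂ) ⊗ₜ x')
  rwa [conjInvolution_tmul, map_one, modelEquiv_tmul, one_smul] at h

theorem conjDifferential_I_smul (hι : IsComplexification E F ι) (x : E) :
    hι.conjDifferential ((Complex.I • homDeriv 𝓘(ℝ, E) 𝓘(ℝ, F) ι) x) =
      -(Complex.I • homDeriv 𝓘(ℝ, E) 𝓘(ℝ, F) ι) x := by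
  let x' : GroupLieAlgebra 𝓘(ℝ, E) G := x
  have h := hι.conjDifferential_modelEquiv (Complex.I ⊗ₜ x')
  rwa [conjInvolution_tmul, Complex.conj_I, modelEquiv_tmul, modelEquiv_tmul, neg_smul] at h

/-- If `√-1 ⊗ x` vanishes, then `B^ℂ` on it, which is `-B x x`, vanishes too, and `x = 0` by
positivity. -/
theorem injective_I_smul (hι : IsComplexification E F ι)
    {B : LinearMap.BilinForm ℝ (GroupLieAlgebra 𝓘(ℝ, E) G)} (hB : IsInvariantInnerProduct B) :
    Function.Injective (Complex.I • homDeriv 𝓘(ℝ, E) 𝓘(ℝ, F) ι) := by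
  refine (injective_iff_map_eq_zero _).2 fun x hx => ?_
  let x' : GroupLieAlgebra 𝓘(ℝ, E) G := x
  have h1 : hι.modelEquiv (Complex.I ⊗ₜ x') = 0 := by rw [modelEquiv_tmul]; exact hx
  have h2 := (map_eq_zero_iff _ hι.modelEquiv.injective).1 h1
  by_contra h
  have h3 : B.baseChange ℂ (Complex.I ⊗ₜ x') (Complex.I ⊗ₜ x') = 0 := by rw [h2, map_zero]
  have h4 : B x' x' = 0 := by simpa using h3
  exact (hB.pos x' h).ne' h4

theorem exists_homDeriv_add_I_smul (hι : IsComplexification E F ι) (y : F) :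
    ∃ a b, homDeriv 𝓘(ℝ, E) 𝓘(ℝ, F) ι a + (Complex.I • homDeriv 𝓘(ℝ, E) 𝓘(ℝ, F) ι) b = y := by
  obtain ⟨z, rfl⟩ := hι.modelEquiv.surjective y
  obtain ⟨a, b, rfl⟩ := exists_eq_one_tmul_add_I_tmul z
  refine ⟨a, b, ?_⟩
  rw [map_add, modelEquiv_tmul, modelEquiv_tmul, one_smul]
  rfl

/-- `σ ∘ σ = id` and `σ ∘ ι = ι` hold because they hold for differentials and both groups are
connected. The transversal is spanned by `√-1 𝔤`, on which the differential of `σ` is `-1`; this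
also shows `σ ≠ id`. -/
theorem isSymmetricPairWith (hι : IsComplexification E F ι) [Nontrivial E] [T2Space H]
    [PreconnectedSpace G] {B : LinearMap.BilinForm ℝ (GroupLieAlgebra 𝓘(ℝ, E) G)}
    (hB : IsInvariantInnerProduct B) {σ : H →* H} (hσ : ContMDiff 𝓘(ℝ, F) 𝓘(ℝ, F) ∞ σ)
    (hσd : homDeriv 𝓘(ℝ, F) 𝓘(ℝ, F) σ = hι.conjDifferential) :
    IsSymmetricPairWith 𝓘(ℝ, F) ι.range σ := by
  have _ := hι.lieGroup
  have _ := hι.simplyConnected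
  have _ : LieGroup 𝓘(ℝ, F) ∞ H := LieGroup.restrictScalars_real
  have _ : IsTopologicalGroup H := topologicalGroup_of_lieGroup 𝓘(ℝ, F) ∞
  have hσσ : σ.comp σ = MonoidHom.id H := by
    refine MonoidHom.eq_of_homDeriv_eq (I := 𝓘(ℝ, F)) (I' := 𝓘(ℝ, F)) (hσ.comp hσ) contMDiff_id ?_
    rw [homDeriv_comp hσ hσ, homDeriv_id, hσd]
    exact ContinuousLinearMap.ext hι.conjDifferential_conjDifferential
  have hσι : σ.comp ι = ι := by
    refine MonoidHom.eq_of_homDeriv_eq (I := 𝓘(ℝ, E)) (I' := 𝓘(ℝ, F)) (hσ.comp hι.contMDiff)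
      hι.contMDiff ?_
    rw [homDeriv_comp hσ hι.contMDiff, hσd]
    exact ContinuousLinearMap.ext hι.conjDifferential_homDeriv
  have hfix : ∀ h ∈ ι.range, σ h = h := by
    rintro _ ⟨g, rfl⟩
    exact DFunLike.congr_fun hσι g
  have hloc : ∀ᶠ h in 𝓝 (1 : H), σ h = h → h ∈ ι.range := by
    refine eventually_mem_range_of_fixed (I := 𝓘(ℝ, E)) (I' := 𝓘(ℝ, F)) hι.contMDiff hσ
      (fun g => hfix _ ⟨g, rfl⟩) (hι.injective_I_smul hB) (fun x => ?_)
      hι.exists_homDeriv_add_I_smul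
    rw [hσd]
    exact hι.conjDifferential_I_smul x
  refine ⟨inferInstance, isClosed_of_eventually_fixed hσ.continuous hfix hloc, hσ,
    fun h => DFunLike.congr_fun hσσ h, fun h => ?_,
    connectedComponentIn_fixed_subset hσ.continuous hfix hloc, hfix⟩
  obtain ⟨x, hx⟩ := exists_ne (0 : E)
  have h1 := hι.conjDifferential_I_smul x
  rw [← hσd, h, homDeriv_id] at h1
  have h2 := eq_zero_of_neg_eq_self h1.symm
  exact hx (hι.injective_I_smul hB (h2.trans (map_zero _).symm))

theorem exists_isLegendrianSymmetricPairVia (hι : IsComplexification E F ι) [Nontrivial E]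
    [T2Space H] [PreconnectedSpace G] {B : LinearMap.BilinForm ℝ (GroupLieAlgebra 𝓘(ℝ, E) G)}
    (hB : IsInvariantInnerProduct B) :
    ∃ σ : H →* H, IsLegendrianSymmetricPairVia 𝓘(ℝ, F) ι.range σ
      (conjInvolution (GroupLieAlgebra 𝓘(ℝ, E) G)) (imPairing B) hι.lieEquiv := by
  have _ := hι.lieGroup
  have _ := hι.simplyConnected
  have _ : LieGroup 𝓘(ℝ, F) ∞ H := LieGroup.restrictScalars_real
  have _ : LocallyPathConnectedSpace H := ChartedSpace.locallyPathConnectedSpace F H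
  -- The conjugation of `𝔤 ⊗ ℂ` is a real Lie algebra homomorphism and `G^ℂ` is simply connected, so
  -- it integrates to `σ`. Group invariance of `Λ₋` then follows from connectedness of `G^ℂ`.
  obtain ⟨σ, hσ, hσd⟩ := exists_monoidHom_homDeriv_eq (I := 𝓘(ℝ, F)) (I' := 𝓘(ℝ, F)) (G := H)
    (G' := H) hι.conjDifferential_bracketCLM
  have hlie (x y : ℂ ⊗[ℝ] GroupLieAlgebra 𝓘(ℝ, E) G) :
      hι.lieEquiv ⁅x, y⁆ = ⁅hι.lieEquiv x, hι.lieEquiv y⁆ := by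
    rw [lie_eq_bracketCLM]
    exact hι.modelEquiv_lie x y
  refine ⟨σ, (hι.isSymmetricPairWith hB hσ hσd).isLegendrianSymmetricPairVia
    (imPairing_isLegendrianStructure hB) hlie (fun x => ?_) (groupAd_invariant_inv ?_)⟩
  · refine Eq.trans ?_ (hι.conjDifferential_modelEquiv x)
    exact congrArg (fun T => T (hι.modelEquiv x)) hσd
  · intro x y z
    obtain ⟨x, rfl⟩ := hι.lieEquiv.surjective x
    obtain ⟨y, rfl⟩ := hι.lieEquiv.surjective y
    obtain ⟨z, rfl⟩ := hι.lieEquiv.surjective z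
    rw [← hlie, ← hlie]
    simpa only [LinearMap.BilinForm.congr_apply, LinearEquiv.symm_apply_apply] using
      (imPairing_isLegendrianStructure hB).invariant x y z

end IsComplexification

end Complexification

end

end

/-! ### The three families of examples -/

theorem mainTheorem6 :
    -- the Lie algebra `𝔤 ⋊ 𝔤*`
    (∀ (𝔤 : Type*) [LieRing 𝔤] [LieAlgebra ℝ 𝔤],
      IsLegendrianStructure (CoadjointLie.involution 𝔤) (CoadjointLie.pairing 𝔤)) ∧
    -- the pair `(G ⋊ 𝔤*, G)`
    (∀ (E : Type*) [NormedAddCommGroup E] [NormedSpace ℝ E] [FiniteDimensional ℝ E] [Nontrivial E]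
      (G : Type*) [TopologicalSpace G] [T2Space G] [ChartedSpace E G] [Group G]
      [LieGroup 𝓘(ℝ, E) ∞ G],
      IsLegendrianSymmetricPair (CoadjointGroup.model E) (CoadjointGroup.inl E G).range ∧
      IsLegendrianSymmetricPairVia (CoadjointGroup.model E) (CoadjointGroup.inl E G).range
        (CoadjointGroup.groupInvolution E G)
        (CoadjointLie.involution (GroupLieAlgebra 𝓘(ℝ, E) G))
        (CoadjointLie.pairing (GroupLieAlgebra 𝓘(ℝ, E) G))
        (CoadjointGroup.lieEquiv E G)) ∧
    -- the Lie algebra `𝔤 × 𝔤`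
    (∀ (𝔤 : Type*) [LieRing 𝔤] [LieAlgebra ℝ 𝔤] (B : LinearMap.BilinForm ℝ 𝔤),
      IsInvariantInnerProduct B →
      IsLegendrianStructure (swapInvolution 𝔤) (productPairing B)) ∧
    -- the pair `(G × G, Δ(G))`
    (∀ (E : Type*) [NormedAddCommGroup E] [NormedSpace ℝ E] [FiniteDimensional ℝ E] [Nontrivial E]
      (G : Type*) [TopologicalSpace G] [T2Space G] [ChartedSpace E G] [Group G]
      [LieGroup 𝓘(ℝ, E) ∞ G] [ConnectedSpace G]
      (B : LinearMap.BilinForm ℝ (GroupLieAlgebra 𝓘(ℝ, E) G)),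
      IsInvariantInnerProduct B →
      IsLegendrianSymmetricPair (𝓘(ℝ, E).prod 𝓘(ℝ, E)) (diagonalSubgroup G) ∧
      IsLegendrianSymmetricPairVia (𝓘(ℝ, E).prod 𝓘(ℝ, E)) (diagonalSubgroup G) (groupSwap G)
        (swapInvolution (GroupLieAlgebra 𝓘(ℝ, E) G)) (productPairing B)
        (productLieEquiv E G)) ∧
    -- the Lie algebra `𝔤 ⊗ ℂ`
    (∀ (𝔤 : Type*) [LieRing 𝔤] [LieAlgebra ℝ 𝔤] (B : LinearMap.BilinForm ℝ 𝔤),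
      IsInvariantInnerProduct B →
      ((∀ x y : 𝔤, B.baseChange ℂ (1 ⊗ₜ[ℝ] x) (1 ⊗ₜ[ℝ] y) = B x y) ∧
        (B.baseChange ℂ).IsSymm ∧ (B.baseChange ℂ).Nondegenerate ∧
        IsAdInvariant (B.baseChange ℂ)) ∧
      IsLegendrianStructure (conjInvolution 𝔤) (imPairing B)) ∧
    -- the pair `(G^ℂ, G)`
    (∀ (E : Type*) [NormedAddCommGroup E] [NormedSpace ℝ E] [FiniteDimensional ℝ E] [Nontrivial E]
      (G : Type*) [TopologicalSpace G] [T2Space G] [ChartedSpace E G] [Group G]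
      [LieGroup 𝓘(ℝ, E) ∞ G] [SimplyConnectedSpace G]
      (B : LinearMap.BilinForm ℝ (GroupLieAlgebra 𝓘(ℝ, E) G))
      (F : Type*) [NormedAddCommGroup F] [NormedSpace ℂ F]
      (H : Type*) [TopologicalSpace H] [T2Space H] [ChartedSpace F H] [Group H]
      (ι : G →* H) (hι : IsComplexification E F ι),
      IsInvariantInnerProduct B →
      IsLegendrianSymmetricPair 𝓘(ℝ, F) ι.range ∧
      ∃ σ : H →* H,
        IsLegendrianSymmetricPairVia 𝓘(ℝ, F) ι.range σ
          (conjInvolution (GroupLieAlgebra 𝓘(ℝ, E) G)) (imPairing B) hι.lieEquiv) := by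
  refine ⟨fun 𝔤 _ _ => CoadjointLie.isLegendrianStructure, fun E _ _ _ _ G _ _ _ _ _ => ?_,
    fun 𝔤 _ _ B hB => productPairing_isLegendrianStructure hB,
    fun E _ _ _ _ G _ _ _ _ _ _ B hB => ?_,
    fun 𝔤 _ _ B hB => ⟨⟨fun x y => by simp, baseChange_isSymm hB.symm,
      LinearMap.BilinForm.nondegenerate_of_isSymm (baseChange_isSymm hB.symm) fun z hz =>
        baseChange_nondegenerate hB fun w => by rw [hz w, Complex.zero_im],
      baseChange_isAdInvariant hB.invariant⟩, imPairing_isLegendrianStructure hB⟩,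
    fun E _ _ _ _ G _ _ _ _ _ _ B F _ _ H _ _ _ _ ι hι hB => ?_⟩
  · have h := CoadjointGroup.isLegendrianSymmetricPairVia_groupInvolution (E := E) (G := G)
    exact ⟨h.isLegendrianSymmetricPair, h⟩
  · have h := isLegendrianSymmetricPairVia_groupSwap (E := E) (G := G) hB
    exact ⟨h.isLegendrianSymmetricPair, h⟩
  -- The model space of `G^ℂ` is finite-dimensional because it is isomorphic to `𝔤 ⊗ ℂ`.
  · have _ := hι.finiteDimensional
    have h := hι.exists_isLegendrianSymmetricPairVia hB
    exact ⟨h.choose_spec.isLegendrianSymmetricPair, h⟩
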